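/- Let $S=\{F=0\}\subset\mathbb P^3(\mathbb C)$ be a smooth cubic surface, let $\ell_1,\ell_2\subset S$ be two skew lines (i.e. $\ell_1\cap\ell_2=\emptyset$), let $m\subset S$ be a line meeting both $\ell_1$ and $\ell_2$, and let $H\subset\mathbb P^3$ be a plane containing $m$ but neither $\ell_1$ nor $\ell_2$. 1. For every $x\in H$ with $x\notin\ell_1\cup\ell_2$ there is a unique line $\ell_x$ through $x$ meeting both $\ell_1$ and $\ell_2$. If $\ell_x\not\subset S$, there is a unique point $q_x\in S$ such that the intersection of $\ell_x$ with $S$, counted with multiplicity, is $(\ell_x\cap\ell_1)+(\ell_x\cap\ell_2)+q_x$. 2. Choose any linear coordinates $H\cong\mathbb P^2$. The partial map $\Phi(x)=q_x$, defined for the points $x\in H\setminus(\ell_1\cup\ell_2)$ with $\ell_x\not\subset S$, is a birational map $\Phi:\mathbb P^2\dashrightarrow S$. It is given by cubic polynomials: there are homogeneous polynomials $\varphi_0,\dots,\varphi_3$ of degree $3$ in three variables, without a nonconstant common factor, such that at every point where $\Phi$ is defined they are not all zero and $\Phi=(\varphi_0:\varphi_1:\varphi_2:\varphi_3)$. 3.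 Suppose moreover that $F$ has real coefficients and that $\ell_1,\ell_2$ are either both real or complex conjugate to each other. Then $m$ and $H$ as above can be chosen to be real, with real linear coordinates on $H$. For every such real choice, $\Phi$ is birational over $\mathbb R$ (the map and its inverse are given by homogeneous polynomials with real coefficients), and the cubic polynomials $\varphi_i$ in 2 (without a nonconstant common factor) can be taken with real coefficients. -/

import Mathlib

open scoped LinearAlgebra.Projectivization

noncomputable section

/-- Complex projective space of dimension `n - 1`, with `n` homogeneous coordinates. -/
abbrev PSpace (n : ℕ) : Type := ℙ ℂ (Fin n → ℂ)

/-! ### Zariski topology and birational maps -/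

/-- A Zariski closed set: the common zeros of a set of homogeneous polynomials. -/
def IsZariskiClosed {n : ℕ} (Z : Set (PSpace n)) : Prop :=
  ∃ I : Set (MvPolynomial (Fin n) ℂ), (∀ g ∈ I, ∃ d : ℕ, g.IsHomogeneous d) ∧
    Z = {x | ∀ g ∈ I, MvPolynomial.eval x.rep g = 0}

/-- `U` is a Zariski open and Zariski dense subset of `X` (for the induced topology on `X`). -/
def IsDenseOpenIn {n : ℕ} (U X : Set (PSpace n)) : Prop :=
  (∃ Z : Set (PSpace n), IsZariskiClosed Z ∧ U = X \ Z) ∧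
    ∀ Z : Set (PSpace n), IsZariskiClosed Z → U ⊆ Z → X ⊆ Z

/-- The tuple of forms `φ` (with coefficients in a subfield `k` of `ℂ`) does not vanish
identically at `x`, and `y` is the point with homogeneous coordinates `φ(x)`.
(For forms of one common degree this does not depend on the representative of `x`.) -/
def SendsTo {k : Type} [Field k] [Algebra k ℂ] {n r : ℕ}
    (φ : Fin r → MvPolynomial (Fin n) k) (x : PSpace n) (y : PSpace r) : Prop :=
  ∃ h : (fun i => MvPolynomial.aeval x.rep (φ i) : Fin r → ℂ) ≠ 0,
    Projectivization.mk ℂ _ h = y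

/-- The partial map `Φ` is a birational map from `X` to `Y`, defined over the subfield `k`:
it is defined on a dense open `U ⊆ X` and restricts to a bijection of `U` with a dense open
`V ⊆ Y` such that this bijection and its inverse are given by forms with coefficients
in `k`. -/
def IsBirationalOver (k : Type) [Field k] [Algebra k ℂ] {n r : ℕ}
    (X : Set (PSpace n)) (Y : Set (PSpace r)) (Φ : PSpace n →. PSpace r) : Prop :=
  ∃ (a b : ℕ) (φ : Fin r → MvPolynomial (Fin n) k) (ψ : Fin n → MvPolynomial (Fin r) k),
    (∀ i, (φ i).IsHomogeneous a) ∧ (∀ j, (ψ j).IsHomogeneous b) ∧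
    ∃ (U : Set (PSpace n)) (V : Set (PSpace r)),
      IsDenseOpenIn U X ∧ IsDenseOpenIn V Y ∧
      (∀ x ∈ U, ∃ y ∈ V, y ∈ Φ x ∧ SendsTo φ x y ∧ SendsTo ψ y x) ∧
      (∀ y ∈ V, ∃ x ∈ U, y ∈ Φ x ∧ SendsTo φ x y ∧ SendsTo ψ y x)

/-- The partial map `Φ` is given by forms of degree `d` over `k` without a nonconstant common
factor, which are not all zero at any point where `Φ` is defined. -/
def IsGivenByFormsOver (k : Type) [Field k] [Algebra k ℂ] {n r : ℕ}
    (d : ℕ) (Φ : PSpace n →. PSpace r) : Prop :=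
  ∃ φ : Fin r → MvPolynomial (Fin n) k,
    (∀ i, (φ i).IsHomogeneous d) ∧
    (∀ g : MvPolynomial (Fin n) k, (∀ i, g ∣ φ i) → IsUnit g) ∧
    ∀ x y, y ∈ Φ x → SendsTo φ x y

/-! ### Cubic surfaces and lines

Linear subspaces of projective space are written as the corresponding linear subspaces
of `ℂ⁴`: lines have dimension `2` and planes have dimension `3`. -/

/-- `F` defines a smooth cubic surface in projective 3-space. -/
def IsSmoothCubic (F : MvPolynomial (Fin 4) ℂ) : Prop :=
  F.IsHomogeneous 3 ∧
    ∀ v : Fin 4 → ℂ, v ≠ 0 → MvPolynomial.eval v F = 0 →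
      ∃ i, MvPolynomial.eval v (MvPolynomial.pderiv i F) ≠ 0

/-- The surface `F = 0`. -/
def surface (F : MvPolynomial (Fin 4) ℂ) : Set (PSpace 4) :=
  {x | MvPolynomial.eval x.rep F = 0}

/-- The linear subspace `W` is contained in the surface `F = 0`. -/
def LiesOn (F : MvPolynomial (Fin 4) ℂ) (W : Submodule ℂ (Fin 4 → ℂ)) : Prop :=
  ∀ v ∈ W, MvPolynomial.eval v F = 0

/-- `L` is a line on the surface `F = 0`. -/
def IsLineOn (F : MvPolynomial (Fin 4) ℂ) (L : Submodule ℂ (Fin 4 → ℂ)) : Prop :=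
  Module.finrank ℂ L = 2 ∧ LiesOn F L

/-- `L` is a line through the point `x` that meets both `ℓ₁` and `ℓ₂`. -/
def IsTransversal (ℓ₁ ℓ₂ : Submodule ℂ (Fin 4 → ℂ)) (x : PSpace 4)
    (L : Submodule ℂ (Fin 4 → ℂ)) : Prop :=
  Module.finrank ℂ L = 2 ∧ x.submodule ≤ L ∧ L ⊓ ℓ₁ ≠ ⊥ ∧ L ⊓ ℓ₂ ≠ ⊥

/-- The cubic `F` cuts the divisor `a + b + c` on the line `L`: restricted to `L` it is the
product of three linear forms whose zeros on `L` are the points `a`, `b` and `c`.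
In particular `F` does not vanish identically on `L`. -/
def CutsDivisor (F : MvPolynomial (Fin 4) ℂ) (L : Submodule ℂ (Fin 4 → ℂ))
    (a b c : PSpace 4) : Prop :=
  a.submodule ≤ L ∧ b.submodule ≤ L ∧ c.submodule ≤ L ∧
    ∃ α β γ : Module.Dual ℂ (Fin 4 → ℂ),
      (∀ v ∈ L, α v = 0 ↔ v ∈ a.submodule) ∧
      (∀ v ∈ L, β v = 0 ↔ v ∈ b.submodule) ∧
      (∀ v ∈ L, γ v = 0 ↔ v ∈ c.submodule) ∧
      ∀ v ∈ L, MvPolynomial.eval v F = α v * β v * γ v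

/-- `q` is the third intersection point (counted with multiplicity) with `F = 0` of the
unique line through `x` that meets `ℓ₁` and `ℓ₂`; the other two are the points of that line
on `ℓ₁` and `ℓ₂`. -/
def IsThirdPoint (F : MvPolynomial (Fin 4) ℂ) (ℓ₁ ℓ₂ : Submodule ℂ (Fin 4 → ℂ))
    (x q : PSpace 4) : Prop :=
  ∃ L, (IsTransversal ℓ₁ ℓ₂ x L ∧ ∀ L', IsTransversal ℓ₁ ℓ₂ x L' → L' = L) ∧
    ∃ p₁ p₂ : PSpace 4, p₁.submodule ≤ ℓ₁ ∧ p₂.submodule ≤ ℓ₂ ∧ CutsDivisor F L p₁ p₂ q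

/-- The partial map `x ↦ q_x`, defined where there is exactly one such point `q_x`. -/
def thirdPointMap (F : MvPolynomial (Fin 4) ℂ) (ℓ₁ ℓ₂ : Submodule ℂ (Fin 4 → ℂ)) :
    PSpace 4 →. PSpace 4 :=
  fun x => ⟨∃! q, IsThirdPoint F ℓ₁ ℓ₂ x q, fun h => h.choose⟩

/-- The map `Φ`, in the homogeneous coordinates on the plane given by an injective linear
map `E` with image that plane. -/
def planeMap (F : MvPolynomial (Fin 4) ℂ) (ℓ₁ ℓ₂ : Submodule ℂ (Fin 4 → ℂ))
    (E : (Fin 3 → ℂ) →ₗ[ℂ] (Fin 4 → ℂ)) (hE : Function.Injective E) : PSpace 3 →. PSpace 4 :=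
  fun y => thirdPointMap F ℓ₁ ℓ₂ (Projectivization.map E hE y)

/-- `m` is a line on the surface `F = 0` that meets `ℓ₁` and `ℓ₂`, and `H` is a plane
containing `m` but neither `ℓ₁` nor `ℓ₂`. -/
def IsAdmissible (F : MvPolynomial (Fin 4) ℂ) (ℓ₁ ℓ₂ m H : Submodule ℂ (Fin 4 → ℂ)) : Prop :=
  IsLineOn F m ∧ m ⊓ ℓ₁ ≠ ⊥ ∧ m ⊓ ℓ₂ ≠ ⊥ ∧
    Module.finrank ℂ H = 3 ∧ m ≤ H ∧ ¬ ℓ₁ ≤ H ∧ ¬ ℓ₂ ≤ H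

/-! ### Real structures; `star` is coordinatewise complex conjugation -/

/-- The linear subspace `W` is defined over `ℝ`. -/
def IsRealSubspace (W : Submodule ℂ (Fin 4 → ℂ)) : Prop :=
  ∀ v ∈ W, star v ∈ W

/-- The linear subspaces `W₁` and `W₂` are complex conjugate. -/
def AreConjugate (W₁ W₂ : Submodule ℂ (Fin 4 → ℂ)) : Prop :=
  ∀ v, v ∈ W₁ ↔ star v ∈ W₂

/-- The linear coordinates `E` are defined over `ℝ`. -/
def IsRealMap (E : (Fin 3 → ℂ) →ₗ[ℂ] (Fin 4 → ℂ)) : Prop :=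
  ∀ y, E (star y) = star (E y)

end

/-! ### Polarization of a smooth cubic form -/

/-! Let `T` be the symmetric trilinear form with `F(v) = T v v v`, and split `ℂ⁴ = ℓ₁ ⊕ ℓ₂` with
projections `P`, `Q`. Since `F` vanishes on both lines, only its mixed parts `A` (bidegree (2,1))
and `B` (bidegree (1,2)) survive. The transversal through `v` is spanned by `P v` and `Q v`, and
there `F(s P v + t Q v) = s t (s A + t B)`. The factors `t` and `s` are the points on `ℓ₁` and `ℓ₂`;
the third point is therefore `B · P v − A · Q v`, a vector of quartic forms (`cubic_transversal`,
`mem_thirdPointMap_iff`).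

On the plane `H`, both `A` and `B` vanish along `m`, because `m` is a transversal contained in the
surface. Cancelling the equation `w` of `m` leaves cubic forms (`thirdVec_E`). The inverse sends a
point of the surface to the point of `H` on its transversal and is given by quadrics
(`planeVec_thirdVec`, `thirdVec_planeVec`).

Smoothness enters through two facts. The polar `T a a` of a nonzero `a ∈ ℓ₁` is nonzero on `ℓ₂`
(`exists_polar_ne`), and along a transversal contained in the surface a certain 2×2 determinant is
nonzero (`jacobian_ne`), since otherwise that transversal would carry a singular point. The
determinant is used three times: to show that the cubics have no common factor
(`isUnit_of_dvd_quadrics`), to reach by a limit the points of the surface on contained transversals,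
so that third points are Zariski dense (`eval_eq_zero_of_cubic`), and to show that a quintic has
simple roots.

In the real case, conjugation fixes or exchanges the two lines, so the forms commute with it up to a
constant and can be rescaled to real ones (`exists_real_forms`). A real `m` exists by parity. The
contained transversals correspond to the roots of a separable quintic, so there are exactly five
(`ncard_surfaceTransversals`), and the involution given by conjugation on five objects has a fixed
point. A general real plane through `m` then serves as `H`. -/

theorem MvPolynomial.pderiv_pderiv_comm {R σ : Type*} [CommRing R] (i j : σ)
    (f : MvPolynomial σ R) : pderiv i (pderiv j f) = pderiv j (pderiv i f) := by
  have h : ⁅pderiv (R := R) i, pderiv (R := R) j⁆ = 0 := by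
    classical
    refine MvPolynomial.derivation_ext fun k => ?_
    rw [Derivation.commutator_apply]
    simp [pderiv_X, Pi.single_apply, apply_ite]
  have := congrArg (fun D => D f) h
  simpa [Derivation.commutator_apply, sub_eq_zero] using this

theorem MvPolynomial.IsHomogeneous.sum_mul_eval_pderiv {n d : ℕ}
    {f : MvPolynomial (Fin n) ℂ} (hf : f.IsHomogeneous d) (v : Fin n → ℂ) :
    ∑ i, v i * eval v (pderiv i f) = d * eval v f := by
  have := congrArg (eval v) hf.sum_X_mul_pderiv
  simpa using this

/-- Trilinear forms on `ℂ⁴`. -/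
abbrev Trilinear : Type :=
  (Fin 4 → ℂ) →ₗ[ℂ] (Fin 4 → ℂ) →ₗ[ℂ] (Fin 4 → ℂ) →ₗ[ℂ] ℂ

/-- Meant for `c` the array of third partial derivatives of a cubic; the factor 1/6 = 1/3! then
makes the diagonal of `T` equal to the cubic. -/
theorem exists_trilinear (c : Fin 4 → Fin 4 → Fin 4 → ℂ) :
    ∃ T : Trilinear, ∀ u v w,
      T u v w = ∑ k, ((1 / 6) * ∑ i, ∑ j, c i j k * u i * v j) * w k := by
  refine ⟨LinearMap.mk₂ ℂ
    (fun u v => ∑ k, ((1 / 6) * ∑ i, ∑ j, c i j k * u i * v j) • LinearMap.proj k)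
    (fun u u' v => by
      simp only [Pi.add_apply, mul_add, add_mul, Finset.sum_add_distrib, add_smul])
    (fun r u v => by
      simp only [Pi.smul_apply, smul_eq_mul, Finset.smul_sum, smul_smul, Finset.mul_sum]
      refine Finset.sum_congr rfl fun k _ => ?_
      congr 1
      refine Finset.sum_congr rfl fun i _ => Finset.sum_congr rfl fun j _ => ?_
      ring)
    (fun u v v' => by
      simp only [Pi.add_apply, mul_add, Finset.sum_add_distrib, add_smul])
    (fun r u v => by
      simp only [Pi.smul_apply, smul_eq_mul, Finset.smul_sum, smul_smul, Finset.mul_sum]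
      refine Finset.sum_congr rfl fun k _ => ?_
      congr 1
      refine Finset.sum_congr rfl fun i _ => Finset.sum_congr rfl fun j _ => ?_
      ring), fun u v w => ?_⟩
  simp [LinearMap.sum_apply]

/-- The third partials of a cubic are constants, and Euler's identity in degrees 1, 2 and 3 recovers
second partials, gradient and `F` from them. In particular `T v v w` is one third of the derivative
of `F` at `v` along `w`, which turns smoothness into the last clause. -/
theorem IsSmoothCubic.exists_polarization {F : MvPolynomial (Fin 4) ℂ} (hF : IsSmoothCubic F) :
    ∃ T : Trilinear, (∀ u v w, T u v w = T v u w) ∧ (∀ u v w, T u v w = T u w v) ∧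
      (∀ v, MvPolynomial.eval v F = T v v v) ∧
      (∀ v, v ≠ 0 → T v v v = 0 → ∃ w, T v v w ≠ 0) := by
  obtain ⟨hhom, hns⟩ := hF
  obtain ⟨c, hc⟩ : ∃ c : Fin 4 → Fin 4 → Fin 4 → ℂ, ∀ i j k, c i j k =
    MvPolynomial.eval 0 (MvPolynomial.pderiv i (MvPolynomial.pderiv j (MvPolynomial.pderiv k F))) :=
    ⟨_, fun _ _ _ => rfl⟩
  have c12 : ∀ i j k, c i j k = c j i k := fun i j k => by
    simp only [hc]; rw [MvPolynomial.pderiv_pderiv_comm i j]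
  have c23 : ∀ i j k, c i j k = c i k j := fun i j k => by
    simp only [hc]; rw [MvPolynomial.pderiv_pderiv_comm j k]
  obtain ⟨T, hT⟩ := exists_trilinear c
  have e0 : ∀ v i j k, MvPolynomial.eval v
      (MvPolynomial.pderiv i (MvPolynomial.pderiv j (MvPolynomial.pderiv k F))) = c i j k := by
    intro v i j k
    have h0 : (MvPolynomial.pderiv i (MvPolynomial.pderiv j
        (MvPolynomial.pderiv k F))).IsHomogeneous 0 := hhom.pderiv.pderiv.pderiv
    rw [← MvPolynomial.totalDegree_zero_iff_isHomogeneous,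
      MvPolynomial.totalDegree_eq_zero_iff_eq_C] at h0
    simp only [hc]
    rw [h0]; simp
  have e1 : ∀ v j k, MvPolynomial.eval v (MvPolynomial.pderiv j (MvPolynomial.pderiv k F)) =
      ∑ i, v i * c i j k := by
    intro v j k
    have := (hhom.pderiv (i := k)).pderiv (i := j) |>.sum_mul_eval_pderiv v
    simp only [e0] at this
    rw [this]; norm_num
  have e2 : ∀ v k, 2 * MvPolynomial.eval v (MvPolynomial.pderiv k F) =
      ∑ j, v j * ∑ i, v i * c i j k := by
    intro v k
    have := (hhom.pderiv (i := k)).sum_mul_eval_pderiv v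
    simp only [e1] at this
    rw [this]; norm_num
  have e3 : ∀ v w, T v v w = (1 / 3) * ∑ k, w k * MvPolynomial.eval v (MvPolynomial.pderiv k F) := by
    intro v w
    rw [hT, Finset.mul_sum]
    refine Finset.sum_congr rfl fun k _ => ?_
    have h := e2 v k
    have : ∑ i, ∑ j, c i j k * v i * v j = ∑ j, v j * ∑ i, v i * c i j k := by
      rw [Finset.sum_comm]
      simp only [Finset.mul_sum]
      refine Finset.sum_congr rfl fun i _ => Finset.sum_congr rfl fun j _ => ?_
      ring
    rw [this, ← h]; ring
  have hdiag : ∀ v, MvPolynomial.eval v F = T v v v := by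
    intro v
    rw [e3, hhom.sum_mul_eval_pderiv v]; push_cast; ring
  refine ⟨T, ?_, ?_, hdiag, ?_⟩
  · intro u v w
    rw [hT, hT]
    refine Finset.sum_congr rfl fun k _ => ?_
    rw [Finset.sum_comm]
    congr 2
    refine Finset.sum_congr rfl fun i _ => Finset.sum_congr rfl fun j _ => ?_
    rw [c12 i j]; ring
  · intro u v w
    rw [hT, hT]
    simp only [Finset.mul_sum, Finset.sum_mul]
    rw [Finset.sum_comm]
    conv_rhs => rw [Finset.sum_comm]
    refine Finset.sum_congr rfl fun i _ => ?_
    rw [Finset.sum_comm]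
    refine Finset.sum_congr rfl fun k _ => Finset.sum_congr rfl fun j _ => ?_
    rw [c23 i j k]; ring
  · intro v hv h0
    rw [← hdiag] at h0
    obtain ⟨i, hi⟩ := hns v hv h0
    refine ⟨Pi.single i 1, ?_⟩
    rw [e3, Finset.sum_eq_single i]
    · simpa using hi
    · intro j _ hj; simp [hj]
    · simp

/-! ### Two skew lines on a smooth cubic -/

theorem Submodule.exists_span_pair {V : Type*} [AddCommGroup V] [Module ℂ V]
    {L : Submodule ℂ V} (hL : Module.finrank ℂ L = 2) {a : V} (ha : a ∈ L) (ha0 : a ≠ 0) :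
    ∃ a' ∈ L, (∀ s t : ℂ, s • a + t • a' = 0 → s = 0 ∧ t = 0) ∧
      ∀ x ∈ L, ∃ s t : ℂ, x = s • a + t • a' := by
  have hne : ¬ L ≤ Submodule.span ℂ {a} := by
    intro h
    have := Submodule.finrank_mono h
    rw [hL, finrank_span_singleton ha0] at this
    omega
  obtain ⟨a', ha', hna'⟩ := Set.not_subset.1 hne
  have hli : LinearIndependent ℂ ![a, a'] := by
    rw [LinearIndependent.pair_iff' ha0]
    intro c hc
    exact hna' (Submodule.mem_span_singleton.2 ⟨c, hc⟩)
  refine ⟨a', ha', fun s t h => LinearIndependent.pair_iff.1 hli s t h, fun x hx => ?_⟩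
  have hle : Submodule.span ℂ {a, a'} ≤ L := by
    rw [Submodule.span_le]; rintro y (rfl | rfl) <;> assumption
  have hfr : Module.finrank ℂ (Submodule.span ℂ {a, a'}) = 2 := by
    have := finrank_span_eq_card hli
    rw [Matrix.range_cons, Matrix.range_cons, Matrix.range_empty, Set.union_empty,
      Set.singleton_union] at this
    simpa using this
  have : FiniteDimensional ℂ L := Module.finite_of_finrank_pos (by omega)
  have heq := Submodule.eq_of_le_of_finrank_eq hle (by rw [hfr, hL])
  rw [← heq, Submodule.mem_span_pair] at hx
  obtain ⟨s, t, h⟩ := hx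
  exact ⟨s, t, h.symm⟩

theorem Submodule.exists_mem_ne_zero_linear_eq_zero {V : Type*} [AddCommGroup V] [Module ℂ V]
    {L : Submodule ℂ V} (hL : Module.finrank ℂ L = 2) (f : V →ₗ[ℂ] ℂ) :
    ∃ b ∈ L, b ≠ 0 ∧ f b = 0 := by
  have hbot : L ≠ ⊥ := by rintro rfl; simp at hL
  obtain ⟨b, hb, hb0⟩ := L.exists_mem_ne_zero_of_ne_bot hbot
  obtain ⟨b', hb', hli, -⟩ := exists_span_pair hL hb hb0
  by_cases h : f b = 0
  · exact ⟨b, hb, hb0, h⟩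
  refine ⟨f b' • b + (-f b) • b', L.add_mem (L.smul_mem _ hb) (L.smul_mem _ hb'), ?_, ?_⟩
  · intro h0
    exact h (by simpa using (hli _ _ h0).2)
  · simp; ring

/-- A symmetric trilinear form defining a smooth cubic surface, two skew lines on that surface,
and the projections belonging to the decomposition of `ℂ⁴` into the two lines. -/
structure SkewLines (T : Trilinear) (ℓ₁ ℓ₂ : Submodule ℂ (Fin 4 → ℂ))
    (P Q : (Fin 4 → ℂ) →ₗ[ℂ] (Fin 4 → ℂ)) : Prop where
  swap₁ : ∀ u v w, T u v w = T v u w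
  swap₂ : ∀ u v w, T u v w = T u w v
  smooth : ∀ v, v ≠ 0 → T v v v = 0 → ∃ w, T v v w ≠ 0
  rank₁ : Module.finrank ℂ ℓ₁ = 2
  rank₂ : Module.finrank ℂ ℓ₂ = 2
  zero₁ : ∀ v ∈ ℓ₁, T v v v = 0
  zero₂ : ∀ v ∈ ℓ₂, T v v v = 0
  disj : ℓ₁ ⊓ ℓ₂ = ⊥
  mem₁ : ∀ v, P v ∈ ℓ₁
  mem₂ : ∀ v, Q v ∈ ℓ₂
  add : ∀ v, P v + Q v = v

theorem exists_projections {ℓ₁ ℓ₂ : Submodule ℂ (Fin 4 → ℂ)} (h₁ : Module.finrank ℂ ℓ₁ = 2)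
    (h₂ : Module.finrank ℂ ℓ₂ = 2) (h : ℓ₁ ⊓ ℓ₂ = ⊥) :
    ∃ P Q : (Fin 4 → ℂ) →ₗ[ℂ] (Fin 4 → ℂ), (∀ v, P v ∈ ℓ₁) ∧ (∀ v, Q v ∈ ℓ₂) ∧
      ∀ v, P v + Q v = v := by
  have hc : IsCompl ℓ₁ ℓ₂ := by
    refine ⟨disjoint_iff.2 h, codisjoint_iff.2 ?_⟩
    apply Submodule.eq_top_of_finrank_eq
    have := Submodule.finrank_sup_add_finrank_inf_eq ℓ₁ ℓ₂
    rw [h, finrank_bot, h₁, h₂] at this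
    simpa using this
  refine ⟨ℓ₁.subtype ∘ₗ ℓ₁.projectionOnto ℓ₂ hc, ℓ₂.subtype ∘ₗ ℓ₂.projectionOnto ℓ₁ hc.symm,
    fun v => by simp, fun v => by simp, fun v => ?_⟩
  simpa using Submodule.projection_add_projection_eq_self hc v

namespace SkewLines

variable {T : Trilinear} {ℓ₁ ℓ₂ : Submodule ℂ (Fin 4 → ℂ)}
  {P Q : (Fin 4 → ℂ) →ₗ[ℂ] (Fin 4 → ℂ)}

theorem symm (S : SkewLines T ℓ₁ ℓ₂ P Q) : SkewLines T ℓ₂ ℓ₁ Q P where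
  swap₁ := S.swap₁
  swap₂ := S.swap₂
  smooth := S.smooth
  rank₁ := S.rank₂
  rank₂ := S.rank₁
  zero₁ := S.zero₂
  zero₂ := S.zero₁
  disj := by rw [inf_comm, S.disj]
  mem₁ := S.mem₂
  mem₂ := S.mem₁
  add v := by rw [add_comm, S.add]

theorem eq_zero (S : SkewLines T ℓ₁ ℓ₂ P Q) {v : Fin 4 → ℂ} (h₁ : v ∈ ℓ₁) (h₂ : v ∈ ℓ₂) :
    v = 0 := by
  have : v ∈ ℓ₁ ⊓ ℓ₂ := ⟨h₁, h₂⟩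
  rwa [S.disj, Submodule.mem_bot] at this

theorem add_eq_add (S : SkewLines T ℓ₁ ℓ₂ P Q) {a a' b b' : Fin 4 → ℂ} (ha : a ∈ ℓ₁)
    (ha' : a' ∈ ℓ₁) (hb : b ∈ ℓ₂) (hb' : b' ∈ ℓ₂) (h : a + b = a' + b') : a = a' ∧ b = b' := by
  have e : a - a' = b' - b := by
    rw [sub_eq_sub_iff_add_eq_add, h, add_comm]
  have : a - a' = 0 := S.eq_zero (ℓ₁.sub_mem ha ha') (e ▸ ℓ₂.sub_mem hb' hb)
  refine ⟨sub_eq_zero.1 this, ?_⟩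
  rw [this] at e
  exact (sub_eq_zero.1 e.symm).symm

theorem proj_add (S : SkewLines T ℓ₁ ℓ₂ P Q) {a b : Fin 4 → ℂ} (ha : a ∈ ℓ₁) (hb : b ∈ ℓ₂) :
    P (a + b) = a ∧ Q (a + b) = b :=
  S.add_eq_add (S.mem₁ _) ha (S.mem₂ _) hb (S.add _)

theorem proj_right (S : SkewLines T ℓ₁ ℓ₂ P Q) {b : Fin 4 → ℂ} (hb : b ∈ ℓ₂) :
    P b = 0 ∧ Q b = b := by
  simpa using S.proj_add ℓ₁.zero_mem hb

theorem cubic_add (S : SkewLines T ℓ₁ ℓ₂ P Q) (u v : Fin 4 → ℂ) (s t : ℂ) :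
    T (s • u + t • v) (s • u + t • v) (s • u + t • v) =
      s ^ 3 * T u u u + 3 * s ^ 2 * t * T u u v + 3 * s * t ^ 2 * T u v v + t ^ 3 * T v v v := by
  have e1 : T v u u = T u u v := by rw [S.swap₁, S.swap₂]
  have e2 : T u v u = T u u v := by rw [S.swap₂]
  have e3 : T v u v = T u v v := by rw [S.swap₁]
  have e4 : T v v u = T u v v := by rw [S.swap₂, S.swap₁]
  simp only [map_add, map_smul, LinearMap.add_apply, LinearMap.smul_apply, smul_eq_mul, e1, e2,
    e3, e4]
  ring

theorem square_add (S : SkewLines T ℓ₁ ℓ₂ P Q) (u v w : Fin 4 → ℂ) (s t : ℂ) :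
    T (s • u + t • v) (s • u + t • v) w =
      s ^ 2 * T u u w + 2 * s * t * T u v w + t ^ 2 * T v v w := by
  have e1 : T v u w = T u v w := by rw [S.swap₁]
  simp only [map_add, map_smul, LinearMap.add_apply, LinearMap.smul_apply, smul_eq_mul, e1]
  ring

/-- The cubic is identically zero on `ℓ₁`, so each coefficient of its restriction vanishes; the
values at `a + a'` and `a - a'` isolate this one. -/
theorem polar_zero (S : SkewLines T ℓ₁ ℓ₂ P Q) {a a' : Fin 4 → ℂ} (ha : a ∈ ℓ₁)
    (ha' : a' ∈ ℓ₁) : T a a a' = 0 := by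
  have h1 := S.cubic_add a a' 1 1
  have h2 := S.cubic_add a a' 1 (-1)
  rw [S.zero₁ _ (ℓ₁.add_mem (ℓ₁.smul_mem _ ha) (ℓ₁.smul_mem _ ha')), S.zero₁ a ha,
    S.zero₁ a' ha'] at h1 h2
  linear_combination (-1 / 6) * h1 + (1 / 6) * h2

/-- The differential of `F` at `a` kills `ℓ₁`, so smoothness makes it nonzero on the complement
`ℓ₂`. Hence `T a a` has exactly one zero on the line `ℓ₂`. -/
theorem exists_polar_ne (S : SkewLines T ℓ₁ ℓ₂ P Q) {a : Fin 4 → ℂ} (ha : a ∈ ℓ₁) (h0 : a ≠ 0) :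
    ∃ b ∈ ℓ₂, T a a b ≠ 0 := by
  obtain ⟨w, hw⟩ := S.smooth a h0 (S.zero₁ a ha)
  refine ⟨Q w, S.mem₂ w, ?_⟩
  rwa [← S.add w, map_add, S.polar_zero ha (S.mem₁ w), zero_add] at hw

/-- Smoothness of the surface along a transversal contained in it. -/
theorem jacobian_ne (S : SkewLines T ℓ₁ ℓ₂ P Q) {a a' b b' : Fin 4 → ℂ} (ha : a ∈ ℓ₁)
    (hb : b ∈ ℓ₂) (ha0 : a ≠ 0) (hb0 : b ≠ 0)
    (hsa : ∀ x ∈ ℓ₁, ∃ s t : ℂ, x = s • a + t • a')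
    (hsb : ∀ x ∈ ℓ₂, ∃ s t : ℂ, x = s • b + t • b')
    (haab : T a a b = 0) (habb : T a b b = 0) :
    T a a b' * T a' b b - 4 * (T a a' b * T a b b') ≠ 0 := by
  intro hJ
  -- This makes the coefficient `τ` below nonzero, so that `v` is a genuine point of the line.
  have hne : T a a b' ≠ 0 := by
    intro h
    obtain ⟨y, hy, hne⟩ := S.exists_polar_ne ha ha0
    obtain ⟨s, t, rfl⟩ := hsb y hy
    exact hne (by simp [haab, h])
  -- The polar at `σ a + τ b` kills `a` and `b`. Its vanishing on `b'` reads `σ (σ T a a b' + 2 τ T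
  -- a b b') = 0`, which this choice solves; its vanishing on `a'` is then the assumed vanishing of
  -- the determinant. So `v` would be singular.
  set σ := 2 * T a b b' with hσ
  set τ := -T a a b' with hτ
  set v := σ • a + τ • b with hv
  have hv0 : v ≠ 0 := by
    intro h
    have := S.add_eq_add (ℓ₁.smul_mem σ ha) ℓ₁.zero_mem (ℓ₂.smul_mem τ hb) ℓ₂.zero_mem
      (by rw [← hv, h, add_zero])
    rcases smul_eq_zero.1 this.2 with h' | h'
    · exact hne (by simpa [hτ] using h')
    · exact hb0 h'
  have hpolar : ∀ w, T v v w = σ ^ 2 * T a a w + 2 * σ * τ * T a b w + τ ^ 2 * T b b w :=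
    fun w => S.square_add a b w σ τ
  have hbba : T b b a = 0 := by rw [S.swap₂, S.swap₁]; exact habb
  have haba : T a b a = 0 := by rw [S.swap₂]; exact haab
  have hz1 : ∀ x ∈ ℓ₁, T v v x = 0 := by
    intro x hx
    obtain ⟨s, t, rfl⟩ := hsa x hx
    have h0 : T a a (s • a + t • a') = 0 := S.polar_zero ha hx
    have e1 : T a b a' = T a a' b := by rw [S.swap₂]
    have e2 : T b b a' = T a' b b := by rw [S.swap₂, S.swap₁]
    rw [hpolar, h0]
    simp only [map_add, map_smul, smul_eq_mul, hbba, haba, e1, e2]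
    rw [hσ, hτ]
    linear_combination (t * T a a b') * hJ
  have hz2 : ∀ x ∈ ℓ₂, T v v x = 0 := by
    intro x hx
    obtain ⟨s, t, rfl⟩ := hsb x hx
    have h0 : T b b (s • b + t • b') = 0 := S.symm.polar_zero hb hx
    rw [hpolar, h0]
    simp only [map_add, map_smul, smul_eq_mul, haab, habb]
    rw [hσ, hτ]
    ring
  have hz : ∀ x, T v v x = 0 := by
    intro x
    rw [← S.add x, map_add, hz1 _ (S.mem₁ x), hz2 _ (S.mem₂ x), add_zero]
  obtain ⟨w, hw⟩ := S.smooth v hv0 (hz v)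
  exact hw (hz w)

end SkewLines

/-! ### Transversals and the third intersection point. -/

/-- The part of bidegree `(2, 1)` of the cubic form. -/
def formA (T : Trilinear) (P Q : (Fin 4 → ℂ) →ₗ[ℂ] (Fin 4 → ℂ)) (v : Fin 4 → ℂ) : ℂ :=
  3 * T (P v) (P v) (Q v)

/-- The part of bidegree `(1, 2)` of the cubic form. -/
def formB (T : Trilinear) (P Q : (Fin 4 → ℂ) →ₗ[ℂ] (Fin 4 → ℂ)) (v : Fin 4 → ℂ) : ℂ :=
  3 * T (P v) (Q v) (Q v)

/-- Homogeneous coordinates of the third intersection point of the surface with the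
transversal through `v`. -/
def thirdVec (T : Trilinear) (P Q : (Fin 4 → ℂ) →ₗ[ℂ] (Fin 4 → ℂ)) (v : Fin 4 → ℂ) :
    Fin 4 → ℂ :=
  formB T P Q v • P v - formA T P Q v • Q v

theorem Projectivization.submodule_le_iff {n : ℕ} (x : PSpace n) (W : Submodule ℂ (Fin n → ℂ)) :
    x.submodule ≤ W ↔ x.rep ∈ W := by
  rw [Projectivization.submodule_eq, Submodule.span_singleton_le_iff_mem]

theorem exists_dual_eq_one {n : ℕ} {a : Fin n → ℂ} (ha : a ≠ 0) :
    ∃ f : (Fin n → ℂ) →ₗ[ℂ] ℂ, f a = 1 := by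
  obtain ⟨i, hi⟩ := Function.ne_iff.1 ha
  exact ⟨(a i)⁻¹ • LinearMap.proj i, by simpa using inv_mul_cancel₀ hi⟩

namespace SkewLines

variable {T : Trilinear} {ℓ₁ ℓ₂ : Submodule ℂ (Fin 4 → ℂ)}
  {P Q : (Fin 4 → ℂ) →ₗ[ℂ] (Fin 4 → ℂ)}

theorem mem_right_iff (S : SkewLines T ℓ₁ ℓ₂ P Q) (v : Fin 4 → ℂ) : v ∈ ℓ₂ ↔ P v = 0 :=
  ⟨fun h => (S.proj_right h).1, fun h => by
    rw [← S.add v, h, zero_add]; exact S.mem₂ v⟩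

theorem mem_left_iff (S : SkewLines T ℓ₁ ℓ₂ P Q) (v : Fin 4 → ℂ) : v ∈ ℓ₁ ↔ Q v = 0 :=
  S.symm.mem_right_iff v

theorem smul_add_smul_eq_zero (S : SkewLines T ℓ₁ ℓ₂ P Q) {a b : Fin 4 → ℂ} (ha : a ∈ ℓ₁)
    (hb : b ∈ ℓ₂) (ha0 : a ≠ 0) (hb0 : b ≠ 0) {s t : ℂ} (h : s • a + t • b = 0) :
    s = 0 ∧ t = 0 := by
  have := S.add_eq_add (ℓ₁.smul_mem s ha) ℓ₁.zero_mem (ℓ₂.smul_mem t hb) ℓ₂.zero_mem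
    (by rw [h, add_zero])
  exact ⟨(smul_eq_zero.1 this.1).resolve_right ha0, (smul_eq_zero.1 this.2).resolve_right hb0⟩

theorem finrank_span_pair (S : SkewLines T ℓ₁ ℓ₂ P Q) {a b : Fin 4 → ℂ} (ha : a ∈ ℓ₁)
    (hb : b ∈ ℓ₂) (ha0 : a ≠ 0) (hb0 : b ≠ 0) :
    Module.finrank ℂ (Submodule.span ℂ {a, b}) = 2 := by
  have hli : LinearIndependent ℂ ![a, b] :=
    LinearIndependent.pair_iff.2 fun s t h => S.smul_add_smul_eq_zero ha hb ha0 hb0 h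
  have := finrank_span_eq_card hli
  rw [Matrix.range_cons, Matrix.range_cons, Matrix.range_empty, Set.union_empty,
    Set.singleton_union] at this
  simpa using this

/-- A line meeting both of the skew lines is spanned by points on them. -/
theorem exists_eq_span_pair (S : SkewLines T ℓ₁ ℓ₂ P Q) {L : Submodule ℂ (Fin 4 → ℂ)}
    (hL : Module.finrank ℂ L = 2) (h₁ : L ⊓ ℓ₁ ≠ ⊥) (h₂ : L ⊓ ℓ₂ ≠ ⊥) :
    ∃ a ∈ ℓ₁, ∃ b ∈ ℓ₂, a ≠ 0 ∧ b ≠ 0 ∧ L = Submodule.span ℂ {a, b} := by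
  obtain ⟨a, ⟨haL, ha⟩, ha0⟩ := Submodule.exists_mem_ne_zero_of_ne_bot h₁
  obtain ⟨b, ⟨hbL, hb⟩, hb0⟩ := Submodule.exists_mem_ne_zero_of_ne_bot h₂
  refine ⟨a, ha, b, hb, ha0, hb0, (Submodule.eq_of_le_of_finrank_eq ?_ ?_).symm⟩
  · rw [Submodule.span_le]; rintro y (rfl | rfl) <;> assumption
  · rw [hL, S.finrank_span_pair ha hb ha0 hb0]

theorem inf_span_pair_ne {a b : Fin 4 → ℂ} (ha : a ∈ ℓ₁)
    (hb : b ∈ ℓ₂) (ha0 : a ≠ 0) (hb0 : b ≠ 0) :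
    Submodule.span ℂ {a, b} ⊓ ℓ₁ ≠ ⊥ ∧ Submodule.span ℂ {a, b} ⊓ ℓ₂ ≠ ⊥ := by
  constructor
  · exact (Submodule.ne_bot_iff _).2 ⟨a, ⟨Submodule.subset_span (by simp), ha⟩, ha0⟩
  · exact (Submodule.ne_bot_iff _).2 ⟨b, ⟨Submodule.subset_span (by simp), hb⟩, hb0⟩

/-- If a line through `x` meets `ℓ₁` in `a` and `ℓ₂` in `b`, writing `x` as a combination of `a` and
`b` shows that these points are `P x` and `Q x`. -/
theorem isTransversal_iff (S : SkewLines T ℓ₁ ℓ₂ P Q) (x : PSpace 4) (hP : P x.rep ≠ 0)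
    (hQ : Q x.rep ≠ 0) (L : Submodule ℂ (Fin 4 → ℂ)) :
    IsTransversal ℓ₁ ℓ₂ x L ↔ L = Submodule.span ℂ {P x.rep, Q x.rep} := by
  constructor
  · rintro ⟨hL, hx, h₁, h₂⟩
    rw [Projectivization.submodule_le_iff] at hx
    obtain ⟨a, ha, b, hb, ha0, hb0, rfl⟩ := S.exists_eq_span_pair hL h₁ h₂
    obtain ⟨s, t, hst⟩ := Submodule.mem_span_pair.1 hx
    obtain ⟨e₁, e₂⟩ := S.proj_add (ℓ₁.smul_mem s ha) (ℓ₂.smul_mem t hb)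
    rw [hst] at e₁ e₂
    symm
    apply Submodule.eq_of_le_of_finrank_eq
    · rw [Submodule.span_le]
      rintro y (rfl | rfl)
      · rw [e₁]; exact Submodule.smul_mem _ _ (Submodule.subset_span (by simp))
      · rw [e₂]; exact Submodule.smul_mem _ _ (Submodule.subset_span (by simp))
    · rw [S.finrank_span_pair (S.mem₁ _) (S.mem₂ _) hP hQ, S.finrank_span_pair ha hb ha0 hb0]
  · rintro rfl
    refine ⟨S.finrank_span_pair (S.mem₁ _) (S.mem₂ _) hP hQ, ?_,
      inf_span_pair_ne (S.mem₁ _) (S.mem₂ _) hP hQ⟩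
    rw [Projectivization.submodule_le_iff, Submodule.mem_span_pair]
    exact ⟨1, 1, by simp [S.add]⟩

/-- Joining a point of `ℓ₁` to the various points of `ℓ₂` gives many transversals. This keeps points
of the two lines out of the domain of `thirdPointMap`, which requires uniqueness. -/
theorem exists_transversal_ne (S : SkewLines T ℓ₁ ℓ₂ P Q) (x : PSpace 4) (hx : x.rep ∈ ℓ₁)
    (L : Submodule ℂ (Fin 4 → ℂ)) : ∃ L', IsTransversal ℓ₁ ℓ₂ x L' ∧ L' ≠ L := by
  have hr := S.rank₂
  obtain ⟨b, hb, hb0⟩ := ℓ₂.exists_mem_ne_zero_of_ne_bot (by rintro h; rw [h] at hr; simp at hr)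
  obtain ⟨b', hb', hli, -⟩ := Submodule.exists_span_pair hr hb hb0
  have hb'0 : b' ≠ 0 := by
    rintro rfl
    have := (hli 0 1 (by simp)).2
    simp at this
  have htr : ∀ c ∈ ℓ₂, c ≠ 0 → IsTransversal ℓ₁ ℓ₂ x (Submodule.span ℂ {x.rep, c}) := by
    intro c hc hc0
    refine ⟨S.finrank_span_pair hx hc x.rep_nonzero hc0, ?_,
      inf_span_pair_ne hx hc x.rep_nonzero hc0⟩
    rw [Projectivization.submodule_le_iff]
    exact Submodule.subset_span (by simp)
  by_cases h : Submodule.span ℂ {x.rep, b} = L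
  · refine ⟨_, htr b' hb' hb'0, ?_⟩
    rw [← h]
    intro he
    have hm : b' ∈ Submodule.span ℂ {x.rep, b} := he ▸ Submodule.subset_span (by simp)
    obtain ⟨s, t, hst⟩ := Submodule.mem_span_pair.1 hm
    have := (S.add_eq_add (ℓ₁.smul_mem s hx) ℓ₁.zero_mem (ℓ₂.smul_mem t hb) hb'
      (by rw [hst, zero_add])).2
    have := (hli t (-1) (by rw [this]; simp)).2
    simp at this
  · exact ⟨_, htr b hb hb0, h⟩

theorem IsTransversal.symm {x : PSpace 4} {L : Submodule ℂ (Fin 4 → ℂ)}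
    (h : IsTransversal ℓ₁ ℓ₂ x L) : IsTransversal ℓ₂ ℓ₁ x L :=
  ⟨h.1, h.2.1, h.2.2.2, h.2.2.1⟩

theorem existsUnique_isTransversal (S : SkewLines T ℓ₁ ℓ₂ P Q) (x : PSpace 4)
    (h₁ : ¬ x.submodule ≤ ℓ₁) (h₂ : ¬ x.submodule ≤ ℓ₂) : ∃! L, IsTransversal ℓ₁ ℓ₂ x L := by
  rw [Projectivization.submodule_le_iff] at h₁ h₂
  rw [S.mem_left_iff] at h₁
  rw [S.mem_right_iff] at h₂
  simp only [S.isTransversal_iff x h₂ h₁]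
  exact existsUnique_eq

/-- The pure terms vanish because both lines lie on the surface. The remaining linear factor has its
zero at `(s : t) = (B : -A)`, which is where `thirdVec` comes from. -/
theorem cubic_transversal (S : SkewLines T ℓ₁ ℓ₂ P Q) (v : Fin 4 → ℂ) (s t : ℂ) :
    T (s • P v + t • Q v) (s • P v + t • Q v) (s • P v + t • Q v) =
      s * t * (s * formA T P Q v + t * formB T P Q v) := by
  rw [S.cubic_add, S.zero₁ _ (S.mem₁ v), S.zero₂ _ (S.mem₂ v), formA, formB]
  ring

theorem cubic_eq_add (S : SkewLines T ℓ₁ ℓ₂ P Q) (v : Fin 4 → ℂ) :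
    T v v v = formA T P Q v + formB T P Q v := by
  simpa [S.add] using S.cubic_transversal v 1 1

theorem proj_ne_of_thirdVec_ne {v : Fin 4 → ℂ} (h : thirdVec T P Q v ≠ 0) :
    P v ≠ 0 ∧ Q v ≠ 0 := by
  constructor <;> intro h0 <;> apply h <;> simp [thirdVec, formA, formB, h0]

theorem thirdVec_ne_iff (S : SkewLines T ℓ₁ ℓ₂ P Q) {v : Fin 4 → ℂ} (hP : P v ≠ 0)
    (hQ : Q v ≠ 0) : thirdVec T P Q v ≠ 0 ↔ ¬ (formA T P Q v = 0 ∧ formB T P Q v = 0) := by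
  rw [not_iff_not]
  constructor
  · intro h
    rw [thirdVec, sub_eq_add_neg, ← neg_smul] at h
    have := S.smul_add_smul_eq_zero (S.mem₁ v) (S.mem₂ v) hP hQ h
    exact ⟨neg_eq_zero.1 this.2, this.1⟩
  · rintro ⟨h1, h2⟩
    simp [thirdVec, h1, h2]

/-- In the coordinates `s`, `t` of the transversal the three linear forms are `t`, `s` and `s A + t
B`; `g ∘ₗ Q` and `f ∘ₗ P` are extensions of `t` and `s` to the whole space. -/
theorem cutsDivisor (S : SkewLines T ℓ₁ ℓ₂ P Q) {F : MvPolynomial (Fin 4) ℂ}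
    (hF : ∀ v, MvPolynomial.eval v F = T v v v) {v : Fin 4 → ℂ} (hP : P v ≠ 0) (hQ : Q v ≠ 0)
    (h : thirdVec T P Q v ≠ 0) :
    CutsDivisor F (Submodule.span ℂ {P v, Q v}) (Projectivization.mk ℂ _ hP)
      (Projectivization.mk ℂ _ hQ) (Projectivization.mk ℂ _ h) := by
  obtain ⟨f, hf⟩ := exists_dual_eq_one hP
  obtain ⟨g, hg⟩ := exists_dual_eq_one hQ
  have hfv : ∀ s t : ℂ, (f ∘ₗ P) (s • P v + t • Q v) = s := by
    intro s t
    rw [LinearMap.comp_apply, (S.proj_add (ℓ₁.smul_mem s (S.mem₁ v))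
      (ℓ₂.smul_mem t (S.mem₂ v))).1]
    simp [hf]
  have hgv : ∀ s t : ℂ, (g ∘ₗ Q) (s • P v + t • Q v) = t := by
    intro s t
    rw [LinearMap.comp_apply, (S.proj_add (ℓ₁.smul_mem s (S.mem₁ v))
      (ℓ₂.smul_mem t (S.mem₂ v))).2]
    simp [hg]
  have hAB := (S.thirdVec_ne_iff hP hQ).1 h
  simp only [CutsDivisor, Projectivization.submodule_mk, Submodule.span_singleton_le_iff_mem]
  refine ⟨Submodule.subset_span (by simp), Submodule.subset_span (by simp), ?_, g ∘ₗ Q, f ∘ₗ P,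
    formA T P Q v • (f ∘ₗ P) + formB T P Q v • (g ∘ₗ Q), ?_, ?_, ?_, ?_⟩
  · exact Submodule.mem_span_pair.2 ⟨formB T P Q v, -formA T P Q v, by
      rw [thirdVec, neg_smul, sub_eq_add_neg]⟩
  · intro w hw
    obtain ⟨s, t, rfl⟩ := Submodule.mem_span_pair.1 hw
    rw [hgv, Submodule.mem_span_singleton]
    constructor
    · rintro rfl; exact ⟨s, by simp⟩
    · rintro ⟨c, hc⟩
      have : (s - c) • P v + t • Q v = 0 := by rw [sub_smul, hc]; abel
      exact (S.smul_add_smul_eq_zero (S.mem₁ v) (S.mem₂ v) hP hQ this).2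
  · intro w hw
    obtain ⟨s, t, rfl⟩ := Submodule.mem_span_pair.1 hw
    rw [hfv, Submodule.mem_span_singleton]
    constructor
    · rintro rfl; exact ⟨t, by simp⟩
    · rintro ⟨c, hc⟩
      have : s • P v + (t - c) • Q v = 0 := by rw [sub_smul, hc]; abel
      exact (S.smul_add_smul_eq_zero (S.mem₁ v) (S.mem₂ v) hP hQ this).1
  · intro w hw
    obtain ⟨s, t, rfl⟩ := Submodule.mem_span_pair.1 hw
    rw [LinearMap.add_apply, LinearMap.smul_apply, LinearMap.smul_apply, hfv, hgv,
      Submodule.mem_span_singleton]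
    simp only [smul_eq_mul]
    constructor
    · intro h0
      by_cases hB : formB T P Q v = 0
      · have hA : formA T P Q v ≠ 0 := fun hA => hAB ⟨hA, hB⟩
        have hs : s = 0 := by simpa [hB, hA] using h0
        refine ⟨-t / formA T P Q v, ?_⟩
        rw [thirdVec, hB, hs, smul_sub, smul_smul, smul_smul]
        have : -t / formA T P Q v * formA T P Q v = -t := by field_simp
        rw [this]; simp
      · refine ⟨s / formB T P Q v, ?_⟩
        have e : t = -(s / formB T P Q v * formA T P Q v) := by
          field_simp; linear_combination h0
        rw [thirdVec, smul_sub, smul_smul, smul_smul, div_mul_cancel₀ _ hB]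
        rw [e, neg_smul, sub_eq_add_neg]
    · rintro ⟨c, hc⟩
      have : (s - c * formB T P Q v) • P v + (t + c * formA T P Q v) • Q v = 0 := by
        rw [sub_smul, add_smul, mul_smul, mul_smul]
        rw [thirdVec, smul_sub] at hc
        have : s • P v + t • Q v - (c • formB T P Q v • P v - c • formA T P Q v • Q v) = 0 := by
          rw [hc, sub_self]
        rw [← this]; abel
      obtain ⟨h1, h2⟩ := S.smul_add_smul_eq_zero (S.mem₁ v) (S.mem₂ v) hP hQ this
      linear_combination formA T P Q v * h1 + formB T P Q v * h2
  · intro w hw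
    obtain ⟨s, t, rfl⟩ := Submodule.mem_span_pair.1 hw
    rw [hF, S.cubic_transversal, LinearMap.add_apply, LinearMap.smul_apply, LinearMap.smul_apply,
      hfv, hgv]
    simp only [smul_eq_mul]
    ring

/-- In any such factorisation the first two forms must be multiples of `t` and `s`. Comparing
coefficients, the third is then proportional to `s A + t B`, whose zero is `thirdVec`. -/
theorem CutsDivisor.eq_thirdVec (S : SkewLines T ℓ₁ ℓ₂ P Q) {F : MvPolynomial (Fin 4) ℂ}
    (hF : ∀ v, MvPolynomial.eval v F = T v v v) {v : Fin 4 → ℂ} (hP : P v ≠ 0) (hQ : Q v ≠ 0)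
    {p₁ p₂ q : PSpace 4} (h₁ : p₁.submodule ≤ ℓ₁) (h₂ : p₂.submodule ≤ ℓ₂)
    (h : CutsDivisor F (Submodule.span ℂ {P v, Q v}) p₁ p₂ q) :
    ∃ h0 : thirdVec T P Q v ≠ 0, Projectivization.mk ℂ _ h0 = q := by
  obtain ⟨hp₁, hp₂, hq, α, β, γ, hα, hβ, hγ, hαβγ⟩ := h
  have mem : ∀ s t : ℂ, s • P v + t • Q v ∈ Submodule.span ℂ {P v, Q v} := fun s t =>
    Submodule.mem_span_pair.2 ⟨s, t, rfl⟩
  have mP : P v ∈ Submodule.span ℂ {P v, Q v} := Submodule.subset_span (by simp)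
  have mQ : Q v ∈ Submodule.span ℂ {P v, Q v} := Submodule.subset_span (by simp)
  have hαQ : α (Q v) ≠ 0 := fun h0 => hQ (S.eq_zero (h₁ ((hα _ mQ).1 h0)) (S.mem₂ v))
  have hβP : β (P v) ≠ 0 := fun h0 => hP (S.eq_zero (S.mem₁ v) (h₂ ((hβ _ mP).1 h0)))
  rw [Projectivization.submodule_le_iff] at hq h₁ h₂
  have key : ∀ s t : ℂ, s * t * (s * formA T P Q v + t * formB T P Q v) =
      (s * α (P v) + t * α (Q v)) * (s * β (P v) + t * β (Q v)) *
        (s * γ (P v) + t * γ (Q v)) := by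
    intro s t
    rw [← S.cubic_transversal, ← hF, hαβγ _ (mem s t)]
    simp
  -- the points `p₁`, `p₂` are the points of the transversal on the two lines
  have hαP : α (P v) = 0 := by
    by_contra hne
    have h1 : p₁.rep ∈ Submodule.span ℂ {P v, Q v} := 
      (Projectivization.submodule_le_iff _ _).1 hp₁
    obtain ⟨s, t, hst⟩ := Submodule.mem_span_pair.1 h1
    have ht : t • Q v = 0 := (S.add_eq_add (ℓ₁.smul_mem s (S.mem₁ v)) h₁
      (ℓ₂.smul_mem t (S.mem₂ v)) ℓ₂.zero_mem (by rw [hst, add_zero])).2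
    rw [ht, add_zero] at hst
    have h0 : α p₁.rep = 0 := (hα _ h1).2 (by
      rw [Projectivization.submodule_eq]; exact Submodule.mem_span_singleton_self _)
    rw [← hst, map_smul, smul_eq_mul] at h0
    rcases mul_eq_zero.1 h0 with h0 | h0
    · rw [h0, zero_smul] at hst
      exact p₁.rep_nonzero hst.symm
    · exact hne h0
  have hβQ : β (Q v) = 0 := by
    by_contra hne
    have h1 : p₂.rep ∈ Submodule.span ℂ {P v, Q v} := 
      (Projectivization.submodule_le_iff _ _).1 hp₂
    obtain ⟨s, t, hst⟩ := Submodule.mem_span_pair.1 h1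
    have ht : s • P v = 0 := (S.add_eq_add (ℓ₁.smul_mem s (S.mem₁ v)) ℓ₁.zero_mem
      (ℓ₂.smul_mem t (S.mem₂ v)) h₂ (by rw [hst, zero_add])).1
    rw [ht, zero_add] at hst
    have h0 : β p₂.rep = 0 := (hβ _ h1).2 (by
      rw [Projectivization.submodule_eq]; exact Submodule.mem_span_singleton_self _)
    rw [← hst, map_smul, smul_eq_mul] at h0
    rcases mul_eq_zero.1 h0 with h0 | h0
    · rw [h0, zero_smul] at hst
      exact p₂.rep_nonzero hst.symm
    · exact hne h0
  -- The values at (1,1) and (1,−1) separate the coefficients of `s² t` and `s t²`.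
  have k1 := key 1 1
  have k2 := key 1 (-1)
  simp only [hαP, hβQ] at k1 k2
  have kA : formA T P Q v = α (Q v) * β (P v) * γ (P v) := by
    linear_combination (1 / 2) * k1 - (1 / 2) * k2
  have kB : formB T P Q v = α (Q v) * β (P v) * γ (Q v) := by
    linear_combination (1 / 2) * k1 + (1 / 2) * k2
  have h0 : thirdVec T P Q v ≠ 0 := by
    rw [S.thirdVec_ne_iff hP hQ]
    rintro ⟨hA, hB⟩
    -- If `A = B = 0`, then `γ` vanishes on the whole transversal, although its zero locus there is
    -- the single point `q`.
    have hγP : γ (P v) = 0 := by simpa [hαQ, hβP] using kA.symm.trans hA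
    have hγQ : γ (Q v) = 0 := by simpa [hαQ, hβP] using kB.symm.trans hB
    have m1 := (hγ _ mP).1 hγP
    have m2 := (hγ _ mQ).1 hγQ
    rw [Projectivization.submodule_eq, Submodule.mem_span_singleton] at m1 m2
    obtain ⟨c, hc⟩ := m1
    obtain ⟨d, hd⟩ := m2
    have : d • P v + (-c) • Q v = 0 := by
      rw [← hc, ← hd, smul_smul, smul_smul, ← add_smul]
      rw [show d * c + -c * d = 0 by ring, zero_smul]
    have := (S.smul_add_smul_eq_zero (S.mem₁ v) (S.mem₂ v) hP hQ this).1
    rw [this, zero_smul] at hd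
    exact hQ hd.symm
  refine ⟨h0, ?_⟩
  have m0 : thirdVec T P Q v ∈ Submodule.span ℂ {P v, Q v} :=
    Submodule.mem_span_pair.2 ⟨formB T P Q v, -formA T P Q v, by
      rw [thirdVec, neg_smul, sub_eq_add_neg]⟩
  have hγ0 : γ (thirdVec T P Q v) = 0 := by
    rw [thirdVec, map_sub, map_smul, map_smul, kA, kB]
    simp only [smul_eq_mul]
    ring
  have := (hγ _ m0).1 hγ0
  rw [Projectivization.submodule_eq, Submodule.mem_span_singleton] at this
  obtain ⟨c, hc⟩ := this
  rw [← q.mk_rep, Projectivization.mk_eq_mk_iff']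
  exact ⟨c, hc⟩

theorem isThirdPoint_iff (S : SkewLines T ℓ₁ ℓ₂ P Q) {F : MvPolynomial (Fin 4) ℂ}
    (hF : ∀ v, MvPolynomial.eval v F = T v v v) (x q : PSpace 4) :
    IsThirdPoint F ℓ₁ ℓ₂ x q ↔
      ∃ h : thirdVec T P Q x.rep ≠ 0, Projectivization.mk ℂ _ h = q := by
  constructor
  · rintro ⟨L, ⟨hL, hL'⟩, p₁, p₂, h₁, h₂, hcut⟩
    have hQ : Q x.rep ≠ 0 := by
      intro h0
      obtain ⟨L', h, hne⟩ := S.exists_transversal_ne x ((S.mem_left_iff _).2 h0) L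
      exact hne (hL' L' h)
    have hP : P x.rep ≠ 0 := by
      intro h0
      obtain ⟨L', h, hne⟩ := S.symm.exists_transversal_ne x ((S.mem_right_iff _).2 h0) L
      exact hne (hL' L' (IsTransversal.symm h))
    rw [S.isTransversal_iff x hP hQ] at hL
    subst hL
    exact CutsDivisor.eq_thirdVec S hF hP hQ h₁ h₂ hcut
  · rintro ⟨h, rfl⟩
    obtain ⟨hP, hQ⟩ := proj_ne_of_thirdVec_ne h
    refine ⟨Submodule.span ℂ {P x.rep, Q x.rep}, ⟨?_, ?_⟩, Projectivization.mk ℂ _ hP,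
      Projectivization.mk ℂ _ hQ, ?_, ?_, S.cutsDivisor hF hP hQ h⟩
    · rw [S.isTransversal_iff x hP hQ]
    · intro L' hL'
      rwa [S.isTransversal_iff x hP hQ] at hL'
    · rw [Projectivization.submodule_mk, Submodule.span_singleton_le_iff_mem]; exact S.mem₁ _
    · rw [Projectivization.submodule_mk, Submodule.span_singleton_le_iff_mem]; exact S.mem₂ _

theorem mem_thirdPointMap_iff (S : SkewLines T ℓ₁ ℓ₂ P Q) {F : MvPolynomial (Fin 4) ℂ}
    (hF : ∀ v, MvPolynomial.eval v F = T v v v) (x q : PSpace 4) :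
    q ∈ thirdPointMap F ℓ₁ ℓ₂ x ↔
      ∃ h : thirdVec T P Q x.rep ≠ 0, Projectivization.mk ℂ _ h = q := by
  rw [← S.isThirdPoint_iff hF]
  constructor
  · rintro ⟨h, rfl⟩
    exact h.choose_spec.1
  · intro h
    have hu : ∃! q, IsThirdPoint F ℓ₁ ℓ₂ x q := by
      refine ⟨q, h, fun q' h' => ?_⟩
      rw [S.isThirdPoint_iff hF] at h h'
      obtain ⟨_, rfl⟩ := h
      obtain ⟨_, rfl⟩ := h'
      rfl
    exact ⟨hu, hu.unique hu.choose_spec.1 h⟩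

/-- By `cubic_transversal`, `A = B = 0` would put the whole transversal on the surface; otherwise
`thirdVec` is nonzero. -/
theorem thirdPointMap_dom (S : SkewLines T ℓ₁ ℓ₂ P Q) {F : MvPolynomial (Fin 4) ℂ}
    (hF : ∀ v, MvPolynomial.eval v F = T v v v) (x : PSpace 4) (h₁ : ¬ x.submodule ≤ ℓ₁)
    (h₂ : ¬ x.submodule ≤ ℓ₂) (L : Submodule ℂ (Fin 4 → ℂ)) (hL : IsTransversal ℓ₁ ℓ₂ x L)
    (hL' : ¬ LiesOn F L) : (thirdPointMap F ℓ₁ ℓ₂ x).Dom := by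
  rw [Projectivization.submodule_le_iff] at h₁ h₂
  rw [S.mem_left_iff] at h₁
  rw [S.mem_right_iff] at h₂
  rw [S.isTransversal_iff x h₂ h₁] at hL
  subst hL
  have h : thirdVec T P Q x.rep ≠ 0 := by
    rw [S.thirdVec_ne_iff h₂ h₁]
    rintro ⟨hA, hB⟩
    apply hL'
    intro w hw
    obtain ⟨s, t, rfl⟩ := Submodule.mem_span_pair.1 hw
    rw [hF, S.cubic_transversal, hA, hB]
    ring
  exact Part.dom_iff_mem.2 ⟨_, (S.mem_thirdPointMap_iff hF x _).2 ⟨h, rfl⟩⟩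

end SkewLines

/-! ### Functions given by forms -/

/-- The function `f` is given by a form of degree `d`. -/
def IsFormFun {n : ℕ} (d : ℕ) (f : (Fin n → ℂ) → ℂ) : Prop :=
  ∃ p : MvPolynomial (Fin n) ℂ, p.IsHomogeneous d ∧ ∀ x, MvPolynomial.eval x p = f x

theorem MvPolynomial.IsHomogeneous.eval_smul' {n d : ℕ} {p : MvPolynomial (Fin n) ℂ}
    (hp : p.IsHomogeneous d) (c : ℂ) (x : Fin n → ℂ) : eval (c • x) p = c ^ d * eval x p := by
  rw [eval_eq, eval_eq, Finset.mul_sum]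
  refine Finset.sum_congr rfl fun m hm => ?_
  have hd : ∑ i ∈ m.support, m i = d := by
    have := hp (mem_support_iff.1 hm)
    simpa [Finsupp.weight_apply, Finsupp.sum] using this
  simp only [Pi.smul_apply, smul_eq_mul, mul_pow]
  rw [Finset.prod_mul_distrib, Finset.prod_pow_eq_pow_sum, hd]
  ring

theorem MvPolynomial.eval_aeval' {m n : ℕ} (q : Fin m → MvPolynomial (Fin n) ℂ)
    (p : MvPolynomial (Fin m) ℂ) (x : Fin n → ℂ) :
    eval x (aeval q p) = eval (fun i => eval x (q i)) p := by
  induction p using MvPolynomial.induction_on with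
  | C a => simp
  | add p q hp hq => rw [map_add, map_add, map_add, hp, hq]
  | mul_X p i hp => rw [map_mul, map_mul, map_mul, hp, aeval_X, eval_X]

theorem LinearMap.apply_eq_sum_mul_single {n : ℕ} (f : (Fin n → ℂ) →ₗ[ℂ] ℂ) (x : Fin n → ℂ) :
    f x = ∑ i, x i * f (Pi.single i 1) := by
  rw [LinearMap.pi_apply_eq_sum_univ f x]
  refine Finset.sum_congr rfl fun i _ => ?_
  rw [smul_eq_mul]
  congr 2
  ext j
  simp [Pi.single_apply, eq_comm]

namespace IsFormFun

variable {n d e : ℕ} {f g : (Fin n → ℂ) → ℂ}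

theorem mul (hf : IsFormFun d f) (hg : IsFormFun e g) : IsFormFun (d + e) fun x => f x * g x := by
  obtain ⟨p, hp, hpf⟩ := hf
  obtain ⟨q, hq, hqg⟩ := hg
  exact ⟨p * q, hp.mul hq, fun x => by rw [map_mul, hpf, hqg]⟩

theorem add (hf : IsFormFun d f) (hg : IsFormFun d g) : IsFormFun d fun x => f x + g x := by
  obtain ⟨p, hp, hpf⟩ := hf
  obtain ⟨q, hq, hqg⟩ := hg
  exact ⟨p + q, hp.add hq, fun x => by rw [map_add, hpf, hqg]⟩

theorem sub (hf : IsFormFun d f) (hg : IsFormFun d g) : IsFormFun d fun x => f x - g x := by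
  obtain ⟨p, hp, hpf⟩ := hf
  obtain ⟨q, hq, hqg⟩ := hg
  exact ⟨p - q, hp.sub hq, fun x => by rw [map_sub, hpf, hqg]⟩

theorem sum {ι : Type*} {s : Finset ι} {f : ι → (Fin n → ℂ) → ℂ}
    (hf : ∀ i ∈ s, IsFormFun d (f i)) : IsFormFun d fun x => ∑ i ∈ s, f i x := by
  choose! p hp hpf using hf
  refine ⟨∑ i ∈ s, p i, MvPolynomial.IsHomogeneous.sum _ _ _ hp, fun x => ?_⟩
  rw [map_sum]
  exact Finset.sum_congr rfl fun i hi => hpf i hi x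

theorem const_mul (c : ℂ) (hf : IsFormFun d f) : IsFormFun d fun x => c * f x := by
  obtain ⟨p, hp, hpf⟩ := hf
  exact ⟨MvPolynomial.C c * p, by simpa using (MvPolynomial.isHomogeneous_C _ c).mul hp,
    fun x => by rw [map_mul, hpf, MvPolynomial.eval_C]⟩

theorem linear (f : (Fin n → ℂ) →ₗ[ℂ] ℂ) : IsFormFun 1 f := by
  refine ⟨∑ i, MvPolynomial.C (f (Pi.single i 1)) * MvPolynomial.X i,
    MvPolynomial.IsHomogeneous.sum _ _ _ fun i _ => by
      simpa using (MvPolynomial.isHomogeneous_C _ _).mul (MvPolynomial.isHomogeneous_X ℂ i),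
    fun x => ?_⟩
  rw [LinearMap.apply_eq_sum_mul_single f x]
  simp [mul_comm]

theorem coord {m : ℕ} (M : (Fin n → ℂ) →ₗ[ℂ] (Fin m → ℂ)) (i : Fin m) :
    IsFormFun 1 fun x => M x i :=
  linear (LinearMap.proj i ∘ₗ M)

theorem trilinear (T : Trilinear) (M N K : (Fin n → ℂ) →ₗ[ℂ] (Fin 4 → ℂ)) :
    IsFormFun 3 fun x => T (M x) (N x) (K x) := by
  have h : ∀ u v w : Fin 4 → ℂ, T u v w = ∑ i, ∑ j, ∑ k,
      T (Pi.single i 1) (Pi.single j 1) (Pi.single k 1) * (u i * v j * w k) := by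
    intro u v w
    have e₁ := ((T.flip v).flip w).apply_eq_sum_mul_single u
    simp only [LinearMap.flip_apply] at e₁
    rw [e₁]
    refine Finset.sum_congr rfl fun i _ => ?_
    have e₂ := ((T (Pi.single i 1)).flip w).apply_eq_sum_mul_single v
    simp only [LinearMap.flip_apply] at e₂
    rw [e₂, Finset.mul_sum]
    refine Finset.sum_congr rfl fun j _ => ?_
    rw [(T (Pi.single i 1) (Pi.single j 1)).apply_eq_sum_mul_single w, Finset.mul_sum,
      Finset.mul_sum]
    refine Finset.sum_congr rfl fun k _ => ?_
    ring
  rw [show (fun x => T (M x) (N x) (K x)) = _ from funext fun x => h (M x) (N x) (K x)]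
  exact sum fun i _ => sum fun j _ => sum fun k _ =>
    ((((coord M i).mul (coord N j)).mul (coord K k))).const_mul _

theorem smul (hf : IsFormFun d f) (c : ℂ) (x : Fin n → ℂ) : f (c • x) = c ^ d * f x := by
  obtain ⟨p, hp, hpf⟩ := hf
  rw [← hpf, ← hpf, hp.eval_smul']

theorem continuous (hf : IsFormFun d f) : Continuous f := by
  obtain ⟨p, -, hpf⟩ := hf
  rw [← funext hpf]
  exact MvPolynomial.continuous_eval p

/-- The ring of polynomial functions has no zero divisors. -/
theorem eq_zero_of_mul_eq_zero (hf : IsFormFun d f) (hg : IsFormFun e g)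
    (h : ∀ x, f x * g x = 0) {x₀ : Fin n → ℂ} (h0 : f x₀ ≠ 0) (x : Fin n → ℂ) : g x = 0 := by
  obtain ⟨p, -, hpf⟩ := hf
  obtain ⟨q, -, hqg⟩ := hg
  have : p * q = 0 := MvPolynomial.funext fun x => by simp [hpf, hqg, h]
  rcases mul_eq_zero.1 this with h1 | h1
  · exact absurd (by rw [← hpf, h1, map_zero]) h0
  · rw [← hqg, h1, map_zero]

theorem comp {m : ℕ} {g : (Fin m → ℂ) → ℂ} (hg : IsFormFun d g)
    {φ : (Fin n → ℂ) → Fin m → ℂ} (hφ : ∀ i, IsFormFun e fun x => φ x i) :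
    IsFormFun (e * d) fun x => g (φ x) := by
  obtain ⟨p, hp, hpg⟩ := hg
  choose q hq hqφ using hφ
  refine ⟨MvPolynomial.aeval q p, hp.aeval q hq, fun x => ?_⟩
  have hφx : φ x = fun i => MvPolynomial.eval x (q i) := funext fun i => (hqφ i x).symm
  change _ = g (φ x)
  rw [← hpg, hφx, MvPolynomial.eval_aeval']

theorem isZariskiClosed (hf : IsFormFun d f) : IsZariskiClosed {x : PSpace n | f x.rep = 0} := by
  obtain ⟨p, hp, hpf⟩ := hf
  exact ⟨{p}, by simpa using ⟨d, hp⟩, by simp [hpf]⟩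

theorem rep_mk (hf : IsFormFun d f) {v : Fin n → ℂ} (hv : v ≠ 0) :
    f (Projectivization.mk ℂ v hv).rep = 0 ↔ f v = 0 := by
  obtain ⟨a, ha⟩ := Projectivization.exists_smul_eq_mk_rep ℂ v hv
  rw [← ha, Units.smul_def, hf.smul]
  simp

/-- A form `g` vanishing wherever `f` does not satisfies `f g = 0` identically, and polynomial
functions have no zero divisors. -/
theorem isDenseOpenIn_univ (hf : IsFormFun d f) (hd : d ≠ 0) {v : Fin n → ℂ} (hv : f v ≠ 0) :
    IsDenseOpenIn {x : PSpace n | f x.rep ≠ 0} Set.univ := by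
  refine ⟨⟨_, hf.isZariskiClosed, ?_⟩, ?_⟩
  · ext x; simp
  · rintro Z ⟨I, hI, rfl⟩ hU x - g hg
    obtain ⟨e, he⟩ := hI g hg
    have hgf : IsFormFun e fun x => MvPolynomial.eval x g := ⟨g, he, fun _ => rfl⟩
    refine hf.eq_zero_of_mul_eq_zero hgf (fun w => ?_) hv _
    -- The origin is not a projective point; there the product vanishes because `f` has positive
    -- degree.
    by_cases hw : w = 0
    · have := hf.smul 0 0
      rw [smul_zero, zero_pow hd, zero_mul] at this
      rw [hw, this, zero_mul]
    · by_cases hfw : f w = 0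
      · rw [hfw, zero_mul]
      · have h1 : MvPolynomial.eval (Projectivization.mk ℂ w hw).rep g = 0 :=
          hU (show Projectivization.mk ℂ w hw ∈ {x : PSpace n | f x.rep ≠ 0} from
            fun h => hfw ((hf.rep_mk hw).1 h)) g hg
        rw [(hgf.rep_mk hw).1 h1, mul_zero]

end IsFormFun

/-! ### Zariski density of third points in the surface. -/

namespace SkewLines

variable {T : Trilinear} {ℓ₁ ℓ₂ : Submodule ℂ (Fin 4 → ℂ)}
  {P Q : (Fin 4 → ℂ) →ₗ[ℂ] (Fin 4 → ℂ)}

theorem formA_swap (S : SkewLines T ℓ₁ ℓ₂ P Q) (v : Fin 4 → ℂ) :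
    formA T Q P v = formB T P Q v := by
  rw [formA, formB, S.swap₂, S.swap₁]

theorem formB_swap (S : SkewLines T ℓ₁ ℓ₂ P Q) (v : Fin 4 → ℂ) :
    formB T Q P v = formA T P Q v := (S.symm.formA_swap v).symm

theorem thirdVec_swap (S : SkewLines T ℓ₁ ℓ₂ P Q) (v : Fin 4 → ℂ) :
    thirdVec T Q P v = (-1 : ℂ) • thirdVec T P Q v := by
  rw [thirdVec, thirdVec, S.formA_swap, S.formB_swap, neg_one_smul, neg_sub]

theorem formA_add (S : SkewLines T ℓ₁ ℓ₂ P Q) {a b : Fin 4 → ℂ} (ha : a ∈ ℓ₁) (hb : b ∈ ℓ₂) :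
    formA T P Q (a + b) = 3 * T a a b := by
  rw [formA, (S.proj_add ha hb).1, (S.proj_add ha hb).2]

theorem formB_add (S : SkewLines T ℓ₁ ℓ₂ P Q) {a b : Fin 4 → ℂ} (ha : a ∈ ℓ₁) (hb : b ∈ ℓ₂) :
    formB T P Q (a + b) = 3 * T a b b := by
  rw [formB, (S.proj_add ha hb).1, (S.proj_add ha hb).2]

theorem thirdVec_add (S : SkewLines T ℓ₁ ℓ₂ P Q) {a b : Fin 4 → ℂ} (ha : a ∈ ℓ₁)
    (hb : b ∈ ℓ₂) : thirdVec T P Q (a + b) = (3 * T a b b) • a - (3 * T a a b) • b := by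
  rw [thirdVec, S.formA_add ha hb, S.formB_add ha hb, (S.proj_add ha hb).1, (S.proj_add ha hb).2]

theorem proj_thirdVec (S : SkewLines T ℓ₁ ℓ₂ P Q) (v : Fin 4 → ℂ) :
    P (thirdVec T P Q v) = formB T P Q v • P v ∧
      Q (thirdVec T P Q v) = (-formA T P Q v) • Q v := by
  rw [thirdVec, sub_eq_add_neg, ← neg_smul]
  exact S.proj_add (ℓ₁.smul_mem _ (S.mem₁ v)) (ℓ₂.smul_mem _ (S.mem₂ v))

theorem cubic_thirdVec (S : SkewLines T ℓ₁ ℓ₂ P Q) (v : Fin 4 → ℂ) :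
    T (thirdVec T P Q v) (thirdVec T P Q v) (thirdVec T P Q v) = 0 := by
  have : thirdVec T P Q v = formB T P Q v • P v + (-formA T P Q v) • Q v := by
    rw [thirdVec, sub_eq_add_neg, neg_smul]
  rw [this, S.cubic_transversal]
  ring

/-- On a transversal inside the surface `thirdVec` itself vanishes, so its points are reached as
limits. Moving to `a + εξ a'` and `b + εη b'` gives third points `ε Y(ε)`, and the nonzero
determinant allows `ξ`, `η` to be chosen so that `Y(0)` is the prescribed point `s a + t b`. -/
theorem eval_eq_zero_of_transversal (S : SkewLines T ℓ₁ ℓ₂ P Q) {e : ℕ}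
    {g : (Fin 4 → ℂ) → ℂ} (hg : IsFormFun e g) (h : ∀ v, g (thirdVec T P Q v) = 0)
    {a b : Fin 4 → ℂ} (ha : a ∈ ℓ₁) (hb : b ∈ ℓ₂) (ha0 : a ≠ 0) (hb0 : b ≠ 0)
    (haab : T a a b = 0) (habb : T a b b = 0) (s t : ℂ) : g (s • a + t • b) = 0 := by
  obtain ⟨a', ha', -, hsa⟩ := Submodule.exists_span_pair S.rank₁ ha ha0
  obtain ⟨b', hb', -, hsb⟩ := Submodule.exists_span_pair S.rank₂ hb hb0
  have hJ := S.jacobian_ne ha hb ha0 hb0 hsa hsb haab habb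
  set J := T a a b' * T a' b b - 4 * (T a a' b * T a b b') with hJdef
  -- Cramer's rule for the linear system `hB1`, `hA1`, whose determinant is `J` up to a constant.
  obtain ⟨ξ, hξ⟩ : ∃ ξ, ξ = (s * T a a b' + 2 * t * T a b b') / (3 * J) := ⟨_, rfl⟩
  obtain ⟨η, hη⟩ : ∃ η, η = -(t * T a' b b + 2 * s * T a a' b) / (3 * J) := ⟨_, rfl⟩
  have hB1 : 3 * (ξ * T a' b b + 2 * η * T a b b') = s := by
    rw [hξ, hη]; field_simp; rw [hJdef]; ring
  have hA1 : 3 * (2 * ξ * T a a' b + η * T a a b') = -t := by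
    rw [hξ, hη]; field_simp; rw [hJdef]; ring
  -- `A'` and `B'` are `A` and `B` on the deformed pair divided by `ε`; their values at 0 are `-t`
  -- and `s`.
  let A' : ℂ → ℂ := fun ε => -t + 3 * ε * (ξ ^ 2 * T a' a' b + 2 * ξ * η * T a a' b') +
    3 * ε ^ 2 * (ξ ^ 2 * η * T a' a' b')
  let B' : ℂ → ℂ := fun ε => s + 3 * ε * (η ^ 2 * T a b' b' + 2 * ξ * η * T a' b b') +
    3 * ε ^ 2 * (ξ * η ^ 2 * T a' b' b')
  let Y : ℂ → Fin 4 → ℂ := fun ε =>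
    B' ε • (a + (ε * ξ) • a') - A' ε • (b + (ε * η) • b')
  have hY : ∀ ε, thirdVec T P Q ((a + (ε * ξ) • a') + (b + (ε * η) • b')) = ε • Y ε := by
    intro ε
    rw [S.thirdVec_add (ℓ₁.add_mem ha (ℓ₁.smul_mem _ ha')) (ℓ₂.add_mem hb (ℓ₂.smul_mem _ hb'))]
    have e1 : T a' a b = T a a' b := S.swap₁ _ _ _
    have e2 : T a' a b' = T a a' b' := S.swap₁ _ _ _
    have e3 : T a b' b = T a b b' := S.swap₂ _ _ _
    have e4 : T a' b' b = T a' b b' := S.swap₂ _ _ _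
    have hA : 3 * T (a + (ε * ξ) • a') (a + (ε * ξ) • a') (b + (ε * η) • b') = ε * A' ε := by
      simp only [A', map_add, map_smul, LinearMap.add_apply, LinearMap.smul_apply, smul_eq_mul,
        e1, e2, haab]
      linear_combination ε * hA1
    have hB : 3 * T (a + (ε * ξ) • a') (b + (ε * η) • b') (b + (ε * η) • b') = ε * B' ε := by
      simp only [B', map_add, map_smul, LinearMap.add_apply, LinearMap.smul_apply, smul_eq_mul,
        e3, e4, habb]
      linear_combination ε * hB1
    rw [hA, hB, mul_smul ε (B' ε), mul_smul ε (A' ε), ← smul_sub]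
  have hY0 : ∀ ε ∈ ({0}ᶜ : Set ℂ), g (Y ε) = (fun _ => (0 : ℂ)) ε := by
    intro ε hε
    have := h ((a + (ε * ξ) • a') + (b + (ε * η) • b'))
    rw [hY, hg.smul] at this
    exact (mul_eq_zero.1 this).resolve_left (pow_ne_zero _ hε)
  -- The form vanishes on `Y ε` for `ε ≠ 0`; continuity extends this to `ε = 0`.
  have hcont : Continuous fun ε => g (Y ε) := hg.continuous.comp (by fun_prop)
  have := congrFun (hcont.ext_on (dense_compl_singleton 0) continuous_const hY0) 0
  simpa [Y, A', B'] using this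

/-- Take `b ∈ ℓ₂` with `T a a b = 0`. Then the third point of `a + b` is `a` itself, unless the
transversal lies on the surface, which is the preceding case. -/
theorem eval_eq_zero_of_left (S : SkewLines T ℓ₁ ℓ₂ P Q) {e : ℕ}
    {g : (Fin 4 → ℂ) → ℂ} (hg : IsFormFun e g) (h : ∀ v, g (thirdVec T P Q v) = 0)
    {a : Fin 4 → ℂ} (ha : a ∈ ℓ₁) (ha0 : a ≠ 0) : g a = 0 := by
  obtain ⟨b, hb, hb0, haab⟩ := Submodule.exists_mem_ne_zero_linear_eq_zero S.rank₂ (T a a)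
  by_cases habb : T a b b = 0
  · simpa using S.eval_eq_zero_of_transversal hg h ha hb ha0 hb0 haab habb 1 0
  · have := h (a + b)
    rw [S.thirdVec_add ha hb, haab, mul_zero, zero_smul, sub_zero, hg.smul] at this
    exact (mul_eq_zero.1 this).resolve_left (pow_ne_zero _ (by simpa using habb))

/-- A form vanishing on all third intersection points vanishes on the whole surface. -/
theorem eval_eq_zero_of_cubic (S : SkewLines T ℓ₁ ℓ₂ P Q) {e : ℕ}
    {g : (Fin 4 → ℂ) → ℂ} (hg : IsFormFun e g) (h : ∀ v, g (thirdVec T P Q v) = 0)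
    {y : Fin 4 → ℂ} (hy : y ≠ 0) (hyS : T y y y = 0) : g y = 0 := by
  have hAB := S.cubic_eq_add y
  rw [hyS] at hAB
  have hB : formB T P Q y = -formA T P Q y := by linear_combination -hAB
  -- On the surface `B = -A`, so `thirdVec y = -A y`: where `A ≠ 0`, `y` is its own third point.
  -- Where `A = 0`, `y` lies on one of the two lines or on a transversal contained in the surface.
  by_cases hA : formA T P Q y = 0
  · rw [hA, neg_zero] at hB
    by_cases hP : P y = 0
    · refine S.symm.eval_eq_zero_of_left hg (fun v => ?_) ((S.mem_right_iff y).2 hP) hy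
      rw [S.thirdVec_swap, hg.smul, h, mul_zero]
    by_cases hQ : Q y = 0
    · exact S.eval_eq_zero_of_left hg h ((S.mem_left_iff y).2 hQ) hy
    · have := S.eval_eq_zero_of_transversal hg h (S.mem₁ y) (S.mem₂ y) hP hQ
        (by simpa [formA] using hA) (by simpa [formB] using hB) 1 1
      simpa [S.add] using this
  · have := h y
    have e : thirdVec T P Q y = (-formA T P Q y) • y := by
      conv_rhs => rw [← S.add y, smul_add, S.add y]
      rw [thirdVec, hB, neg_smul (formA T P Q y) (Q y), sub_eq_add_neg]
    rw [e, hg.smul] at this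
    exact (mul_eq_zero.1 this).resolve_left (pow_ne_zero _ (neg_ne_zero.2 hA))

theorem isFormFun_formA : IsFormFun 3 (formA T P Q) :=
  (IsFormFun.trilinear T P P Q).const_mul 3

theorem isFormFun_formB : IsFormFun 3 (formB T P Q) :=
  (IsFormFun.trilinear T P Q Q).const_mul 3

theorem isFormFun_thirdVec (i : Fin 4) : IsFormFun 4 fun v => thirdVec T P Q v i :=
  (isFormFun_formB.mul (IsFormFun.coord P i)).sub (isFormFun_formA.mul (IsFormFun.coord Q i))

/-- Third points are parametrised by `ℂ⁴`, so the product `f g` can be pulled back along `thirdVec`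
to a ring without zero divisors. Irreducibility of the surface is never needed separately. -/
theorem isDenseOpenIn_surface (S : SkewLines T ℓ₁ ℓ₂ P Q) {F : MvPolynomial (Fin 4) ℂ}
    (hF : ∀ v, MvPolynomial.eval v F = T v v v) {d : ℕ} {f : (Fin 4 → ℂ) → ℂ}
    (hf : IsFormFun d f) (hd : d ≠ 0) {v : Fin 4 → ℂ} (hv : f (thirdVec T P Q v) ≠ 0) :
    IsDenseOpenIn {y : PSpace 4 | y ∈ surface F ∧ f y.rep ≠ 0} (surface F) := by
  refine ⟨⟨_, hf.isZariskiClosed, ?_⟩, ?_⟩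
  · ext x; simp
  · rintro Z ⟨I, hI, rfl⟩ hU y hy g hg
    obtain ⟨e, he⟩ := hI g hg
    have hgf : IsFormFun e fun x => MvPolynomial.eval x g := ⟨g, he, fun _ => rfl⟩
    have hFf : IsFormFun 3 fun x => T x x x :=
      IsFormFun.trilinear T LinearMap.id LinearMap.id LinearMap.id
    have hyS : T y.rep y.rep y.rep = 0 := by rw [← hF]; exact hy
    refine S.eval_eq_zero_of_cubic hgf ?_ y.rep_nonzero hyS
    refine (hf.comp isFormFun_thirdVec).eq_zero_of_mul_eq_zero (hgf.comp isFormFun_thirdVec)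
      (fun w => ?_) hv
    by_cases hw : thirdVec T P Q w = 0
    · have := hf.smul 0 0
      rw [smul_zero, zero_pow hd, zero_mul] at this
      simp only [hw, this, zero_mul]
    · by_cases hfw : f (thirdVec T P Q w) = 0
      · simp only [hfw, zero_mul]
      · have h1 : MvPolynomial.eval (Projectivization.mk ℂ _ hw).rep g = 0 := by
          refine hU ⟨?_, fun h => hfw ((hf.rep_mk hw).1 h)⟩ g hg
          change MvPolynomial.eval _ F = 0
          rw [hF]
          exact (hFf.rep_mk hw).2 (S.cubic_thirdVec w)
        have h2 := (hgf.rep_mk hw).1 h1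
        simp only [h2, mul_zero]

end SkewLines

/-! ### Two quadratic forms without common factor -/

namespace MvPolynomial

theorem degreeOf_eq_zero_of_dvd {n : ℕ} {f g : MvPolynomial (Fin n) ℂ} (hfg : g ∣ f)
    (hf : f ≠ 0) {i : Fin n} (h : degreeOf i f = 0) : degreeOf i g = 0 := by
  obtain ⟨k, rfl⟩ := hfg
  obtain ⟨hg, hk⟩ := mul_ne_zero_iff.1 hf
  rw [degreeOf_mul_eq hg hk] at h
  omega

theorem degreeOf_eq_zero_of_mem_supported {n : ℕ} {f : MvPolynomial (Fin n) ℂ} {i : Fin n}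
    (h : f ∈ supported ℂ ({i}ᶜ : Set (Fin n))) : degreeOf i f = 0 := by
  rw [mem_supported] at h
  by_contra h0
  have hi : i ∈ f.vars := by
    classical
    rw [vars_def, Multiset.mem_toFinset, ← Multiset.count_pos, ← degreeOf_def]
    omega
  exact h (Finset.mem_coe.2 hi) rfl

theorem eval_eq_of_degreeOf_eq_zero {n : ℕ} {f : MvPolynomial (Fin n) ℂ} {x y : Fin n → ℂ}
    (h : ∀ i, degreeOf i f = 0 ∨ x i = y i) : eval x f = eval y f := by
  refine eval₂Hom_congr' rfl (fun i hi _ => ?_) rfl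
  refine (h i).resolve_left fun h0 => ?_
  classical
  rw [vars_def, Multiset.mem_toFinset, ← Multiset.count_pos, ← degreeOf_def] at hi
  omega

theorem polynomial_eval_aeval {n : ℕ} (q : Fin n → Polynomial ℂ) (f : MvPolynomial (Fin n) ℂ)
    (t : ℂ) : (aeval q f).eval t = eval (fun i => (q i).eval t) f := by
  induction f using MvPolynomial.induction_on with
  | C a => simp
  | add p q hp hq => rw [map_add, Polynomial.eval_add, map_add, hp, hq]
  | mul_X p i hp => rw [map_mul, Polynomial.eval_mul, map_mul, hp, aeval_X, eval_X]

/-- A quadratic form that is at most linear in `X j`, and has coefficient `α₁` at `(X i)²`. -/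
noncomputable def quadric (i j : Fin 3) (α₁ α₂ α₃ α₄ α₅ : ℂ) : MvPolynomial (Fin 3) ℂ :=
  C α₁ * X i ^ 2 + C α₂ * (X i * X j) + C α₃ * (X i * X 2) + C α₄ * (X j * X 2) + C α₅ * X 2 ^ 2

/-- With respect to `X j` the two quadrics are `e X j + c` and `β₁ (X j)² + k X j + l`, and `R` is
their resultant. It is free of `X j`, and at the `i`-th unit vector it takes the value `α₁ (α₁ β₁ -
α₂ β₂) ≠ 0`. Hence `g` divides a nonzero polynomial free of `X j`. -/
theorem degreeOf_common_factor {i j : Fin 3} (hij : i ≠ j) (hi : i ≠ 2) (hj : j ≠ 2)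
    {α₁ α₂ α₃ α₄ α₅ β₁ β₂ β₃ β₄ β₅ : ℂ} (hα : α₁ ≠ 0) (h : α₁ * β₁ - α₂ * β₂ ≠ 0)
    {g : MvPolynomial (Fin 3) ℂ} (hA : g ∣ X 2 * quadric i j α₁ α₂ α₃ α₄ α₅)
    (hB : g ∣ X 2 * quadric j i β₁ β₂ β₃ β₄ β₅) : degreeOf j g = 0 := by
  set c : MvPolynomial (Fin 3) ℂ := C α₁ * X i ^ 2 + C α₃ * (X i * X 2) + C α₅ * X 2 ^ 2 with hc
  set e : MvPolynomial (Fin 3) ℂ := C α₂ * X i + C α₄ * X 2 with he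
  set k : MvPolynomial (Fin 3) ℂ := C β₂ * X i + C β₃ * X 2 with hk
  set l : MvPolynomial (Fin 3) ℂ := C β₄ * (X i * X 2) + C β₅ * X 2 ^ 2 with hl
  set R : MvPolynomial (Fin 3) ℂ := C β₁ * c ^ 2 - k * e * c + l * e ^ 2 with hR
  have hgR : g ∣ X 2 * R := by
    -- Obtained by substituting `e X j = (first quadric) - c` in `e²` times the second quadric and
    -- collecting the multiples of the first.
    have : X 2 * R = X 2 * quadric j i β₁ β₂ β₃ β₄ β₅ * e ^ 2 -
        X 2 * quadric i j α₁ α₂ α₃ α₄ α₅ *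
          (C β₁ * (quadric i j α₁ α₂ α₃ α₄ α₅ - 2 * c) + k * e) := by
      simp only [hR, hc, he, hk, hl, quadric]
      ring
    rw [this]
    exact dvd_sub (hB.mul_right _) (hA.mul_right _)
  have hR0 : R ≠ 0 := by
    intro h0
    have := congrArg (eval (Pi.single i 1)) h0
    simp only [hR, hc, he, hk, hl, map_add, map_sub, map_mul, map_pow, eval_C, eval_X,
      Pi.single_eq_same, Pi.single_eq_of_ne hi.symm, map_zero] at this
    exact (mul_ne_zero hα h) (by linear_combination this)
  refine degreeOf_eq_zero_of_dvd hgR (mul_ne_zero (X_ne_zero 2) hR0)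
    (degreeOf_eq_zero_of_mem_supported ?_)
  have mi : (X i : MvPolynomial (Fin 3) ℂ) ∈ supported ℂ ({j}ᶜ : Set (Fin 3)) :=
    X_mem_supported.2 hij
  have m2 : (X 2 : MvPolynomial (Fin 3) ℂ) ∈ supported ℂ ({j}ᶜ : Set (Fin 3)) :=
    X_mem_supported.2 hj.symm
  have mC : ∀ r : ℂ, (C r : MvPolynomial (Fin 3) ℂ) ∈ supported ℂ ({j}ᶜ : Set (Fin 3)) :=
    fun r => (supported ℂ ({j}ᶜ : Set (Fin 3))).algebraMap_mem r
  simp only [hR, hc, he, hk, hl]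
  repeat' first
    | exact mi | exact m2 | exact mC _ | refine pow_mem ?_ _ | refine add_mem ?_ ?_
    | refine sub_mem ?_ ?_ | refine mul_mem ?_ ?_

/-- Both resultants are nonzero, so `g` involves only `X 2`. The divisibility `hB'` without the
factor `X 2` then excludes a nonconstant `g`, in particular `X 2` itself. -/
theorem isUnit_of_dvd_quadrics {α₁ α₂ α₃ α₄ α₅ β₁ β₂ β₃ β₄ β₅ : ℂ} (hα : α₁ ≠ 0) (hβ : β₁ ≠ 0)
    (h : α₁ * β₁ - α₂ * β₂ ≠ 0) {g : MvPolynomial (Fin 3) ℂ}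
    (hA : g ∣ X 2 * quadric 0 1 α₁ α₂ α₃ α₄ α₅) (hB : g ∣ X 2 * quadric 1 0 β₁ β₂ β₃ β₄ β₅)
    (hB' : g ∣ X 0 * quadric 1 0 β₁ β₂ β₃ β₄ β₅) : IsUnit g := by
  have d1 : degreeOf 1 g = 0 :=
    degreeOf_common_factor (by decide) (by decide) (by decide) hα h hA hB
  have d0 : degreeOf 0 g = 0 :=
    degreeOf_common_factor (by decide) (by decide) (by decide) hβ
      (fun h' => h (by linear_combination h')) hB hA
  set p : Polynomial ℂ := aeval ![0, 0, Polynomial.X] g with hp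
  have hgp : ∀ x, eval x g = p.eval (x 2) := by
    intro x
    rw [hp, polynomial_eval_aeval]
    apply eval_eq_of_degreeOf_eq_zero
    intro i
    fin_cases i
    · exact Or.inl d0
    · exact Or.inl d1
    · right; simp
  by_cases hdeg : p.degree = 0
  · rw [Polynomial.eq_C_of_degree_eq_zero hdeg] at hgp
    have hg : g = C (p.coeff 0) := MvPolynomial.funext fun x => by rw [hgp]; simp
    have hc0 : p.coeff 0 ≠ 0 := by
      intro h0
      rw [Polynomial.eq_C_of_degree_eq_zero hdeg, h0] at hdeg
      simp at hdeg
    rw [hg]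
    exact (IsUnit.mk0 _ hc0).map C
  · exfalso
    -- At a root `t` the second quadric would vanish at `(1, s, t)` for all `s`; its second
    -- difference in `s` returns `β₁`.
    obtain ⟨t, ht⟩ := IsAlgClosed.exists_root p hdeg
    obtain ⟨k, hk⟩ := hB'
    have key : ∀ s : ℂ, β₁ * s ^ 2 + β₂ * s + β₃ * (s * t) + β₄ * t + β₅ * t ^ 2 = 0 := by
      intro s
      have h1 := congrArg (eval ![1, s, t]) hk
      rw [map_mul, map_mul, hgp] at h1
      have h2 : p.eval t = 0 := ht
      simp only [quadric, Matrix.cons_val, h2, zero_mul, map_add, map_mul, map_pow, eval_C,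
        eval_X] at h1
      linear_combination h1
    apply hβ
    linear_combination (1 / 2) * key 1 + (1 / 2) * key (-1) - key 0

end MvPolynomial

/-! ### Coordinates on the plane adapted to the two lines -/

/-- Linear coordinates `E` on the plane `h = 0`, compared with the coordinates `u, v, w` given by
the points `p₁`, `p₂` and `a₁ + a₂` of the plane. -/
structure PlaneFrame (T : Trilinear) (ℓ₁ ℓ₂ : Submodule ℂ (Fin 4 → ℂ))
    (P Q : (Fin 4 → ℂ) →ₗ[ℂ] (Fin 4 → ℂ)) (E : (Fin 3 → ℂ) →ₗ[ℂ] (Fin 4 → ℂ))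
    (G : (Fin 4 → ℂ) →ₗ[ℂ] (Fin 3 → ℂ)) (h : (Fin 4 → ℂ) →ₗ[ℂ] ℂ) (p₁ a₁ p₂ a₂ : Fin 4 → ℂ)
    (u v w : (Fin 3 → ℂ) →ₗ[ℂ] ℂ) : Prop extends SkewLines T ℓ₁ ℓ₂ P Q where
  mem_p₁ : p₁ ∈ ℓ₁
  mem_a₁ : a₁ ∈ ℓ₁
  mem_p₂ : p₂ ∈ ℓ₂
  mem_a₂ : a₂ ∈ ℓ₂
  ne_p₁ : p₁ ≠ 0
  ne_p₂ : p₂ ≠ 0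
  span₁ : ∀ x ∈ ℓ₁, ∃ s t : ℂ, x = s • p₁ + t • a₁
  span₂ : ∀ x ∈ ℓ₂, ∃ s t : ℂ, x = s • p₂ + t • a₂
  van₁ : T p₁ p₁ p₂ = 0
  van₂ : T p₁ p₂ p₂ = 0
  h_p₁ : h p₁ = 0
  h_p₂ : h p₂ = 0
  h_a₁ : h a₁ = 1
  h_a₂ : h a₂ = -1
  h_E : ∀ y, h (E y) = 0
  G_E : ∀ y, G (E y) = y
  E_G : ∀ x, h x = 0 → E (G x) = x
  proj₁ : ∀ y, P (E y) = u y • p₁ + w y • a₁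
  proj₂ : ∀ y, Q (E y) = v y • p₂ + w y • a₂

theorem Submodule.exists_ker_eq {H : Submodule ℂ (Fin 4 → ℂ)} (hH : Module.finrank ℂ H = 3) :
    ∃ h : (Fin 4 → ℂ) →ₗ[ℂ] ℂ, LinearMap.ker h = H := by
  have hlt : H < ⊤ := by
    rw [lt_top_iff_ne_top]
    rintro rfl
    simp at hH
  obtain ⟨h, hne, hle⟩ := H.exists_le_ker_of_lt_top hlt
  refine ⟨h, (Submodule.eq_of_le_of_finrank_le hle ?_).symm⟩
  have h1 := h.finrank_range_add_finrank_ker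
  have h2 : LinearMap.range h = ⊤ := LinearMap.range_eq_top.2 (LinearMap.surjective hne)
  rw [h2, finrank_top] at h1
  simp at h1
  omega

/-- Coordinates on a line `L` that is not contained in the plane `h = 0`: the point `p` of the
plane and a point `a` off the plane span `L`. -/
theorem Submodule.eq_smul_add_of_mem {L : Submodule ℂ (Fin 4 → ℂ)} (hL : Module.finrank ℂ L = 2)
    {p a : Fin 4 → ℂ} (hp : p ∈ L) (ha : a ∈ L) (hp0 : p ≠ 0) {h f : (Fin 4 → ℂ) →ₗ[ℂ] ℂ}
    (hhp : h p = 0) (hha : h a ≠ 0) (hf : f p = 1) {x : Fin 4 → ℂ} (hx : x ∈ L) :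
    x = f (x - (h x / h a) • a) • p + (h x / h a) • a := by
  obtain ⟨a', ha', -, hspan⟩ := exists_span_pair hL hp hp0
  have hha' : h a' ≠ 0 := by
    intro h0
    obtain ⟨s, t, rfl⟩ := hspan a ha
    exact hha (by simp [hhp, h0])
  obtain ⟨s, t, hst⟩ := hspan (x - (h x / h a) • a) (L.sub_mem hx (L.smul_mem _ ha))
  have ht : t = 0 := by
    have := congrArg h hst
    simp only [map_sub, map_add, map_smul, smul_eq_mul, hhp, mul_zero, zero_add,
      div_mul_cancel₀ _ hha, sub_self] at this
    exact (mul_eq_zero.1 this.symm).resolve_right hha'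
  have hs : f (x - (h x / h a) • a) = s := by rw [hst, ht]; simp [hf]
  rw [hs, ← sub_eq_iff_eq_add, hst, ht, zero_smul, add_zero]

namespace SkewLines

variable {T : Trilinear} {ℓ₁ ℓ₂ : Submodule ℂ (Fin 4 → ℂ)}
  {P Q : (Fin 4 → ℂ) →ₗ[ℂ] (Fin 4 → ℂ)}

theorem exists_planeFrame (S : SkewLines T ℓ₁ ℓ₂ P Q) {F : MvPolynomial (Fin 4) ℂ}
    (hF : ∀ v, MvPolynomial.eval v F = T v v v) {m H : Submodule ℂ (Fin 4 → ℂ)}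
    (hadm : IsAdmissible F ℓ₁ ℓ₂ m H) {E : (Fin 3 → ℂ) →ₗ[ℂ] (Fin 4 → ℂ)}
    (hE : Function.Injective E) (hEH : LinearMap.range E = H) :
    ∃ G h p₁ a₁ p₂ a₂ u v w, PlaneFrame T ℓ₁ ℓ₂ P Q E G h p₁ a₁ p₂ a₂ u v w := by
  obtain ⟨⟨hm2, hmF⟩, hm₁, hm₂, hH3, hmH, h₁, h₂⟩ := hadm
  obtain ⟨h, hh⟩ := Submodule.exists_ker_eq hH3
  obtain ⟨p₁, hp₁, p₂, hp₂, hp₁0, hp₂0, rfl⟩ := S.exists_eq_span_pair hm2 hm₁ hm₂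
  obtain ⟨b₁, hb₁, hb₁H⟩ := Set.not_subset.1 h₁
  obtain ⟨b₂, hb₂, hb₂H⟩ := Set.not_subset.1 h₂
  have hker : ∀ x, h x = 0 ↔ x ∈ H := fun x => by rw [← hh, LinearMap.mem_ker]
  have hhb₁ : h b₁ ≠ 0 := fun h0 => hb₁H ((hker _).1 h0)
  have hhb₂ : h b₂ ≠ 0 := fun h0 => hb₂H ((hker _).1 h0)
  have hhp₁ : h p₁ = 0 := (hker _).2 (hmH (Submodule.subset_span (by simp)))
  have hhp₂ : h p₂ = 0 := (hker _).2 (hmH (Submodule.subset_span (by simp)))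
  -- The opposite values 1 and −1 of `h` put `a₁ + a₂` in the plane, and both components of a point
  -- of the plane then share the coordinate `w`.
  obtain ⟨a₁, ha₁, hha₁⟩ : ∃ a ∈ ℓ₁, h a = 1 :=
    ⟨(h b₁)⁻¹ • b₁, ℓ₁.smul_mem _ hb₁, by simp [hhb₁]⟩
  obtain ⟨a₂, ha₂, hha₂⟩ : ∃ a ∈ ℓ₂, h a = -1 :=
    ⟨(-(h b₂)⁻¹) • b₂, ℓ₂.smul_mem _ hb₂, by simp [hhb₂]⟩
  obtain ⟨f₁, hf₁⟩ := exists_dual_eq_one hp₁0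
  obtain ⟨f₂, hf₂⟩ := exists_dual_eq_one hp₂0
  obtain ⟨G, hG⟩ := LinearMap.exists_leftInverse_of_injective E (LinearMap.ker_eq_bot.2 hE)
  have hGE : ∀ y, G (E y) = y := fun y => by
    rw [← LinearMap.comp_apply, hG, LinearMap.id_apply]
  have e₁ : ∀ x ∈ ℓ₁, x = f₁ (x - h x • a₁) • p₁ + h x • a₁ := fun x hx => by
    simpa [hha₁] using Submodule.eq_smul_add_of_mem S.rank₁ hp₁ ha₁ hp₁0 hhp₁
      (by rw [hha₁]; exact one_ne_zero) hf₁ hx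
  have e₂ : ∀ x ∈ ℓ₂, x = f₂ (x - (-h x) • a₂) • p₂ + (-h x) • a₂ := fun x hx => by
    simpa [hha₂, div_neg] using Submodule.eq_smul_add_of_mem S.rank₂ hp₂ ha₂ hp₂0 hhp₂
      (by rw [hha₂]; norm_num) hf₂ hx
  have hhE : ∀ y, h (E y) = 0 := fun y => (hker _).2 (hEH ▸ LinearMap.mem_range_self E y)
  -- Since `m` lies on the surface, the mixed terms of the cubic on `m` vanish identically.
  have hT0 : ∀ s t : ℂ, 3 * s ^ 2 * t * T p₁ p₁ p₂ + 3 * s * t ^ 2 * T p₁ p₂ p₂ = 0 := by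
    intro s t
    have := hmF (s • p₁ + t • p₂) (Submodule.mem_span_pair.2 ⟨s, t, rfl⟩)
    rw [hF, S.cubic_add, S.zero₁ _ hp₁, S.zero₂ _ hp₂] at this
    linear_combination this
  refine ⟨G, h, p₁, a₁, p₂, a₂, (f₁ ∘ₗ (LinearMap.id - h.smulRight a₁)) ∘ₗ P ∘ₗ E,
    (f₂ ∘ₗ (LinearMap.id + h.smulRight a₂)) ∘ₗ Q ∘ₗ E, h ∘ₗ P ∘ₗ E,
    { S with
      mem_p₁ := hp₁, mem_a₁ := ha₁, mem_p₂ := hp₂, mem_a₂ := ha₂, ne_p₁ := hp₁0, ne_p₂ := hp₂0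
      span₁ := fun x hx => ⟨_, _, e₁ x hx⟩
      span₂ := fun x hx => ⟨_, _, e₂ x hx⟩
      van₁ := by linear_combination (1 / 6) * hT0 1 1 - (1 / 6) * hT0 1 (-1)
      van₂ := by linear_combination (1 / 6) * hT0 1 1 + (1 / 6) * hT0 1 (-1)
      h_p₁ := hhp₁, h_p₂ := hhp₂, h_a₁ := hha₁, h_a₂ := hha₂, h_E := hhE, G_E := hGE
      E_G := ?_, proj₁ := ?_, proj₂ := ?_ }⟩
  · intro x hx
    rw [hker, ← hEH] at hx
    obtain ⟨y, rfl⟩ := hx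
    rw [hGE]
  · intro y
    simpa using e₁ _ (S.mem₁ (E y))
  · intro y
    have hw : h (P (E y)) = -h (Q (E y)) := by
      have := hhE y
      rw [← S.add (E y), map_add] at this
      linear_combination this
    simpa [hw] using e₂ _ (S.mem₂ (E y))

end SkewLines

theorem MvPolynomial.isHomogeneous_quadric (i j : Fin 3) (α₁ α₂ α₃ α₄ α₅ : ℂ) :
    (quadric i j α₁ α₂ α₃ α₄ α₅).IsHomogeneous 2 := by
  have hC : ∀ (c : ℂ) {p : MvPolynomial (Fin 3) ℂ}, p.IsHomogeneous 2 →
      (C c * p).IsHomogeneous 2 := fun c p hp => by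
    simpa using (isHomogeneous_C _ c).mul hp
  have hX : ∀ k l : Fin 3, (X k * X l : MvPolynomial (Fin 3) ℂ).IsHomogeneous 2 := fun k l =>
    (isHomogeneous_X ℂ k).mul (isHomogeneous_X ℂ l)
  have hX2 : ∀ k : Fin 3, (X k ^ 2 : MvPolynomial (Fin 3) ℂ).IsHomogeneous 2 := fun k =>
    sq (X k : MvPolynomial (Fin 3) ℂ) ▸ hX k k
  exact ((((hC _ (hX2 i)).add (hC _ (hX i j))).add (hC _ (hX i 2))).add (hC _ (hX j 2))).add
    (hC _ (hX2 2))

theorem IsFormFun.exists_mul_ne {n d e : ℕ} {f g : (Fin n → ℂ) → ℂ} (hf : IsFormFun d f)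
    (hg : IsFormFun e g) {x y : Fin n → ℂ} (hx : f x ≠ 0) (hy : g y ≠ 0) :
    ∃ z, f z * g z ≠ 0 := by
  by_contra! h
  exact hy (hf.eq_zero_of_mul_eq_zero hg h hx y)

theorem thirdVec_smul (T : Trilinear) (P Q : (Fin 4 → ℂ) →ₗ[ℂ] (Fin 4 → ℂ)) (c : ℂ)
    (v : Fin 4 → ℂ) : thirdVec T P Q (c • v) = c ^ 4 • thirdVec T P Q v := by
  ext i
  exact (SkewLines.isFormFun_thirdVec i).smul c v

/-- If the forms `f` are proportional to the coordinates of `φ`, then `f` sends `x` to `φ(x)`. -/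
theorem sendsTo_iff {k : Type} [Field k] [Algebra k ℂ] {n r : ℕ} {f : Fin r → MvPolynomial (Fin n) k}
    {φ : (Fin n → ℂ) → Fin r → ℂ} {c : ℂ} (hc : c ≠ 0)
    (hf : ∀ x i, MvPolynomial.aeval x (f i) = c * φ x i) (x : PSpace n) (y : PSpace r) :
    SendsTo f x y ↔ ∃ h : φ x.rep ≠ 0, Projectivization.mk ℂ _ h = y := by
  have e : (fun i => MvPolynomial.aeval x.rep (f i) : Fin r → ℂ) = c • φ x.rep :=
    funext fun i => hf _ i
  constructor
  · rintro ⟨h, rfl⟩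
    have h' : φ x.rep ≠ 0 := fun h0 => h (by rw [e, h0, smul_zero])
    refine ⟨h', (Projectivization.mk_eq_mk_iff' ..).2 ⟨c⁻¹, ?_⟩⟩
    rw [e, smul_smul, inv_mul_cancel₀ hc, one_smul]
  · rintro ⟨h, rfl⟩
    have h' : (fun i => MvPolynomial.aeval x.rep (f i) : Fin r → ℂ) ≠ 0 := by
      rw [e]; exact smul_ne_zero hc h
    exact ⟨h', (Projectivization.mk_eq_mk_iff' ..).2 ⟨c, e.symm⟩⟩

/-! ### The cubic forms on the plane and their common factors. -/

namespace PlaneFrame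

variable {T : Trilinear} {ℓ₁ ℓ₂ : Submodule ℂ (Fin 4 → ℂ)}
  {P Q : (Fin 4 → ℂ) →ₗ[ℂ] (Fin 4 → ℂ)} {E : (Fin 3 → ℂ) →ₗ[ℂ] (Fin 4 → ℂ)}
  {G : (Fin 4 → ℂ) →ₗ[ℂ] (Fin 3 → ℂ)} {h : (Fin 4 → ℂ) →ₗ[ℂ] ℂ} {p₁ a₁ p₂ a₂ : Fin 4 → ℂ}
  {u v w : (Fin 3 → ℂ) →ₗ[ℂ] ℂ}

/-- The quadratic form `A / w` in the coordinates `u, v, w`. -/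
noncomputable def polyA (T : Trilinear) (p₁ a₁ p₂ a₂ : Fin 4 → ℂ) : MvPolynomial (Fin 3) ℂ :=
  MvPolynomial.quadric 0 1 (3 * T p₁ p₁ a₂) (6 * T p₁ a₁ p₂) (6 * T p₁ a₁ a₂) (3 * T a₁ a₁ p₂)
    (3 * T a₁ a₁ a₂)

/-- The quadratic form `B / w` in the coordinates `u, v, w`. -/
noncomputable def polyB (T : Trilinear) (p₁ a₁ p₂ a₂ : Fin 4 → ℂ) : MvPolynomial (Fin 3) ℂ :=
  MvPolynomial.quadric 1 0 (3 * T a₁ p₂ p₂) (6 * T p₁ p₂ a₂) (6 * T a₁ p₂ a₂) (3 * T p₁ a₂ a₂)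
    (3 * T a₁ a₂ a₂)

/-- The cubic forms describing the map on the plane. -/
noncomputable def cubicVec (T : Trilinear) (P Q : (Fin 4 → ℂ) →ₗ[ℂ] (Fin 4 → ℂ))
    (E : (Fin 3 → ℂ) →ₗ[ℂ] (Fin 4 → ℂ)) (p₁ a₁ p₂ a₂ : Fin 4 → ℂ)
    (u v w : (Fin 3 → ℂ) →ₗ[ℂ] ℂ) (y : Fin 3 → ℂ) : Fin 4 → ℂ :=
  MvPolynomial.eval ![u y, v y, w y] (polyB T p₁ a₁ p₂ a₂) • P (E y) -
    MvPolynomial.eval ![u y, v y, w y] (polyA T p₁ a₁ p₂ a₂) • Q (E y)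

/-- The point of the plane `h = 0` on the transversal through `x`. -/
noncomputable def planeVec (P Q : (Fin 4 → ℂ) →ₗ[ℂ] (Fin 4 → ℂ)) (h : (Fin 4 → ℂ) →ₗ[ℂ] ℂ)
    (x : Fin 4 → ℂ) : Fin 4 → ℂ :=
  h (Q x) • P x - h (P x) • Q x

/-- The only term of `A` free of `w` is `3 u² v T p₁ p₁ p₂`, which is zero because `m` lies on the
surface. So the equation `w` of `m` splits off. -/
theorem formA_E (K : PlaneFrame T ℓ₁ ℓ₂ P Q E G h p₁ a₁ p₂ a₂ u v w) (y : Fin 3 → ℂ) :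
    formA T P Q (E y) =
      w y * MvPolynomial.eval ![u y, v y, w y] (polyA T p₁ a₁ p₂ a₂) := by
  rw [formA, K.proj₁, K.proj₂, K.square_add]
  simp only [polyA, MvPolynomial.quadric, map_add, map_mul, map_pow, MvPolynomial.eval_C,
    MvPolynomial.eval_X, Matrix.cons_val, map_smul, smul_eq_mul, K.van₁]
  ring

theorem formB_E (K : PlaneFrame T ℓ₁ ℓ₂ P Q E G h p₁ a₁ p₂ a₂ u v w) (y : Fin 3 → ℂ) :
    formB T P Q (E y) =
      w y * MvPolynomial.eval ![u y, v y, w y] (polyB T p₁ a₁ p₂ a₂) := by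
  rw [← K.formA_swap, formA, K.proj₁, K.proj₂, K.square_add]
  have e : ∀ x y z, T x y z = T z x y := fun x y z => by rw [K.swap₂, K.swap₁]
  simp only [polyB, MvPolynomial.quadric, map_add, map_mul, map_pow, MvPolynomial.eval_C,
    MvPolynomial.eval_X, Matrix.cons_val, map_smul, smul_eq_mul]
  rw [e p₂ p₂ p₁, e p₂ p₂ a₁, e p₂ a₂ p₁, e p₂ a₂ a₁, e a₂ a₂ p₁, e a₂ a₂ a₁, K.van₂]
  ring

/-- This cancellation lowers the degree of the map from four to three. -/
theorem thirdVec_E (K : PlaneFrame T ℓ₁ ℓ₂ P Q E G h p₁ a₁ p₂ a₂ u v w) (y : Fin 3 → ℂ) :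
    thirdVec T P Q (E y) = w y • cubicVec T P Q E p₁ a₁ p₂ a₂ u v w y := by
  rw [thirdVec, cubicVec, K.formA_E, K.formB_E, mul_smul, mul_smul, ← smul_sub]

theorem isFormFun_eval {p : MvPolynomial (Fin 3) ℂ} (hp : p.IsHomogeneous 2) :
    IsFormFun 2 fun y => MvPolynomial.eval ![u y, v y, w y] p := by
  have hg : IsFormFun 2 fun x => MvPolynomial.eval x p := ⟨p, hp, fun _ => rfl⟩
  refine hg.comp (φ := fun y => ![u y, v y, w y]) (e := 1) fun i => ?_
  fin_cases i
  · exact IsFormFun.linear u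
  · exact IsFormFun.linear v
  · exact IsFormFun.linear w

theorem isFormFun_cubicVec (i : Fin 4) :
    IsFormFun 3 fun y => cubicVec T P Q E p₁ a₁ p₂ a₂ u v w y i :=
  ((isFormFun_eval (MvPolynomial.isHomogeneous_quadric ..)).mul
    (IsFormFun.coord (P ∘ₗ E) i)).sub
  ((isFormFun_eval (MvPolynomial.isHomogeneous_quadric ..)).mul (IsFormFun.coord (Q ∘ₗ E) i))

theorem isFormFun_planeVec (M : (Fin 4 → ℂ) →ₗ[ℂ] (Fin 3 → ℂ)) (i : Fin 3) :
    IsFormFun 2 fun x => M (planeVec P Q h x) i := by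
  have := ((IsFormFun.linear (h ∘ₗ Q)).mul (IsFormFun.coord (M ∘ₗ P) i)).sub
    ((IsFormFun.linear (h ∘ₗ P)).mul (IsFormFun.coord (M ∘ₗ Q) i))
  simpa [planeVec] using this

/-- The polar of `p₁` is nonzero on `ℓ₂` but kills `p₂`, so it is nonzero at `a₂`. This is the
leading coefficient of `polyA`. -/
theorem polar_ne₁ (K : PlaneFrame T ℓ₁ ℓ₂ P Q E G h p₁ a₁ p₂ a₂ u v w) : T p₁ p₁ a₂ ≠ 0 := by
  intro h0
  obtain ⟨b, hb, hne⟩ := K.exists_polar_ne K.mem_p₁ K.ne_p₁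
  obtain ⟨s, t, rfl⟩ := K.span₂ b hb
  exact hne (by simp [h0, K.van₁])

theorem polar_ne₂ (K : PlaneFrame T ℓ₁ ℓ₂ P Q E G h p₁ a₁ p₂ a₂ u v w) : T a₁ p₂ p₂ ≠ 0 := by
  intro h0
  have e : ∀ x y z, T x y z = T z x y := fun x y z => by rw [K.swap₂, K.swap₁]
  obtain ⟨b, hb, hne⟩ := K.symm.exists_polar_ne K.mem_p₂ K.ne_p₂
  obtain ⟨s, t, rfl⟩ := K.span₁ b hb
  rw [e] at hne
  exact hne (by simp [h0, K.van₂])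

/-- The points of the plane with coordinates `u, v, w = x`. -/
noncomputable def frameMap (G : (Fin 4 → ℂ) →ₗ[ℂ] (Fin 3 → ℂ)) (p₁ a₁ p₂ a₂ : Fin 4 → ℂ) :
    (Fin 3 → ℂ) →ₗ[ℂ] (Fin 3 → ℂ) :=
  G ∘ₗ ((LinearMap.proj 0).smulRight p₁ + (LinearMap.proj 1).smulRight p₂ +
    (LinearMap.proj 2).smulRight (a₁ + a₂))

theorem frameMap_apply (x : Fin 3 → ℂ) :
    frameMap G p₁ a₁ p₂ a₂ x = G (x 0 • p₁ + x 1 • p₂ + x 2 • (a₁ + a₂)) := rfl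

theorem E_frameMap (K : PlaneFrame T ℓ₁ ℓ₂ P Q E G h p₁ a₁ p₂ a₂ u v w) (x : Fin 3 → ℂ) :
    E (frameMap G p₁ a₁ p₂ a₂ x) = (x 0 • p₁ + x 2 • a₁) + (x 1 • p₂ + x 2 • a₂) := by
  rw [frameMap_apply, K.E_G]
  · rw [smul_add]; abel
  · simp [K.h_p₁, K.h_p₂, K.h_a₁, K.h_a₂]

theorem proj_frameMap (K : PlaneFrame T ℓ₁ ℓ₂ P Q E G h p₁ a₁ p₂ a₂ u v w) (x : Fin 3 → ℂ) :
    P (E (frameMap G p₁ a₁ p₂ a₂ x)) = x 0 • p₁ + x 2 • a₁ ∧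
      Q (E (frameMap G p₁ a₁ p₂ a₂ x)) = x 1 • p₂ + x 2 • a₂ := by
  rw [K.E_frameMap]
  exact K.proj_add (ℓ₁.add_mem (ℓ₁.smul_mem _ K.mem_p₁) (ℓ₁.smul_mem _ K.mem_a₁))
    (ℓ₂.add_mem (ℓ₂.smul_mem _ K.mem_p₂) (ℓ₂.smul_mem _ K.mem_a₂))

theorem h_proj (K : PlaneFrame T ℓ₁ ℓ₂ P Q E G h p₁ a₁ p₂ a₂ u v w) (y : Fin 3 → ℂ) :
    h (P (E y)) = w y ∧ h (Q (E y)) = -w y := by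
  rw [K.proj₁, K.proj₂]
  simp [K.h_p₁, K.h_p₂, K.h_a₁, K.h_a₂]

theorem coords_frameMap (K : PlaneFrame T ℓ₁ ℓ₂ P Q E G h p₁ a₁ p₂ a₂ u v w) (x : Fin 3 → ℂ) :
    ![u (frameMap G p₁ a₁ p₂ a₂ x), v (frameMap G p₁ a₁ p₂ a₂ x),
      w (frameMap G p₁ a₁ p₂ a₂ x)] = x := by
  obtain ⟨h1, h2⟩ := K.proj_frameMap x
  have hw : w (frameMap G p₁ a₁ p₂ a₂ x) = x 2 := by
    rw [← (K.h_proj _).1, h1]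
    simp [K.h_p₁, K.h_a₁]
  rw [K.proj₁, hw, add_left_inj] at h1
  rw [K.proj₂, hw, add_left_inj] at h2
  have hu := smul_left_injective ℂ K.ne_p₁ h1
  have hv := smul_left_injective ℂ K.ne_p₂ h2
  ext i
  fin_cases i
  · exact hu
  · exact hv
  · exact hw

theorem frameMap_coords (K : PlaneFrame T ℓ₁ ℓ₂ P Q E G h p₁ a₁ p₂ a₂ u v w) (y : Fin 3 → ℂ) :
    frameMap G p₁ a₁ p₂ a₂ ![u y, v y, w y] = y := by
  refine (Function.LeftInverse.injective K.G_E) ?_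
  rw [K.E_frameMap]
  simp only [Matrix.cons_val]
  rw [← K.proj₁, ← K.proj₂, K.add]

theorem cubicVec_frameMap (K : PlaneFrame T ℓ₁ ℓ₂ P Q E G h p₁ a₁ p₂ a₂ u v w)
    (x : Fin 3 → ℂ) :
    cubicVec T P Q E p₁ a₁ p₂ a₂ u v w (frameMap G p₁ a₁ p₂ a₂ x) =
      MvPolynomial.eval x (polyB T p₁ a₁ p₂ a₂) • (x 0 • p₁ + x 2 • a₁) -
        MvPolynomial.eval x (polyA T p₁ a₁ p₂ a₂) • (x 1 • p₂ + x 2 • a₂) := by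
  rw [cubicVec, K.coords_frameMap, (K.proj_frameMap x).1, (K.proj_frameMap x).2]

/-- In the coordinates `u, v, w` the common factor divides every linear combination of the
components of `B' (u p₁ + w a₁) - A' (v p₂ + w a₂)`, where `A'`, `B'` are the two quadrics. Suitable
functionals extract `w A'`, `w B'` and `u B'`. -/
theorem isUnit_of_forall_dvd (K : PlaneFrame T ℓ₁ ℓ₂ P Q E G h p₁ a₁ p₂ a₂ u v w)
    {f : Fin 4 → MvPolynomial (Fin 3) ℂ}
    (hf : ∀ y i, MvPolynomial.eval y (f i) = cubicVec T P Q E p₁ a₁ p₂ a₂ u v w y i)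
    {g : MvPolynomial (Fin 3) ℂ} (hg : ∀ i, g ∣ f i) : IsUnit g := by
  choose n _ hn using fun j => IsFormFun.coord (frameMap G p₁ a₁ p₂ a₂) j
  choose n' _ hn' using fun j : Fin 3 => IsFormFun.linear (![u, v, w] j)
  set g' := MvPolynomial.aeval n g with hg'
  have key : ∀ (l : (Fin 4 → ℂ) →ₗ[ℂ] ℂ) (R : MvPolynomial (Fin 3) ℂ),
      (∀ x, l (cubicVec T P Q E p₁ a₁ p₂ a₂ u v w (frameMap G p₁ a₁ p₂ a₂ x)) =
        MvPolynomial.eval x R) → g' ∣ R := by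
    intro l R hR
    have : R = ∑ i, MvPolynomial.aeval n (f i) * MvPolynomial.C (l (Pi.single i 1)) := by
      refine MvPolynomial.funext fun x => ?_
      rw [← hR, l.apply_eq_sum_mul_single, map_sum]
      refine Finset.sum_congr rfl fun i _ => ?_
      rw [map_mul, MvPolynomial.eval_aeval', MvPolynomial.eval_C, ← hf]
      congr 2
      simp only [hn]
    rw [this]
    exact Finset.dvd_sum fun i _ => (map_dvd (MvPolynomial.aeval n) (hg i)).mul_right _
  obtain ⟨l, hl⟩ := exists_dual_eq_one K.ne_p₁
  have proj : ∀ x : Fin 3 → ℂ,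
      P (cubicVec T P Q E p₁ a₁ p₂ a₂ u v w (frameMap G p₁ a₁ p₂ a₂ x)) =
        MvPolynomial.eval x (polyB T p₁ a₁ p₂ a₂) • (x 0 • p₁ + x 2 • a₁) ∧
      Q (cubicVec T P Q E p₁ a₁ p₂ a₂ u v w (frameMap G p₁ a₁ p₂ a₂ x)) =
        (-MvPolynomial.eval x (polyA T p₁ a₁ p₂ a₂)) • (x 1 • p₂ + x 2 • a₂) := by
    intro x
    rw [K.cubicVec_frameMap, sub_eq_add_neg, ← neg_smul]
    exact K.proj_add
      (ℓ₁.smul_mem _ (ℓ₁.add_mem (ℓ₁.smul_mem _ K.mem_p₁) (ℓ₁.smul_mem _ K.mem_a₁)))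
      (ℓ₂.smul_mem _ (ℓ₂.add_mem (ℓ₂.smul_mem _ K.mem_p₂) (ℓ₂.smul_mem _ K.mem_a₂)))
  have hA : g' ∣ MvPolynomial.X 2 * polyA T p₁ a₁ p₂ a₂ := by
    refine key (h ∘ₗ Q) _ fun x => ?_
    rw [LinearMap.comp_apply, (proj x).2]
    simp only [map_smul, map_add, K.h_p₂, K.h_a₂, smul_eq_mul, map_mul, MvPolynomial.eval_X]
    ring
  have hB : g' ∣ MvPolynomial.X 2 * polyB T p₁ a₁ p₂ a₂ := by
    refine key (h ∘ₗ P) _ fun x => ?_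
    rw [LinearMap.comp_apply, (proj x).1]
    simp only [map_smul, map_add, K.h_p₁, K.h_a₁, smul_eq_mul, map_mul, MvPolynomial.eval_X]
    ring
  have hB' : g' ∣ MvPolynomial.X 0 * polyB T p₁ a₁ p₂ a₂ := by
    refine key (l ∘ₗ (LinearMap.id - h.smulRight a₁) ∘ₗ P) _ fun x => ?_
    rw [LinearMap.comp_apply, LinearMap.comp_apply, (proj x).1]
    simp only [LinearMap.sub_apply, LinearMap.id_apply, LinearMap.smulRight_apply, map_sub,
      map_smul, map_add, K.h_p₁, K.h_a₁, hl, smul_eq_mul, map_mul, MvPolynomial.eval_X]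
    ring
  -- The determinant for the contained transversal `m` is `(α₁ β₁ - α₂ β₂) / 9` for the coefficients
  -- of the two quadrics.
  have hJ := K.jacobian_ne K.mem_p₁ K.mem_p₂ K.ne_p₁ K.ne_p₂ K.span₁ K.span₂ K.van₁ K.van₂
  have hu : IsUnit g' := MvPolynomial.isUnit_of_dvd_quadrics
    (mul_ne_zero three_ne_zero K.polar_ne₁) (mul_ne_zero three_ne_zero K.polar_ne₂)
    (fun h0 => hJ (by linear_combination (1 / 9) * h0)) hA hB hB'
  -- The substitutions `n` and `n'` are inverse linear changes of coordinates, so being a unit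
  -- carries back to `g`.
  have hgg : MvPolynomial.aeval n' g' = g := by
    refine MvPolynomial.funext fun y => ?_
    rw [MvPolynomial.eval_aeval', hg', MvPolynomial.eval_aeval']
    congr 2
    have e : (fun i => MvPolynomial.eval y (n' i)) = ![u y, v y, w y] := by
      ext i
      rw [hn']
      fin_cases i <;> rfl
    ext j
    rw [e, hn]
    exact congrFun (K.frameMap_coords y) j
  rw [← hgg]
  exact hu.map _

end PlaneFrame

/-! ### The birational map of the plane onto the surface -/

namespace PlaneFrame

variable {T : Trilinear} {ℓ₁ ℓ₂ : Submodule ℂ (Fin 4 → ℂ)}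
  {P Q : (Fin 4 → ℂ) →ₗ[ℂ] (Fin 4 → ℂ)} {E : (Fin 3 → ℂ) →ₗ[ℂ] (Fin 4 → ℂ)}
  {G : (Fin 4 → ℂ) →ₗ[ℂ] (Fin 3 → ℂ)} {h : (Fin 4 → ℂ) →ₗ[ℂ] ℂ} {p₁ a₁ p₂ a₂ : Fin 4 → ℂ}
  {u v w : (Fin 3 → ℂ) →ₗ[ℂ] ℂ} {F : MvPolynomial (Fin 4) ℂ}

theorem mem_planeMap_iff (K : PlaneFrame T ℓ₁ ℓ₂ P Q E G h p₁ a₁ p₂ a₂ u v w)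
    (hF : ∀ v, MvPolynomial.eval v F = T v v v) (hE : Function.Injective E) (x : PSpace 3)
    (q : PSpace 4) : q ∈ planeMap F ℓ₁ ℓ₂ E hE x ↔
      ∃ h : thirdVec T P Q (E x.rep) ≠ 0, Projectivization.mk ℂ _ h = q := by
  rw [planeMap, K.mem_thirdPointMap_iff hF]
  have hx : E x.rep ≠ 0 := fun h0 => x.rep_nonzero (hE (by rw [h0, map_zero]))
  obtain ⟨c, hc⟩ := Projectivization.exists_smul_eq_mk_rep ℂ _ hx
  have e : Projectivization.map E hE x = Projectivization.mk ℂ _ hx := by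
    conv_lhs => rw [← x.mk_rep]
    rw [Projectivization.map_mk]
  rw [e, ← hc, Units.smul_def]
  have e4 := thirdVec_smul T P Q (c : ℂ) (E x.rep)
  constructor
  · rintro ⟨h0, rfl⟩
    have h1 : thirdVec T P Q (E x.rep) ≠ 0 := fun h1 => h0 (by rw [e4, h1, smul_zero])
    refine ⟨h1, (Projectivization.mk_eq_mk_iff' ..).2 ⟨((c : ℂ) ^ 4)⁻¹, ?_⟩⟩
    rw [e4, smul_smul, inv_mul_cancel₀ (pow_ne_zero 4 c.ne_zero), one_smul]
  · rintro ⟨h0, rfl⟩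
    have h1 : thirdVec T P Q ((c : ℂ) • E x.rep) ≠ 0 := by
      rw [e4]; exact smul_ne_zero (pow_ne_zero 4 c.ne_zero) h0
    exact ⟨h1, (Projectivization.mk_eq_mk_iff' ..).2 ⟨(c : ℂ) ^ 4, e4.symm⟩⟩

theorem sendsTo_of_mem_planeMap (K : PlaneFrame T ℓ₁ ℓ₂ P Q E G h p₁ a₁ p₂ a₂ u v w)
    (hF : ∀ v, MvPolynomial.eval v F = T v v v) (hE : Function.Injective E)
    {k : Type} [Field k] [Algebra k ℂ] {f : Fin 4 → MvPolynomial (Fin 3) k} {c : ℂ} (hc : c ≠ 0)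
    (hf : ∀ y i, MvPolynomial.aeval y (f i) =
      c * cubicVec T P Q E p₁ a₁ p₂ a₂ u v w y i) {x : PSpace 3} {q : PSpace 4}
    (hq : q ∈ planeMap F ℓ₁ ℓ₂ E hE x) : SendsTo f x q := by
  rw [K.mem_planeMap_iff hF] at hq
  obtain ⟨h0, rfl⟩ := hq
  rw [sendsTo_iff hc hf]
  have h1 : cubicVec T P Q E p₁ a₁ p₂ a₂ u v w x.rep ≠ 0 := fun h1 => h0 (by
    rw [K.thirdVec_E, h1, smul_zero])
  have hw : w x.rep ≠ 0 := fun hw => h0 (by rw [K.thirdVec_E, hw, zero_smul])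
  refine ⟨h1, (Projectivization.mk_eq_mk_iff' ..).2 ⟨(w x.rep)⁻¹, ?_⟩⟩
  rw [K.thirdVec_E, smul_smul, inv_mul_cancel₀ hw, one_smul]

/-- The function whose non-vanishing locus is the domain of the birational correspondence. -/
noncomputable def sourceFun (T : Trilinear) (P Q : (Fin 4 → ℂ) →ₗ[ℂ] (Fin 4 → ℂ))
    (E : (Fin 3 → ℂ) →ₗ[ℂ] (Fin 4 → ℂ)) (w : (Fin 3 → ℂ) →ₗ[ℂ] ℂ) (y : Fin 3 → ℂ) : ℂ :=
  w y * (formA T P Q (E y) * formB T P Q (E y))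

/-- The function whose non-vanishing locus on the surface is the image of the birational
correspondence. -/
noncomputable def targetFun (T : Trilinear) (P Q : (Fin 4 → ℂ) →ₗ[ℂ] (Fin 4 → ℂ))
    (h : (Fin 4 → ℂ) →ₗ[ℂ] ℂ) (x : Fin 4 → ℂ) : ℂ :=
  h (P x) * h (Q x) * formA T P Q x

theorem isFormFun_sourceFun : IsFormFun 7 (sourceFun T P Q E w) := by
  have hA : IsFormFun 3 fun y => formA T P Q (E y) :=
    (SkewLines.isFormFun_formA (T := T) (P := P) (Q := Q)).comp (φ := E) (IsFormFun.coord E)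
  have hB : IsFormFun 3 fun y => formB T P Q (E y) :=
    (SkewLines.isFormFun_formB (T := T) (P := P) (Q := Q)).comp (φ := E) (IsFormFun.coord E)
  exact (IsFormFun.linear w).mul (hA.mul hB)

theorem isFormFun_targetFun : IsFormFun 5 (targetFun T P Q h) :=
  ((IsFormFun.linear (h ∘ₗ P)).mul (IsFormFun.linear (h ∘ₗ Q))).mul SkewLines.isFormFun_formA

theorem exists_sourceFun_ne (K : PlaneFrame T ℓ₁ ℓ₂ P Q E G h p₁ a₁ p₂ a₂ u v w) :
    ∃ y, sourceFun T P Q E w y ≠ 0 := by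
  have hc := fun x => K.coords_frameMap x
  have hw : w (frameMap G p₁ a₁ p₂ a₂ (Pi.single 2 1)) ≠ 0 := by
    have := congrFun (hc (Pi.single 2 1)) 2
    simp only [Matrix.cons_val, Pi.single_eq_same] at this
    rw [this]; exact one_ne_zero
  obtain ⟨y₁, hy₁⟩ := (IsFormFun.linear w).exists_mul_ne
    (isFormFun_eval (u := u) (v := v) (w := w) (MvPolynomial.isHomogeneous_quadric ..)) hw
    (show MvPolynomial.eval _ (polyA T p₁ a₁ p₂ a₂) ≠ 0 by
      rw [hc (Pi.single 0 1)]
      simpa [polyA, MvPolynomial.quadric] using K.polar_ne₁)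
  obtain ⟨y₂, hy₂⟩ := (IsFormFun.linear w).exists_mul_ne
    (isFormFun_eval (u := u) (v := v) (w := w) (MvPolynomial.isHomogeneous_quadric ..)) hw
    (show MvPolynomial.eval _ (polyB T p₁ a₁ p₂ a₂) ≠ 0 by
      rw [hc (Pi.single 1 1)]
      simpa [polyB, MvPolynomial.quadric] using K.polar_ne₂)
  have hA : IsFormFun 3 fun y => formA T P Q (E y) :=
    (SkewLines.isFormFun_formA (T := T) (P := P) (Q := Q)).comp (φ := E) (IsFormFun.coord E)
  have hB : IsFormFun 3 fun y => formB T P Q (E y) :=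
    (SkewLines.isFormFun_formB (T := T) (P := P) (Q := Q)).comp (φ := E) (IsFormFun.coord E)
  obtain ⟨y₃, hy₃⟩ := hA.exists_mul_ne hB (x := y₁) (y := y₂) (by rw [K.formA_E]; exact hy₁)
    (by rw [K.formB_E]; exact hy₂)
  exact (IsFormFun.linear w).exists_mul_ne (hA.mul hB) hw hy₃

/-- Ensures that the open set of the plane is carried into the open set of the surface;
`sourceFun_planeVec` does the same for the inverse. -/
theorem targetFun_thirdVec (K : PlaneFrame T ℓ₁ ℓ₂ P Q E G h p₁ a₁ p₂ a₂ u v w)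
    (y : Fin 3 → ℂ) : targetFun T P Q h (thirdVec T P Q (E y)) =
      -(sourceFun T P Q E w y ^ 2 * formA T P Q (E y) * formB T P Q (E y)) := by
  obtain ⟨e₁, e₂⟩ := K.proj_thirdVec (E y)
  have eA : formA T P Q (thirdVec T P Q (E y)) =
      -(formB T P Q (E y) ^ 2 * formA T P Q (E y) ^ 2) := by
    rw [formA, e₁, e₂]
    simp only [map_smul, LinearMap.smul_apply, smul_eq_mul]
    rw [formA]; ring
  rw [targetFun, eA, e₁, e₂, map_smul, map_smul, (K.h_proj y).1, (K.h_proj y).2, sourceFun]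
  simp only [smul_eq_mul]
  ring

/-- A point and its third point share a transversal, so returning to the plane along it recovers the
point up to a scalar factor. -/
theorem planeVec_thirdVec (K : PlaneFrame T ℓ₁ ℓ₂ P Q E G h p₁ a₁ p₂ a₂ u v w)
    (y : Fin 3 → ℂ) : G (planeVec P Q h (thirdVec T P Q (E y))) =
      sourceFun T P Q E w y • y := by
  obtain ⟨e₁, e₂⟩ := K.proj_thirdVec (E y)
  have : planeVec P Q h (thirdVec T P Q (E y)) = sourceFun T P Q E w y • E y := by
    conv_rhs => rw [← K.add (E y), smul_add]
    rw [planeVec, e₁, e₂, map_smul, map_smul, (K.h_proj y).1, (K.h_proj y).2, sub_eq_add_neg,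
      ← neg_smul, smul_smul, smul_smul, sourceFun]
    simp only [smul_eq_mul]
    congr 2 <;> ring
  rw [this, map_smul, K.G_E]

theorem E_planeVec (K : PlaneFrame T ℓ₁ ℓ₂ P Q E G h p₁ a₁ p₂ a₂ u v w) (x : Fin 4 → ℂ) :
    E (G (planeVec P Q h x)) = planeVec P Q h x := by
  apply K.E_G
  simp only [planeVec, map_sub, map_smul, smul_eq_mul]
  ring

theorem proj_planeVec (K : PlaneFrame T ℓ₁ ℓ₂ P Q E G h p₁ a₁ p₂ a₂ u v w) (x : Fin 4 → ℂ) :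
    P (planeVec P Q h x) = h (Q x) • P x ∧ Q (planeVec P Q h x) = (-h (P x)) • Q x := by
  rw [planeVec, sub_eq_add_neg, ← neg_smul]
  exact K.proj_add (ℓ₁.smul_mem _ (K.mem₁ x)) (ℓ₂.smul_mem _ (K.mem₂ x))

theorem sourceFun_planeVec (K : PlaneFrame T ℓ₁ ℓ₂ P Q E G h p₁ a₁ p₂ a₂ u v w)
    {x : Fin 4 → ℂ} (hx : T x x x = 0) : sourceFun T P Q E w (G (planeVec P Q h x)) =
      targetFun T P Q h x ^ 2 * (h (P x) * h (Q x)) ^ 2 := by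
  obtain ⟨e₁, e₂⟩ := K.proj_planeVec x
  have hB : formB T P Q x = -formA T P Q x := by
    have := K.cubic_eq_add x
    rw [hx] at this
    linear_combination -this
  have hw : w (G (planeVec P Q h x)) = h (Q x) * h (P x) := by
    rw [← (K.h_proj _).1, K.E_planeVec, e₁, map_smul, smul_eq_mul]
  have eA : formA T P Q (planeVec P Q h x) = -(h (Q x) ^ 2 * h (P x) * formA T P Q x) := by
    rw [formA, e₁, e₂]
    simp only [map_smul, LinearMap.smul_apply, smul_eq_mul]
    rw [formA]; ring
  have eB : formB T P Q (planeVec P Q h x) = h (Q x) * h (P x) ^ 2 * formB T P Q x := by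
    rw [formB, e₁, e₂]
    simp only [map_smul, LinearMap.smul_apply, smul_eq_mul]
    rw [formB]; ring
  rw [sourceFun, hw, K.E_planeVec, eA, eB, hB, targetFun]
  ring

/-- A point of the surface is the third point of the transversal through it, so the other composite
is also the identity up to a scalar. -/
theorem thirdVec_planeVec (K : PlaneFrame T ℓ₁ ℓ₂ P Q E G h p₁ a₁ p₂ a₂ u v w)
    {x : Fin 4 → ℂ} (hx : T x x x = 0) : thirdVec T P Q (E (G (planeVec P Q h x))) =
      (-(h (P x) * h (Q x) * targetFun T P Q h x)) • x := by
  obtain ⟨e₁, e₂⟩ := K.proj_planeVec x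
  have hB : formB T P Q x = -formA T P Q x := by
    have := K.cubic_eq_add x
    rw [hx] at this
    linear_combination -this
  have eA : formA T P Q (planeVec P Q h x) = -(h (Q x) ^ 2 * h (P x) * formA T P Q x) := by
    rw [formA, e₁, e₂]
    simp only [map_smul, LinearMap.smul_apply, smul_eq_mul]
    rw [formA]; ring
  have eB : formB T P Q (planeVec P Q h x) = h (Q x) * h (P x) ^ 2 * formB T P Q x := by
    rw [formB, e₁, e₂]
    simp only [map_smul, LinearMap.smul_apply, smul_eq_mul]
    rw [formB]; ring
  conv_rhs => rw [← K.add x, smul_add]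
  rw [K.E_planeVec, thirdVec, e₁, e₂, eA, eB, hB, smul_smul, smul_smul, sub_eq_add_neg,
    ← neg_smul, targetFun, K.add]
  congr 2 <;> ring

/-- The constants `c`, `d` allow the forms to be rescaled, so that one argument covers complex
coefficients and the real forms obtained by descent. -/
theorem isBirationalOver (K : PlaneFrame T ℓ₁ ℓ₂ P Q E G h p₁ a₁ p₂ a₂ u v w)
    (hF : ∀ v, MvPolynomial.eval v F = T v v v) (hE : Function.Injective E)
    {k : Type} [Field k] [Algebra k ℂ] {f : Fin 4 → MvPolynomial (Fin 3) k}
    {g : Fin 3 → MvPolynomial (Fin 4) k} {c d : ℂ} (hc : c ≠ 0) (hd : d ≠ 0)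
    (hf3 : ∀ i, (f i).IsHomogeneous 3) (hg2 : ∀ i, (g i).IsHomogeneous 2)
    (hf : ∀ y i, MvPolynomial.aeval y (f i) = c * cubicVec T P Q E p₁ a₁ p₂ a₂ u v w y i)
    (hg : ∀ x i, MvPolynomial.aeval x (g i) = d * G (planeVec P Q h x) i) :
    IsBirationalOver k Set.univ (surface F) (planeMap F ℓ₁ ℓ₂ E hE) := by
  obtain ⟨y₀, hy₀⟩ := K.exists_sourceFun_ne
  have hs : IsFormFun 7 (sourceFun T P Q E w) := isFormFun_sourceFun
  have ht : IsFormFun 5 (targetFun T P Q h) := isFormFun_targetFun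
  have hFf : IsFormFun 3 fun x => T x x x :=
    IsFormFun.trilinear T LinearMap.id LinearMap.id LinearMap.id
  have hG : ∀ (s : ℂ) (x : Fin 4 → ℂ),
      G (planeVec P Q h (s • x)) = s ^ 2 • G (planeVec P Q h x) := fun s x => by
    ext i
    exact (isFormFun_planeVec G i).smul s x
  have hts : ∀ y, sourceFun T P Q E w y ≠ 0 →
      targetFun T P Q h (thirdVec T P Q (E y)) ≠ 0 := by
    intro y hy
    rw [K.targetFun_thirdVec, mul_assoc]
    exact neg_ne_zero.2 (mul_ne_zero (pow_ne_zero 2 hy) (right_ne_zero_of_mul hy))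
  refine ⟨3, 2, f, g, hf3, hg2, {x | sourceFun T P Q E w x.rep ≠ 0},
    {y | y ∈ surface F ∧ targetFun T P Q h y.rep ≠ 0}, hs.isDenseOpenIn_univ (by norm_num) hy₀,
    K.isDenseOpenIn_surface hF ht (by norm_num) (hts y₀ hy₀), ?_, ?_⟩
  · intro x hx
    have ht0 := hts _ hx
    have h0 : thirdVec T P Q (E x.rep) ≠ 0 := by
      intro h0
      rw [h0, targetFun] at ht0
      simp at ht0
    have hmem := (K.mem_planeMap_iff hF hE x (Projectivization.mk ℂ _ h0)).2 ⟨h0, rfl⟩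
    refine ⟨Projectivization.mk ℂ _ h0, ⟨?_, fun h => ht0 ((ht.rep_mk h0).1 h)⟩, hmem,
      K.sendsTo_of_mem_planeMap hF hE hc hf hmem, ?_⟩
    · change MvPolynomial.eval _ F = 0
      rw [hF]
      exact (hFf.rep_mk h0).2 (K.cubic_thirdVec _)
    · rw [sendsTo_iff (φ := fun x => G (planeVec P Q h x)) hd hg]
      obtain ⟨s, hs⟩ := Projectivization.exists_smul_eq_mk_rep ℂ _ h0
      have e : G (planeVec P Q h (Projectivization.mk ℂ _ h0).rep) =
          ((s : ℂ) ^ 2 * sourceFun T P Q E w x.rep) • x.rep := by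
        rw [← hs, Units.smul_def, hG, K.planeVec_thirdVec, smul_smul]
      have hne : (s : ℂ) ^ 2 * sourceFun T P Q E w x.rep ≠ 0 :=
        mul_ne_zero (pow_ne_zero 2 s.ne_zero) hx
      refine ⟨by rw [e]; exact smul_ne_zero hne x.rep_nonzero, ?_⟩
      conv_rhs => rw [← x.mk_rep]
      exact (Projectivization.mk_eq_mk_iff' ..).2 ⟨_, e.symm⟩
  · rintro y ⟨hyS, hy⟩
    have hyS' : T y.rep y.rep y.rep = 0 := by rw [← hF]; exact hyS
    have hne : h (P y.rep) * h (Q y.rep) ≠ 0 := left_ne_zero_of_mul hy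
    have hs0 : sourceFun T P Q E w (G (planeVec P Q h y.rep)) ≠ 0 := by
      rw [K.sourceFun_planeVec hyS']
      exact mul_ne_zero (pow_ne_zero 2 hy) (pow_ne_zero 2 hne)
    have h0 : G (planeVec P Q h y.rep) ≠ 0 := by
      intro h0
      rw [h0, sourceFun] at hs0
      simp at hs0
    have hmem : y ∈ planeMap F ℓ₁ ℓ₂ E hE (Projectivization.mk ℂ _ h0) := by
      rw [K.mem_planeMap_iff hF]
      obtain ⟨s, hs⟩ := Projectivization.exists_smul_eq_mk_rep ℂ _ h0
      have e : thirdVec T P Q (E (Projectivization.mk ℂ _ h0).rep) =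
          ((s : ℂ) ^ 4 * -(h (P y.rep) * h (Q y.rep) * targetFun T P Q h y.rep)) • y.rep := by
        rw [← hs, Units.smul_def, map_smul, thirdVec_smul, K.thirdVec_planeVec hyS', smul_smul]
      have hne' : (s : ℂ) ^ 4 * -(h (P y.rep) * h (Q y.rep) * targetFun T P Q h y.rep) ≠ 0 :=
        mul_ne_zero (pow_ne_zero 4 s.ne_zero) (neg_ne_zero.2 (mul_ne_zero hne hy))
      refine ⟨by rw [e]; exact smul_ne_zero hne' y.rep_nonzero, ?_⟩
      conv_rhs => rw [← y.mk_rep]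
      exact (Projectivization.mk_eq_mk_iff' ..).2 ⟨_, e.symm⟩
    refine ⟨Projectivization.mk ℂ _ h0, fun h => hs0 ((hs.rep_mk h0).1 h), hmem,
      K.sendsTo_of_mem_planeMap hF hE hc hf hmem, ?_⟩
    rw [sendsTo_iff (φ := fun x => G (planeVec P Q h x)) hd hg]
    exact ⟨h0, rfl⟩

theorem exists_forms (K : PlaneFrame T ℓ₁ ℓ₂ P Q E G h p₁ a₁ p₂ a₂ u v w)
    (hF : ∀ v, MvPolynomial.eval v F = T v v v) (hE : Function.Injective E) :
    IsBirationalOver ℂ Set.univ (surface F) (planeMap F ℓ₁ ℓ₂ E hE) ∧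
      IsGivenByFormsOver ℂ 3 (planeMap F ℓ₁ ℓ₂ E hE) := by
  choose f hf3 hf using fun i => isFormFun_cubicVec (T := T) (P := P) (Q := Q) (E := E)
    (p₁ := p₁) (a₁ := a₁) (p₂ := p₂) (a₂ := a₂) (u := u) (v := v) (w := w) i
  choose g hg2 hg using fun i => isFormFun_planeVec (P := P) (Q := Q) (h := h) G i
  have hf' : ∀ y i, MvPolynomial.aeval y (f i) =
      1 * cubicVec T P Q E p₁ a₁ p₂ a₂ u v w y i := fun y i => by
    rw [one_mul]; exact hf i y
  have hg' : ∀ x i, MvPolynomial.aeval x (g i) = 1 * G (planeVec P Q h x) i := fun x i => by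
    rw [one_mul]; exact hg i x
  exact ⟨K.isBirationalOver hF hE one_ne_zero one_ne_zero hf3 hg2 hf' hg', f, hf3,
    fun r hr => K.isUnit_of_forall_dvd (fun y i => hf i y) hr,
    fun x y hy => K.sendsTo_of_mem_planeMap hF hE one_ne_zero hf' hy⟩

end PlaneFrame

/-! ### Descent to real coefficients -/

theorem MvPolynomial.eval_map_conj {n : ℕ} (p : MvPolynomial (Fin n) ℂ) (x : Fin n → ℂ) :
    eval x (map (starRingEnd ℂ) p) = star (eval (star x) p) := by
  induction p using MvPolynomial.induction_on with
  | C a => simp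
  | add p q hp hq => rw [map_add, map_add, map_add, hp, hq, star_add]
  | mul_X p i hp => simp [hp]

theorem MvPolynomial.eval_star_map {n : ℕ} (p : MvPolynomial (Fin n) ℝ) (x : Fin n → ℂ) :
    eval (star x) (map (algebraMap ℝ ℂ) p) = star (eval x (map (algebraMap ℝ ℂ) p)) := by
  have h := eval_map_conj (map (algebraMap ℝ ℂ) p) (star x)
  rw [star_star, map_map] at h
  have e : (starRingEnd ℂ).comp (algebraMap ℝ ℂ) = algebraMap ℝ ℂ := by ext r; simp
  rw [← h, e]

theorem IsFormFun.conj {n d : ℕ} {f : (Fin n → ℂ) → ℂ} (hf : IsFormFun d f) :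
    IsFormFun d fun x => star (f (star x)) := by
  obtain ⟨p, hp, hpf⟩ := hf
  exact ⟨MvPolynomial.map (starRingEnd ℂ) p, hp.map _, fun x => by
    rw [MvPolynomial.eval_map_conj, hpf]⟩

theorem MvPolynomial.exists_map_ofReal_eq {n : ℕ} (p : MvPolynomial (Fin n) ℂ)
    (hp : ∀ m, star (coeff m p) = coeff m p) :
    ∃ q : MvPolynomial (Fin n) ℝ, map (algebraMap ℝ ℂ) q = p := by
  refine ⟨∑ m ∈ p.support, monomial m (coeff m p).re, ?_⟩
  rw [map_sum]
  conv_rhs => rw [p.as_sum]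
  refine Finset.sum_congr rfl fun m _ => ?_
  rw [map_monomial]
  congr 1
  exact Complex.conj_eq_iff_re.1 (hp m)

/-- A tuple of forms that is real up to a constant factor is proportional to a real tuple. -/
theorem exists_real_forms {n r d : ℕ} {φ : (Fin n → ℂ) → Fin r → ℂ}
    (hφ : ∀ i, IsFormFun d fun x => φ x i) {c : ℂ} (hc : ∀ x, φ (star x) = c • star (φ x)) :
    ∃ (f : Fin r → MvPolynomial (Fin n) ℝ) (s : ℂ), s ≠ 0 ∧ (∀ i, (f i).IsHomogeneous d) ∧
      ∀ x i, MvPolynomial.aeval x (f i) = s * φ x i := by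
  choose p hp hpφ using hφ
  have hcoeff : ∀ i m, star ((p i).coeff m) = star c * (p i).coeff m := by
    intro i m
    have : MvPolynomial.map (starRingEnd ℂ) (p i) = MvPolynomial.C (star c) * p i := by
      refine MvPolynomial.funext fun x => ?_
      rw [MvPolynomial.eval_map_conj, map_mul, MvPolynomial.eval_C, hpφ, hpφ]
      simp [hc]
    have := congrArg (MvPolynomial.coeff m) this
    rwa [MvPolynomial.coeff_map, MvPolynomial.coeff_C_mul] at this
  obtain ⟨s, hs, hsr⟩ : ∃ s : ℂ, s ≠ 0 ∧
      ∀ i m, star (s * (p i).coeff m) = s * (p i).coeff m := by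
    by_cases h : ∀ i m, (p i).coeff m = 0
    · exact ⟨1, one_ne_zero, fun i m => by rw [h]; simp⟩
    · push Not at h
      obtain ⟨j, l, hjl⟩ := h
      -- Conjugation multiplies every coefficient by the same constant, so multiplying by the
      -- conjugate of one nonzero coefficient makes all of them real.
      refine ⟨star ((p j).coeff l), star_ne_zero.2 hjl, fun i m => ?_⟩
      rw [star_mul', star_star, hcoeff i m, hcoeff j l]
      ring
  choose f hf using fun i => MvPolynomial.exists_map_ofReal_eq (MvPolynomial.C s * p i)
    (fun m => by rw [MvPolynomial.coeff_C_mul]; exact hsr i m)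
  refine ⟨f, s, hs, fun i => ?_, fun x i => ?_⟩
  · refine MvPolynomial.IsHomogeneous.of_map (f := algebraMap ℝ ℂ) Complex.ofReal_injective ?_
    rw [hf]
    simpa using (MvPolynomial.isHomogeneous_C _ s).mul (hp i)
  · rw [MvPolynomial.aeval_def, ← MvPolynomial.eval_map, hf, map_mul, MvPolynomial.eval_C, hpφ]

/-- Complex conjugation preserves the cubic and either preserves or exchanges the two lines. -/
structure RealSkewLines (T : Trilinear) (ℓ₁ ℓ₂ : Submodule ℂ (Fin 4 → ℂ))
    (P Q : (Fin 4 → ℂ) →ₗ[ℂ] (Fin 4 → ℂ)) : Prop extends SkewLines T ℓ₁ ℓ₂ P Q where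
  conj : ∀ v, T (star v) (star v) (star v) = star (T v v v)
  real : (IsRealSubspace ℓ₁ ∧ IsRealSubspace ℓ₂) ∨ AreConjugate ℓ₁ ℓ₂

namespace RealSkewLines

variable {T : Trilinear} {ℓ₁ ℓ₂ : Submodule ℂ (Fin 4 → ℂ)}
  {P Q : (Fin 4 → ℂ) →ₗ[ℂ] (Fin 4 → ℂ)}

theorem proj_star (S : RealSkewLines T ℓ₁ ℓ₂ P Q) :
    (∀ v, P (star v) = star (P v) ∧ Q (star v) = star (Q v)) ∨
      ∀ v, P (star v) = star (Q v) ∧ Q (star v) = star (P v) := by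
  rcases S.real with ⟨h₁, h₂⟩ | h
  · left
    intro v
    have := S.proj_add (h₁ _ (S.mem₁ v)) (h₂ _ (S.mem₂ v))
    rwa [← star_add, S.add] at this
  · right
    intro v
    have := S.proj_add ((h _).2 (by rw [star_star]; exact S.mem₂ v)) ((h _).1 (S.mem₁ v))
    rwa [← star_add, add_comm, S.add] at this

/-- The behaviour under conjugation is given only for the values `T v v v`; this expresses `A`
through such values. -/
theorem formA_eq (S : SkewLines T ℓ₁ ℓ₂ P Q) (v : Fin 4 → ℂ) :
    formA T P Q v = (T v v v - T (P v - Q v) (P v - Q v) (P v - Q v)) / 2 := by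
  have h1 := S.cubic_eq_add v
  have h2 := S.cubic_transversal v 1 (-1)
  rw [one_smul, neg_one_smul, ← sub_eq_add_neg] at h2
  linear_combination (-1 / 2) * h1 + (1 / 2) * h2

/-- If conjugation exchanges the lines, it exchanges `P` with `Q` and `A` with `B`, so `B P v - A Q
v` changes sign; otherwise the constant is 1. -/
theorem thirdVec_star (S : RealSkewLines T ℓ₁ ℓ₂ P Q) :
    ∃ e : ℂ, ∀ v, thirdVec T P Q (star v) = e • star (thirdVec T P Q v) := by
  have hB : ∀ v, formB T P Q v = T v v v - formA T P Q v := fun v => by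
    rw [S.cubic_eq_add]; ring
  rcases S.proj_star with h | h
  · refine ⟨1, fun v => ?_⟩
    have hA : formA T P Q (star v) = star (formA T P Q v) := by
      rw [formA_eq S.toSkewLines, formA_eq S.toSkewLines, (h v).1, (h v).2, ← star_sub, S.conj,
        S.conj]
      simp
    rw [thirdVec, thirdVec, hB, hB, hA, S.conj, (h v).1, (h v).2, one_smul]
    simp
  · refine ⟨-1, fun v => ?_⟩
    have hA : formA T P Q (star v) = star (formB T P Q v) := by
      rw [hB, formA_eq S.toSkewLines, formA_eq S.toSkewLines, (h v).1, (h v).2, ← star_sub,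
        S.conj, S.conj, ← neg_sub (P v) (Q v)]
      have : ∀ x, T (-x) (-x) (-x) = -T x x x := fun x => by simp
      rw [this]
      simp
      ring
    have hB' : formB T P Q (star v) = star (formA T P Q v) := by
      rw [hB, hA, S.conj, hB]; simp
    rw [thirdVec, thirdVec, hA, hB', (h v).1, (h v).2, neg_one_smul]
    simp

end RealSkewLines

namespace PlaneFrame

variable {T : Trilinear} {ℓ₁ ℓ₂ : Submodule ℂ (Fin 4 → ℂ)}
  {P Q : (Fin 4 → ℂ) →ₗ[ℂ] (Fin 4 → ℂ)} {E : (Fin 3 → ℂ) →ₗ[ℂ] (Fin 4 → ℂ)}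
  {G : (Fin 4 → ℂ) →ₗ[ℂ] (Fin 3 → ℂ)} {h : (Fin 4 → ℂ) →ₗ[ℂ] ℂ} {p₁ a₁ p₂ a₂ : Fin 4 → ℂ}
  {u v w : (Fin 3 → ℂ) →ₗ[ℂ] ℂ} {F : MvPolynomial (Fin 4) ℂ}

/-- The plane is real, so `h` and its conjugate have the same kernel and are proportional;
evaluation at `a₁` gives the factor. -/
theorem h_star (K : PlaneFrame T ℓ₁ ℓ₂ P Q E G h p₁ a₁ p₂ a₂ u v w) (hE : IsRealMap E)
    (x : Fin 4 → ℂ) : h (star x) = h (star a₁) * star (h x) := by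
  have h0 : h (x - h x • a₁) = 0 := by simp [K.h_a₁]
  have h1 : h (star (x - h x • a₁)) = 0 := by
    rw [← K.E_G _ h0, ← hE]
    exact K.h_E _
  rw [star_sub, star_smul, map_sub, map_smul, smul_eq_mul] at h1
  linear_combination h1

theorem G_star (K : PlaneFrame T ℓ₁ ℓ₂ P Q E G h p₁ a₁ p₂ a₂ u v w) (hE : IsRealMap E)
    {x : Fin 4 → ℂ} (hx : h x = 0) : G (star x) = star (G x) := by
  rw [← K.E_G x hx, ← hE, K.G_E, K.G_E]

theorem planeVec_star (K : PlaneFrame T ℓ₁ ℓ₂ P Q E G h p₁ a₁ p₂ a₂ u v w)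
    (S : RealSkewLines T ℓ₁ ℓ₂ P Q) (hE : IsRealMap E) :
    ∃ c : ℂ, ∀ x, G (planeVec P Q h (star x)) = c • star (G (planeVec P Q h x)) := by
  have h0 : ∀ x, h (planeVec P Q h x) = 0 := fun x => by
    simp only [planeVec, map_sub, map_smul, smul_eq_mul]
    ring
  rcases S.proj_star with hs | hs
  · refine ⟨h (star a₁), fun x => ?_⟩
    have : planeVec P Q h (star x) = h (star a₁) • star (planeVec P Q h x) := by
      rw [planeVec, planeVec, (hs x).1, (hs x).2, K.h_star hE (P x), K.h_star hE (Q x), star_sub,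
        star_smul, star_smul, smul_sub, smul_smul, smul_smul]
    rw [this, map_smul, K.G_star hE (h0 x)]
  · refine ⟨-h (star a₁), fun x => ?_⟩
    have : planeVec P Q h (star x) = (-h (star a₁)) • star (planeVec P Q h x) := by
      rw [planeVec, planeVec, (hs x).1, (hs x).2, K.h_star hE (P x), K.h_star hE (Q x), star_sub,
        star_smul, star_smul, neg_smul, smul_sub, smul_smul, smul_smul, neg_sub]
    rw [this, map_smul, K.G_star hE (h0 x)]

theorem w_star (K : PlaneFrame T ℓ₁ ℓ₂ P Q E G h p₁ a₁ p₂ a₂ u v w)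
    (S : RealSkewLines T ℓ₁ ℓ₂ P Q) (hE : IsRealMap E) :
    ∃ c : ℂ, ∀ y, w (star y) = c * star (w y) := by
  rcases S.proj_star with hs | hs
  · refine ⟨h (star a₁), fun y => ?_⟩
    rw [← (K.h_proj y).1, ← (K.h_proj _).1, hE, (hs _).1, K.h_star hE]
  · refine ⟨-h (star a₁), fun y => ?_⟩
    have : w y = -h (Q (E y)) := by rw [(K.h_proj y).2, neg_neg]
    rw [← (K.h_proj (star y)).1, hE, (hs _).1, K.h_star hE, this]
    simp

theorem cubicVec_star (K : PlaneFrame T ℓ₁ ℓ₂ P Q E G h p₁ a₁ p₂ a₂ u v w)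
    (S : RealSkewLines T ℓ₁ ℓ₂ P Q) (hE : IsRealMap E) :
    ∃ c : ℂ, ∀ y, cubicVec T P Q E p₁ a₁ p₂ a₂ u v w (star y) =
      c • star (cubicVec T P Q E p₁ a₁ p₂ a₂ u v w y) := by
  obtain ⟨e, hT⟩ := S.thirdVec_star
  obtain ⟨c, hw⟩ := K.w_star S hE
  obtain ⟨y₀, hy₀⟩ := K.exists_sourceFun_ne
  have hw₀ : w y₀ ≠ 0 := left_ne_zero_of_mul hy₀
  set φ := cubicVec T P Q E p₁ a₁ p₂ a₂ u v w with hφ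
  have hform : ∀ i, IsFormFun 3 fun y => φ y i := isFormFun_cubicVec
  -- The transformation rule is known for `thirdVec`, which is `w` times the cubics; `w` is
  -- cancelled because polynomial functions have no zero divisors.
  have key : ∀ y i, w y * (φ y i - (e * star c) * star (φ (star y) i)) = 0 := by
    intro y i
    have h1 := hT (E (star y))
    rw [← hE, star_star, K.thirdVec_E, K.thirdVec_E, hw] at h1
    have h2 := congrFun h1 i
    simp only [Pi.smul_apply, Pi.star_apply, smul_eq_mul, star_mul', star_star] at h2
    linear_combination h2
  have hzero : ∀ y i, φ y i - (e * star c) * star (φ (star y) i) = 0 := fun y i =>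
    (IsFormFun.linear w).eq_zero_of_mul_eq_zero
      ((hform i).sub ((hform i).conj.const_mul (e * star c))) (fun y => key y i) hw₀ y
  refine ⟨e * star c, fun y => ?_⟩
  ext i
  have := hzero (star y) i
  rw [star_star] at this
  exact sub_eq_zero.1 this

theorem exists_real_forms (K : PlaneFrame T ℓ₁ ℓ₂ P Q E G h p₁ a₁ p₂ a₂ u v w)
    (S : RealSkewLines T ℓ₁ ℓ₂ P Q) (hER : IsRealMap E)
    (hF : ∀ v, MvPolynomial.eval v F = T v v v) (hE : Function.Injective E) :
    IsBirationalOver ℝ Set.univ (surface F) (planeMap F ℓ₁ ℓ₂ E hE) ∧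
      IsGivenByFormsOver ℝ 3 (planeMap F ℓ₁ ℓ₂ E hE) := by
  obtain ⟨c, hc⟩ := K.cubicVec_star S hER
  obtain ⟨c', hc'⟩ := K.planeVec_star S hER
  obtain ⟨f, s, hs, hf3, hf⟩ := _root_.exists_real_forms isFormFun_cubicVec hc
  obtain ⟨g, s', hs', hg2, hg⟩ := _root_.exists_real_forms
    (φ := fun x => G (planeVec P Q h x)) (isFormFun_planeVec G) hc'
  refine ⟨K.isBirationalOver hF hE hs hs' hf3 hg2 hf hg, f, hf3, fun r hr => ?_,
    fun x y hy => K.sendsTo_of_mem_planeMap hF hE hs hf hy⟩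
  -- A real common factor is also a common factor of the complex cubics, hence a nonzero constant;
  -- the remaining lines bring this back to `ℝ`.
  have hu : IsUnit (MvPolynomial.map (algebraMap ℝ ℂ) r) := by
    refine K.isUnit_of_forall_dvd
      (f := fun i => MvPolynomial.C s⁻¹ * MvPolynomial.map (algebraMap ℝ ℂ) (f i))
      (fun y i => ?_) (fun i => (map_dvd (MvPolynomial.map (algebraMap ℝ ℂ)) (hr i)).mul_left _)
    rw [map_mul, MvPolynomial.eval_C, MvPolynomial.eval_map, ← MvPolynomial.aeval_def, hf,
      inv_mul_cancel_left₀ hs]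
  rw [MvPolynomial.isUnit_iff_eq_C_of_isReduced] at hu ⊢
  obtain ⟨z, hz, hrz⟩ := hu
  have hr : r = MvPolynomial.C (MvPolynomial.coeff 0 r) := by
    ext m
    by_cases hm : m = 0
    · rw [hm]; simp
    · rw [MvPolynomial.coeff_C, if_neg (Ne.symm hm)]
      have := congrArg (MvPolynomial.coeff m) hrz
      rw [MvPolynomial.coeff_map, MvPolynomial.coeff_C, if_neg (Ne.symm hm)] at this
      exact Complex.ofReal_injective (by simpa using this)
  refine ⟨MvPolynomial.coeff 0 r, ?_, hr⟩
  have := congrArg (MvPolynomial.coeff 0) hrz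
  rw [MvPolynomial.coeff_map, MvPolynomial.coeff_C, if_pos rfl] at this
  rw [isUnit_iff_ne_zero] at hz ⊢
  rintro h0
  rw [h0, map_zero] at this
  exact hz this.symm

end PlaneFrame

/-! ### The five transversals contained in the surface -/

section Quintic

open Polynomial

/-- The resultant of `A` and `B` along the line through `b₀` and `b₁`, eliminating the coordinates
given by `c₀`, `c₁`. -/
noncomputable def quintic (T : Trilinear) (b₀ b₁ c₀ c₁ : Fin 4 → ℂ) : ℂ[X] :=
  (C (T b₀ c₀ c₀) * X + C (T b₁ c₀ c₀)) *
      (C (T b₀ b₀ c₁) * X ^ 2 + C (2 * T b₀ b₁ c₁) * X + C (T b₁ b₁ c₁)) ^ 2 -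
    2 * (C (T b₀ c₀ c₁) * X + C (T b₁ c₀ c₁)) *
      ((C (T b₀ b₀ c₀) * X ^ 2 + C (2 * T b₀ b₁ c₀) * X + C (T b₁ b₁ c₀)) *
        (C (T b₀ b₀ c₁) * X ^ 2 + C (2 * T b₀ b₁ c₁) * X + C (T b₁ b₁ c₁))) +
    (C (T b₀ c₁ c₁) * X + C (T b₁ c₁ c₁)) *
      (C (T b₀ b₀ c₀) * X ^ 2 + C (2 * T b₀ b₁ c₀) * X + C (T b₁ b₁ c₀)) ^ 2

theorem natDegree_quintic_le (T : Trilinear) (b₀ b₁ c₀ c₁ : Fin 4 → ℂ) :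
    (quintic T b₀ b₁ c₀ c₁).natDegree ≤ 5 := by
  unfold quintic
  compute_degree

/-- The leading coefficient is the value of the resultant at the point at infinity `b₀` of the
parametrisation `z b₀ + b₁`. -/
theorem coeff_quintic (T : Trilinear) (b₀ b₁ c₀ c₁ : Fin 4 → ℂ) :
    (quintic T b₀ b₁ c₀ c₁).coeff 5 = T b₀ c₀ c₀ * T b₀ b₀ c₁ ^ 2 -
      2 * T b₀ c₀ c₁ * (T b₀ b₀ c₀ * T b₀ b₀ c₁) + T b₀ c₁ c₁ * T b₀ b₀ c₀ ^ 2 := by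
  unfold quintic
  compute_degree
  all_goals decide

end Quintic

/-- The point of the second line, spanned by `c₀` and `c₁`, at which `T x x` vanishes. -/
noncomputable def residualPt (T : Trilinear) (c₀ c₁ x : Fin 4 → ℂ) : Fin 4 → ℂ :=
  T x x c₁ • c₀ - T x x c₀ • c₁

namespace SkewLines

variable {T : Trilinear} {ℓ₁ ℓ₂ : Submodule ℂ (Fin 4 → ℂ)}
  {P Q : (Fin 4 → ℂ) →ₗ[ℂ] (Fin 4 → ℂ)}

theorem polar_residual (c₀ c₁ x : Fin 4 → ℂ) : T x x (residualPt T c₀ c₁ x) = 0 := by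
  simp only [residualPt, map_sub, map_smul, smul_eq_mul]
  ring

theorem cubic_residual (S : SkewLines T ℓ₁ ℓ₂ P Q) (c₀ c₁ x : Fin 4 → ℂ) :
    T x (residualPt T c₀ c₁ x) (residualPt T c₀ c₁ x) = T x c₀ c₀ * T x x c₁ ^ 2 -
      2 * T x c₀ c₁ * (T x x c₀ * T x x c₁) + T x c₁ c₁ * T x x c₀ ^ 2 := by
  have e : T x c₁ c₀ = T x c₀ c₁ := S.swap₂ _ _ _
  simp only [residualPt, map_sub, map_smul, LinearMap.sub_apply, LinearMap.smul_apply, smul_eq_mul,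
    e]
  ring

theorem residual_ne_zero (S : SkewLines T ℓ₁ ℓ₂ P Q) {c₀ c₁ x : Fin 4 → ℂ}
    (hli : ∀ s t : ℂ, s • c₀ + t • c₁ = 0 → s = 0 ∧ t = 0)
    (hspan : ∀ y ∈ ℓ₂, ∃ s t : ℂ, y = s • c₀ + t • c₁) (hx : x ∈ ℓ₁) (hx0 : x ≠ 0) :
    residualPt T c₀ c₁ x ≠ 0 := by
  intro h
  rw [residualPt, sub_eq_add_neg, ← neg_smul] at h
  obtain ⟨h1, h2⟩ := hli _ _ h
  obtain ⟨b, hb, hne⟩ := S.exists_polar_ne hx hx0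
  obtain ⟨s, t, rfl⟩ := hspan b hb
  exact hne (by simp [h1, neg_eq_zero.1 h2])

theorem residual_mem {c₀ c₁ : Fin 4 → ℂ} (h₀ : c₀ ∈ ℓ₂) (h₁ : c₁ ∈ ℓ₂) (x : Fin 4 → ℂ) :
    residualPt T c₀ c₁ x ∈ ℓ₂ :=
  ℓ₂.sub_mem (ℓ₂.smul_mem _ h₀) (ℓ₂.smul_mem _ h₁)

/-- The nonzero functional `T x x` on the two-dimensional `ℓ₂` has a one-dimensional kernel, which
contains both vectors. -/
theorem exists_residual_eq_smul (S : SkewLines T ℓ₁ ℓ₂ P Q) {c₀ c₁ x b : Fin 4 → ℂ}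
    (hli : ∀ s t : ℂ, s • c₀ + t • c₁ = 0 → s = 0 ∧ t = 0)
    (hspan : ∀ y ∈ ℓ₂, ∃ s t : ℂ, y = s • c₀ + t • c₁) (hx : x ∈ ℓ₁) (hx0 : x ≠ 0)
    (hb : b ∈ ℓ₂) (hb0 : b ≠ 0) (h : T x x b = 0) :
    ∃ k : ℂ, k ≠ 0 ∧ residualPt T c₀ c₁ x = k • b := by
  have hne := S.residual_ne_zero hli hspan hx hx0
  obtain ⟨r, q, rfl⟩ := hspan b hb
  simp only [map_add, map_smul, smul_eq_mul] at h
  obtain ⟨k, hk⟩ : ∃ k : ℂ, residualPt T c₀ c₁ x = k • (r • c₀ + q • c₁) := by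
    by_cases hr : r = 0
    · have hq : q ≠ 0 := by
        rintro rfl
        exact hb0 (by simp [hr])
      have h1 : T x x c₁ = 0 := by simpa [hr, hq] using h
      refine ⟨-T x x c₀ / q, ?_⟩
      rw [residualPt, h1, hr, zero_smul, zero_add, zero_sub, smul_smul,
        div_mul_cancel₀ _ hq, neg_smul]
    · refine ⟨T x x c₁ / r, ?_⟩
      have e : T x x c₁ / r * q = -T x x c₀ := by
        field_simp
        linear_combination h
      rw [residualPt, smul_add, smul_smul, smul_smul, div_mul_cancel₀ _ hr, e, neg_smul,
        sub_eq_add_neg]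
  refine ⟨k, ?_, hk⟩
  rintro rfl
  exact hne (by rw [hk, zero_smul])

/-- Thus `z` is a root exactly when `x = z b₀ + b₁` and its residual point `J` satisfy `T x J J =
0`; as `T x x J = 0` always holds, their span then lies on the surface if the vectors are in the two
lines. -/
theorem eval_quintic (S : SkewLines T ℓ₁ ℓ₂ P Q) (b₀ b₁ c₀ c₁ : Fin 4 → ℂ) (z : ℂ) :
    (quintic T b₀ b₁ c₀ c₁).eval z = T (z • b₀ + b₁) (residualPt T c₀ c₁ (z • b₀ + b₁))
      (residualPt T c₀ c₁ (z • b₀ + b₁)) := by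
  have e : ∀ c, T (z • b₀ + b₁) (z • b₀ + b₁) c =
      T b₀ b₀ c * z ^ 2 + 2 * T b₀ b₁ c * z + T b₁ b₁ c := fun c => by
    have := S.square_add b₀ b₁ c z 1
    rw [one_smul] at this
    rw [this]; ring
  have e' : ∀ c d, T (z • b₀ + b₁) c d = T b₀ c d * z + T b₁ c d := fun c d => by
    simp [mul_comm]
  rw [S.cubic_residual, e, e, e', e', e']
  simp [quintic]

/-- Differentiate `T x J J` and the identity `T x x J = 0` along `b₀`. At a double root, eliminating
the derivative of `J` from the two relations gives the vanishing of the determinant in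
`jacobian_ne`. -/
theorem derivative_quintic_ne_zero (S : SkewLines T ℓ₁ ℓ₂ P Q) {b₀ b₁ c₀ c₁ : Fin 4 → ℂ}
    (hb₀ : b₀ ∈ ℓ₁) (hb₁ : b₁ ∈ ℓ₁) (hc₀ : c₀ ∈ ℓ₂) (hc₁ : c₁ ∈ ℓ₂)
    (hb : ∀ s t : ℂ, s • b₀ + t • b₁ = 0 → s = 0 ∧ t = 0)
    (hbs : ∀ y ∈ ℓ₁, ∃ s t : ℂ, y = s • b₀ + t • b₁)
    (hc : ∀ s t : ℂ, s • c₀ + t • c₁ = 0 → s = 0 ∧ t = 0)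
    (hcs : ∀ y ∈ ℓ₂, ∃ s t : ℂ, y = s • c₀ + t • c₁) {z : ℂ}
    (hz : (quintic T b₀ b₁ c₀ c₁).eval z = 0) :
    (quintic T b₀ b₁ c₀ c₁).derivative.eval z ≠ 0 := by
  intro hd
  obtain ⟨x, hx⟩ : ∃ x, x = z • b₀ + b₁ := ⟨_, rfl⟩
  obtain ⟨J, hJ⟩ : ∃ J, J = residualPt T c₀ c₁ x := ⟨_, rfl⟩
  have hxm : x ∈ ℓ₁ := hx ▸ ℓ₁.add_mem (ℓ₁.smul_mem _ hb₀) hb₁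
  have hx0 : x ≠ 0 := by
    rw [hx]
    intro h0
    have := (hb z 1 (by rw [one_smul, h0])).2
    simp at this
  have hJm : J ∈ ℓ₂ := hJ ▸ residual_mem hc₀ hc₁ x
  have hJ0 : J ≠ 0 := hJ ▸ S.residual_ne_zero hc hcs hxm hx0
  have hxs : ∀ y ∈ ℓ₁, ∃ s t : ℂ, y = s • x + t • b₀ := by
    intro y hy
    obtain ⟨s, t, rfl⟩ := hbs y hy
    refine ⟨t, s - t * z, ?_⟩
    rw [hx, smul_add, smul_smul, sub_smul]
    abel
  obtain ⟨b', -, -, hJs⟩ := Submodule.exists_span_pair S.rank₂ hJm hJ0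
  have hxxJ : T x x J = 0 := hJ ▸ polar_residual c₀ c₁ x
  have hxJJ : T x J J = 0 := by
    rw [hJ, hx, ← S.eval_quintic, hz]
  -- The vector decomposed here is the derivative of the residual point in the direction `b₀`; its
  -- `J`-component contributes nothing below.
  obtain ⟨c, d, hcd⟩ := hJs ((2 * T x b₀ c₁) • c₀ - (2 * T x b₀ c₀) • c₁)
    (ℓ₂.sub_mem (ℓ₂.smul_mem _ hc₀) (ℓ₂.smul_mem _ hc₁))
  refine S.jacobian_ne hxm hJm hx0 hJ0 hxs hJs hxxJ hxJJ ?_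
  have hx' : x = z • b₀ + (1 : ℂ) • b₁ := by rw [hx, one_smul]
  have e2 : ∀ c, T x x c = T b₀ b₀ c * z ^ 2 + 2 * T b₀ b₁ c * z + T b₁ b₁ c := fun c => by
    rw [hx', S.square_add]; ring
  have e1 : ∀ c d, T x c d = T b₀ c d * z + T b₁ c d := fun c d => by
    rw [hx]; simp [mul_comm]
  have e1' : ∀ c, T x b₀ c = T b₀ b₀ c * z + T b₀ b₁ c := fun c => by
    rw [e1, S.swap₁ b₁]
  have ec : ∀ u, T u c₁ c₀ = T u c₀ c₁ := fun u => S.swap₂ _ _ _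
  -- the derivative of `T x J J`
  have E1 : T b₀ J J + 2 * (d * T x J b') = 0 := by
    have h1 : T x J ((2 * T x b₀ c₁) • c₀ - (2 * T x b₀ c₀) • c₁) = d * T x J b' := by
      rw [hcd, map_add, map_smul, map_smul, hxJJ]; simp
    rw [← h1, hJ]
    simp only [residualPt, map_sub, map_smul, LinearMap.sub_apply, LinearMap.smul_apply,
      smul_eq_mul, ec]
    rw [e2, e2, e1', e1', e1, e1, e1]
    simp only [quintic, Polynomial.derivative_add, Polynomial.derivative_sub,
      Polynomial.derivative_mul, Polynomial.derivative_pow, Polynomial.derivative_X,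
      Polynomial.derivative_C, Polynomial.derivative_ofNat, Polynomial.eval_add,
      Polynomial.eval_sub, Polynomial.eval_mul, Polynomial.eval_pow, Polynomial.eval_X,
      Polynomial.eval_C, Polynomial.eval_ofNat, Polynomial.eval_zero, Polynomial.eval_one,
      Nat.cast_ofNat] at hd
    linear_combination hd
  -- the derivative of `T x x J`
  have E2 : 2 * T x b₀ J + d * T x x b' = 0 := by
    have h1 : T x x ((2 * T x b₀ c₁) • c₀ - (2 * T x b₀ c₀) • c₁) = d * T x x b' := by
      rw [hcd, map_add, map_smul, map_smul, hxxJ]; simp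
    rw [← h1, hJ]
    simp only [residualPt, map_sub, map_smul, smul_eq_mul]
    ring
  linear_combination T x x b' * E1 - 2 * T x J b' * E2

end SkewLines

/-- The lines in the surface that meet both of the skew lines. -/
def surfaceTransversals (T : Trilinear) (ℓ₁ ℓ₂ : Submodule ℂ (Fin 4 → ℂ)) :
    Set (Submodule ℂ (Fin 4 → ℂ)) :=
  {L | ∃ a ∈ ℓ₁, ∃ b ∈ ℓ₂, a ≠ 0 ∧ b ≠ 0 ∧ T a a b = 0 ∧ T a b b = 0 ∧
    L = Submodule.span ℂ {a, b}}

theorem Submodule.span_smul_pair {V : Type*} [AddCommGroup V] [Module ℂ V] {s t : ℂ} (hs : s ≠ 0)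
    (ht : t ≠ 0) (a b : V) :
    Submodule.span ℂ {s • a, t • b} = Submodule.span ℂ {a, b} := by
  rw [Submodule.span_insert, Submodule.span_insert, Submodule.span_singleton_smul_eq hs.isUnit,
    Submodule.span_singleton_smul_eq ht.isUnit]

namespace SkewLines

variable {T : Trilinear} {ℓ₁ ℓ₂ : Submodule ℂ (Fin 4 → ℂ)}
  {P Q : (Fin 4 → ℂ) →ₗ[ℂ] (Fin 4 → ℂ)}

/-- There are exactly five lines in the surface that meet both of the skew lines. -/
theorem ncard_surfaceTransversals (S : SkewLines T ℓ₁ ℓ₂ P Q) :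
    (surfaceTransversals T ℓ₁ ℓ₂).ncard = 5 := by
  have exists_ne : ∀ {L : Submodule ℂ (Fin 4 → ℂ)}, Module.finrank ℂ L = 2 →
      ∃ a ∈ L, a ≠ 0 := fun {L} hL =>
    L.exists_mem_ne_zero_of_ne_bot (by rintro rfl; simp at hL)
  obtain ⟨c₀, hc₀, hc₀0⟩ := exists_ne S.rank₂
  obtain ⟨c₁, hc₁, hc, hcs⟩ := Submodule.exists_span_pair S.rank₂ hc₀ hc₀0
  -- a point of the first line through which there is no such line
  obtain ⟨b₀, hb₀, hb₀0, hR⟩ : ∃ b ∈ ℓ₁, b ≠ 0 ∧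
      T b (residualPt T c₀ c₁ b) (residualPt T c₀ c₁ b) ≠ 0 := by
    obtain ⟨d₀, hd₀, hd₀0⟩ := exists_ne S.rank₁
    obtain ⟨d₁, hd₁, hd, hds⟩ := Submodule.exists_span_pair S.rank₁ hd₀ hd₀0
    -- A zero quintic would have a multiple root at every `z`.
    have hp : quintic T d₀ d₁ c₀ c₁ ≠ 0 := by
      intro h0
      exact S.derivative_quintic_ne_zero hd₀ hd₁ hc₀ hc₁ hd hds hc hcs (z := 0)
        (by rw [h0, Polynomial.eval_zero]) (by rw [h0]; simp)
    obtain ⟨z, hz⟩ : ∃ z, (quintic T d₀ d₁ c₀ c₁).eval z ≠ 0 := by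
      by_contra! h
      exact hp (Polynomial.funext fun z => by rw [h, Polynomial.eval_zero])
    rw [S.eval_quintic] at hz
    refine ⟨z • d₀ + d₁, ℓ₁.add_mem (ℓ₁.smul_mem _ hd₀) hd₁, fun h0 => hz ?_, hz⟩
    rw [h0]; simp
  obtain ⟨b₁, hb₁, hb, hbs⟩ := Submodule.exists_span_pair S.rank₁ hb₀ hb₀0
  set p := quintic T b₀ b₁ c₀ c₁ with hp
  have hdeg : p.natDegree = 5 := by
    refine Polynomial.natDegree_eq_of_le_of_coeff_ne_zero (natDegree_quintic_le ..) ?_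
    rw [hp, coeff_quintic, ← S.cubic_residual]
    exact hR
  have hp0 : p ≠ 0 := by
    intro h0
    rw [h0] at hdeg
    simp at hdeg
  have hnodup : p.roots.Nodup := by
    rw [Multiset.nodup_iff_count_le_one]
    intro z
    rw [Polynomial.count_roots]
    by_contra! h
    have := (Polynomial.one_lt_rootMultiplicity_iff_isRoot hp0).1 h
    exact S.derivative_quintic_ne_zero hb₀ hb₁ hc₀ hc₁ hb hbs hc hcs this.1 this.2
  have hcard : p.roots.toFinset.card = 5 := by
    rw [Multiset.toFinset_card_of_nodup hnodup, ← hdeg]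
    exact (IsAlgClosed.splits p).natDegree_eq_card_roots.symm
  let x : ℂ → Fin 4 → ℂ := fun z => z • b₀ + b₁
  have hxm : ∀ z, x z ∈ ℓ₁ := fun z => ℓ₁.add_mem (ℓ₁.smul_mem _ hb₀) hb₁
  have hx0 : ∀ z, x z ≠ 0 := by
    intro z h0
    have := (hb z 1 (by rw [one_smul]; exact h0)).2
    simp at this
  have hJm : ∀ z, residualPt T c₀ c₁ (x z) ∈ ℓ₂ := fun z => residual_mem hc₀ hc₁ _
  have hJ0 : ∀ z, residualPt T c₀ c₁ (x z) ≠ 0 := fun z =>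
    S.residual_ne_zero hc hcs (hxm z) (hx0 z)
  have himage : surfaceTransversals T ℓ₁ ℓ₂ =
      (fun z => Submodule.span ℂ {x z, residualPt T c₀ c₁ (x z)}) '' (p.roots.toFinset : Set ℂ) := by
    ext L
    constructor
    · rintro ⟨a, ha, b, hbm, ha0, hb0, haab, habb, rfl⟩
      obtain ⟨s, t, rfl⟩ := hbs a ha
      -- By the choice of `b₀`, no contained transversal passes through it, so all of them appear at
      -- finite parameters.
      have ht : t ≠ 0 := by
        rintro rfl
        rw [zero_smul, add_zero] at ha0 haab habb
        have hs : s ≠ 0 := by rintro rfl; simp at ha0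
        have h1 : T b₀ b₀ b = 0 := by simpa [hs] using haab
        have h2 : T b₀ b b = 0 := by simpa [hs] using habb
        obtain ⟨k, -, hk⟩ := S.exists_residual_eq_smul hc hcs hb₀ hb₀0 hbm hb0 h1
        apply hR
        rw [hk]; simp [h2]
      have e : s • b₀ + t • b₁ = t • x (s / t) := by
        simp only [x]
        rw [smul_add, smul_smul, mul_div_cancel₀ _ ht]
      rw [e] at haab habb ⊢
      have h1 : T (x (s / t)) (x (s / t)) b = 0 := by simpa [ht] using haab
      have h2 : T (x (s / t)) b b = 0 := by simpa [ht] using habb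
      obtain ⟨k, hk0, hk⟩ := S.exists_residual_eq_smul hc hcs (hxm _) (hx0 _) hbm hb0 h1
      refine ⟨s / t, ?_, ?_⟩
      · simp only [Finset.mem_coe, Multiset.mem_toFinset, Polynomial.mem_roots hp0]
        rw [Polynomial.IsRoot, hp, S.eval_quintic]
        change T (x (s / t)) (residualPt T c₀ c₁ (x (s / t))) (residualPt T c₀ c₁ (x (s / t))) = 0
        rw [hk]; simp [h2]
      · have e1 := Submodule.span_smul_pair ht one_ne_zero (x (s / t)) b
        have e2 := Submodule.span_smul_pair one_ne_zero hk0 (x (s / t)) b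
        rw [one_smul] at e1 e2
        simp only
        rw [hk, e1, e2]
    · rintro ⟨z, hz, rfl⟩
      simp only [Finset.mem_coe, Multiset.mem_toFinset, Polynomial.mem_roots hp0] at hz
      rw [Polynomial.IsRoot, hp, S.eval_quintic] at hz
      exact ⟨x z, hxm z, _, hJm z, hx0 z, hJ0 z, polar_residual _ _ _, hz, rfl⟩
  have hinj : Set.InjOn (fun z => Submodule.span ℂ {x z, residualPt T c₀ c₁ (x z)})
      (p.roots.toFinset : Set ℂ) := by
    intro z _ z' _ hzz'
    simp only at hzz'
    have hmem : x z ∈ Submodule.span ℂ {x z', residualPt T c₀ c₁ (x z')} :=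
      hzz' ▸ Submodule.subset_span (by simp)
    obtain ⟨s, t, hst⟩ := Submodule.mem_span_pair.1 hmem
    have h1 := (S.add_eq_add (ℓ₁.smul_mem s (hxm z')) (hxm z) (ℓ₂.smul_mem t (hJm z'))
      ℓ₂.zero_mem (by rw [hst, add_zero])).1
    have h2 : (s * z' - z) • b₀ + (s - 1) • b₁ = 0 := by
      simp only [x] at h1
      rw [sub_smul, sub_smul, mul_smul, one_smul, sub_add_sub_comm, ← smul_add, h1, sub_self]
    obtain ⟨h3, h4⟩ := hb _ _ h2
    rw [sub_eq_zero.1 h4, one_mul] at h3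
    exact (sub_eq_zero.1 h3).symm
  rw [himage, hinj.ncard_image, Set.ncard_coe_finset, hcard]

end SkewLines

/-! ### Real transversals and real planes -/

/-- The complex conjugate of a linear subspace. -/
def conjSubspace (W : Submodule ℂ (Fin 4 → ℂ)) : Submodule ℂ (Fin 4 → ℂ) where
  carrier := {v | star v ∈ W}
  add_mem' ha hb := by
    simp only [Set.mem_ofPred_eq, star_add] at *
    exact W.add_mem ha hb
  zero_mem' := by simp
  smul_mem' c v hv := by
    simp only [Set.mem_ofPred_eq, star_smul] at *
    exact W.smul_mem _ hv

theorem mem_conjSubspace {W : Submodule ℂ (Fin 4 → ℂ)} {v : Fin 4 → ℂ} :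
    v ∈ conjSubspace W ↔ star v ∈ W := Iff.rfl

theorem conjSubspace_conjSubspace (W : Submodule ℂ (Fin 4 → ℂ)) :
    conjSubspace (conjSubspace W) = W := by
  ext v
  rw [mem_conjSubspace, mem_conjSubspace, star_star]

theorem conjSubspace_span_pair (a b : Fin 4 → ℂ) :
    conjSubspace (Submodule.span ℂ {a, b}) = Submodule.span ℂ {star a, star b} := by
  ext v
  rw [mem_conjSubspace, Submodule.mem_span_pair, Submodule.mem_span_pair]
  constructor
  · rintro ⟨s, t, h⟩
    refine ⟨star s, star t, ?_⟩
    rw [← star_smul, ← star_smul, ← star_add, h, star_star]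
  · rintro ⟨s, t, h⟩
    refine ⟨star s, star t, ?_⟩
    rw [← h, star_add, star_smul, star_smul, star_star, star_star]

/-- The vectors `x + star x` and `i (x - star x)` are real and span `x`, so they cannot both lie in
`W'`. -/
theorem IsRealSubspace.exists_real_notMem {W W' : Submodule ℂ (Fin 4 → ℂ)}
    (hW : IsRealSubspace W) (h : ¬ W ≤ W') : ∃ v ∈ W, star v = v ∧ v ∉ W' := by
  obtain ⟨x, hx, hx'⟩ := Set.not_subset.1 h
  by_cases h1 : x + star x ∈ W'
  · refine ⟨Complex.I • (x - star x), W.smul_mem _ (W.sub_mem hx (hW x hx)), ?_, fun h2 => ?_⟩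
    · rw [star_smul, star_sub, star_star]
      simp only [Complex.star_def, Complex.conj_I, neg_smul, ← smul_neg, neg_sub]
    · apply hx'
      have : x = (1 / 2 : ℂ) • ((x + star x) - Complex.I • (Complex.I • (x - star x))) := by
        rw [smul_smul, Complex.I_mul_I, neg_one_smul, sub_neg_eq_add, add_add_sub_cancel,
          ← two_smul ℂ x, smul_smul]
        norm_num
      rw [this]
      exact W'.smul_mem _ (W'.sub_mem h1 (W'.smul_mem _ h2))
  · exact ⟨x + star x, W.add_mem hx (hW x hx), by rw [star_add, star_star, add_comm], h1⟩

namespace RealSkewLines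

variable {T : Trilinear} {ℓ₁ ℓ₂ : Submodule ℂ (Fin 4 → ℂ)}
  {P Q : (Fin 4 → ℂ) →ₗ[ℂ] (Fin 4 → ℂ)}

theorem polar_conj (S : RealSkewLines T ℓ₁ ℓ₂ P Q) (u v : Fin 4 → ℂ) :
    T (star u) (star u) (star v) = star (T u u v) := by
  have h : ∀ u v, 6 * T u u v = T (u + v) (u + v) (u + v) - T (u - v) (u - v) (u - v) -
      2 * T v v v := by
    intro u v
    have h1 := S.cubic_add u v 1 1
    have h2 := S.cubic_add u v 1 (-1)
    rw [one_smul, one_smul] at h1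
    rw [one_smul, neg_one_smul, ← sub_eq_add_neg] at h2
    linear_combination h2 - h1
  have h1 := h (star u) (star v)
  rw [← star_add, ← star_sub, S.conj, S.conj, S.conj] at h1
  have h2 := congrArg star (h u v)
  simp only [star_sub, star_mul'] at h2
  simp only [Complex.star_def, map_ofNat] at h1 h2
  rw [← h2] at h1
  exact mul_left_cancel₀ (by norm_num) h1

/-- When conjugation exchanges the lines, the points `a` and `b` change roles, and so do the two
vanishing conditions. -/
theorem conjSubspace_mem (S : RealSkewLines T ℓ₁ ℓ₂ P Q) {L : Submodule ℂ (Fin 4 → ℂ)}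
    (hL : L ∈ surfaceTransversals T ℓ₁ ℓ₂) : conjSubspace L ∈ surfaceTransversals T ℓ₁ ℓ₂ := by
  obtain ⟨a, ha, b, hb, ha0, hb0, haab, habb, rfl⟩ := hL
  have e : ∀ x y z, T x y z = T z x y := fun x y z => by rw [S.swap₂, S.swap₁]
  rw [conjSubspace_span_pair]
  have h1 : T (star a) (star a) (star b) = 0 := by rw [S.polar_conj, haab, star_zero]
  have h2 : T (star a) (star b) (star b) = 0 := by
    rw [← e, S.polar_conj, e, habb, star_zero]
  rcases S.real with ⟨hr₁, hr₂⟩ | hr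
  · exact ⟨star a, hr₁ a ha, star b, hr₂ b hb, star_ne_zero.2 ha0, star_ne_zero.2 hb0, h1, h2, rfl⟩
  · refine ⟨star b, (hr _).2 (by rwa [star_star]), star a, (hr _).1 ha, star_ne_zero.2 hb0,
      star_ne_zero.2 ha0, ?_, ?_, by rw [Set.pair_comm]⟩
    · rw [e]; exact h2
    · rw [← e]; exact h1

/-- Conjugation acts as an involution on the five contained transversals; five is odd, so one of
them is fixed. -/
theorem exists_real_transversal (S : RealSkewLines T ℓ₁ ℓ₂ P Q) {F : MvPolynomial (Fin 4) ℂ}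
    (hF : ∀ v, MvPolynomial.eval v F = T v v v) :
    ∃ m, IsLineOn F m ∧ m ⊓ ℓ₁ ≠ ⊥ ∧ m ⊓ ℓ₂ ≠ ⊥ ∧ IsRealSubspace m := by
  have hcard := S.ncard_surfaceTransversals
  have : Fintype (surfaceTransversals T ℓ₁ ℓ₂) :=
    (Set.finite_of_ncard_ne_zero (by rw [hcard]; norm_num)).fintype
  rw [Set.ncard_eq_toFinset_card', Set.toFinset_card] at hcard
  let σ : Equiv.Perm (surfaceTransversals T ℓ₁ ℓ₂) :=
    { toFun := fun L => ⟨conjSubspace L, S.conjSubspace_mem L.2⟩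
      invFun := fun L => ⟨conjSubspace L, S.conjSubspace_mem L.2⟩
      left_inv := fun L => Subtype.ext (conjSubspace_conjSubspace _)
      right_inv := fun L => Subtype.ext (conjSubspace_conjSubspace _) }
  have hσ : σ ^ 2 ^ 1 = 1 := by
    ext1 L
    exact Subtype.ext (conjSubspace_conjSubspace L.1)
  obtain ⟨⟨m, hm⟩, hfix⟩ := Equiv.Perm.exists_fixed_point_of_prime (p := 2) (n := 1)
    (by rw [hcard]; norm_num) hσ
  have hfix' : conjSubspace m = m := congrArg Subtype.val hfix
  obtain ⟨a, ha, b, hb, ha0, hb0, haab, habb, rfl⟩ := hm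
  refine ⟨_, ⟨S.finrank_span_pair ha hb ha0 hb0, fun v hv => ?_⟩,
    (SkewLines.inf_span_pair_ne ha hb ha0 hb0).1, (SkewLines.inf_span_pair_ne ha hb ha0 hb0).2,
    fun v hv => ?_⟩
  · obtain ⟨s, t, rfl⟩ := Submodule.mem_span_pair.1 hv
    rw [hF, S.cubic_add, S.zero₁ _ ha, S.zero₂ _ hb, haab, habb]
    ring
  · rw [← hfix'] at hv
    exact hv

theorem exists_real_plane (S : RealSkewLines T ℓ₁ ℓ₂ P Q) {F : MvPolynomial (Fin 4) ℂ}
    (hF : ∀ v, MvPolynomial.eval v F = T v v v) :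
    ∃ (m H : Submodule ℂ (Fin 4 → ℂ)) (E : (Fin 3 → ℂ) →ₗ[ℂ] (Fin 4 → ℂ)),
      IsAdmissible F ℓ₁ ℓ₂ m H ∧ IsRealSubspace m ∧ IsRealSubspace H ∧
        Function.Injective E ∧ LinearMap.range E = H ∧ IsRealMap E := by
  obtain ⟨m, hm, hm₁, hm₂, hmR⟩ := S.exists_real_transversal hF
  have hm2 := hm.1
  obtain ⟨r₁, hr₁, hr₁R, hr₁0⟩ := hmR.exists_real_notMem (W' := ⊥)
    (by rw [le_bot_iff]; rintro rfl; simp at hm2)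
  rw [Submodule.mem_bot] at hr₁0
  obtain ⟨r₂, hr₂, hr₂R, hr₂n⟩ := hmR.exists_real_notMem (W' := Submodule.span ℂ {r₁}) (by
    intro hle
    have := Submodule.finrank_mono hle
    rw [hm2, finrank_span_singleton hr₁0] at this
    omega)
  have hli : ∀ s t : ℂ, s • r₁ + t • r₂ = 0 → s = 0 ∧ t = 0 := by
    have : LinearIndependent ℂ ![r₁, r₂] := by
      rw [LinearIndependent.pair_iff' hr₁0]
      exact fun c hc => hr₂n (Submodule.mem_span_singleton.2 ⟨c, hc⟩)
    exact LinearIndependent.pair_iff.1 this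
  have hmspan : m = Submodule.span ℂ {r₁, r₂} := by
    symm
    apply Submodule.eq_of_le_of_finrank_eq
    · rw [Submodule.span_le]; rintro y (rfl | rfl) <;> assumption
    · have := finrank_span_eq_card (LinearIndependent.pair_iff.2 hli)
      rw [Matrix.range_cons, Matrix.range_cons, Matrix.range_empty, Set.union_empty,
        Set.singleton_union] at this
      rw [hm2]
      simpa using this
  have htop : IsRealSubspace ⊤ := fun _ _ => Submodule.mem_top
  -- Since `m` meets `ℓ`, their sum has dimension at most three.
  have hsup : ∀ ℓ : Submodule ℂ (Fin 4 → ℂ), Module.finrank ℂ ℓ = 2 → m ⊓ ℓ ≠ ⊥ →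
      ¬ (⊤ : Submodule ℂ (Fin 4 → ℂ)) ≤ m ⊔ ℓ := by
    intro ℓ hℓ hne htop
    have h1 := Submodule.finrank_sup_add_finrank_inf_eq m ℓ
    rw [top_le_iff.1 htop, hm2, hℓ, finrank_top] at h1
    have h2 := Submodule.one_le_finrank_iff.2 hne
    rw [Module.finrank_fin_fun] at h1
    omega
  -- One of `e₁`, `e₂`, `e₁ + e₂` avoids both proper subspaces. The plane spanned by `m` and `e`
  -- cannot contain `ℓ₁` or `ℓ₂`, as it would then be the sum of `m` with that line and exclude `e`.
  obtain ⟨e, heR, he₁, he₂⟩ : ∃ e : Fin 4 → ℂ, star e = e ∧ e ∉ m ⊔ ℓ₁ ∧ e ∉ m ⊔ ℓ₂ := by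
    obtain ⟨e₁, -, he₁R, he₁⟩ := htop.exists_real_notMem (hsup ℓ₁ S.rank₁ hm₁)
    obtain ⟨e₂, -, he₂R, he₂⟩ := htop.exists_real_notMem (hsup ℓ₂ S.rank₂ hm₂)
    by_cases h1 : e₁ ∈ m ⊔ ℓ₂
    · by_cases h2 : e₂ ∈ m ⊔ ℓ₁
      · exact ⟨e₁ + e₂, by rw [star_add, he₁R, he₂R],
          fun h => he₁ (by simpa using (m ⊔ ℓ₁).sub_mem h h2),
          fun h => he₂ (by simpa using (m ⊔ ℓ₂).sub_mem h h1)⟩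
      · exact ⟨e₂, he₂R, h2, he₂⟩
    · exact ⟨e₁, he₁R, he₁, h1⟩
  let E : (Fin 3 → ℂ) →ₗ[ℂ] (Fin 4 → ℂ) := (LinearMap.proj 0).smulRight r₁ +
    (LinearMap.proj 1).smulRight r₂ + (LinearMap.proj 2).smulRight e
  have hE : ∀ y, E y = y 0 • r₁ + y 1 • r₂ + y 2 • e := fun y => rfl
  have hrm : ∀ s t : ℂ, s • r₁ + t • r₂ ∈ m := fun s t =>
    m.add_mem (m.smul_mem _ hr₁) (m.smul_mem _ hr₂)
  have hinj : Function.Injective E := by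
    rw [← LinearMap.ker_eq_bot, LinearMap.ker_eq_bot']
    intro y hy
    rw [hE] at hy
    have h2 : y 2 = 0 := by
      by_contra h2
      apply he₁
      have : e = -(y 2)⁻¹ • (y 0 • r₁ + y 1 • r₂) := by
        rw [eq_neg_of_add_eq_zero_left hy, smul_neg, neg_smul, neg_neg, smul_smul,
          inv_mul_cancel₀ h2, one_smul]
      rw [this]
      exact Submodule.smul_mem _ _ (Submodule.mem_sup_left (hrm _ _))
    rw [h2, zero_smul, add_zero] at hy
    obtain ⟨h0, h1⟩ := hli _ _ hy
    ext i
    fin_cases i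
    · exact h0
    · exact h1
    · exact h2
  have hReal : IsRealMap E := by
    intro y
    rw [hE, hE, star_add, star_add, star_smul, star_smul, star_smul, hr₁R, hr₂R, heR]
    rfl
  have hnle : ∀ ℓ : Submodule ℂ (Fin 4 → ℂ), ¬ ℓ ≤ m → e ∉ m ⊔ ℓ → ¬ ℓ ≤ LinearMap.range E := by
    intro ℓ hℓm heℓ hle
    obtain ⟨x, hx, hxm⟩ := Set.not_subset.1 hℓm
    obtain ⟨y, hy⟩ := hle hx
    rw [hE] at hy
    have h2 : y 2 ≠ 0 := by
      intro h2
      rw [h2, zero_smul, add_zero] at hy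
      exact hxm (hy ▸ hrm _ _)
    apply heℓ
    have : e = (y 2)⁻¹ • (x - (y 0 • r₁ + y 1 • r₂)) := by
      rw [← hy, add_sub_cancel_left, smul_smul, inv_mul_cancel₀ h2, one_smul]
    rw [this]
    exact Submodule.smul_mem _ _ (Submodule.sub_mem _ (Submodule.mem_sup_right hx)
      (Submodule.mem_sup_left (hrm _ _)))
  have hne₁ : ¬ ℓ₁ ≤ m := by
    intro hle
    have := Submodule.eq_of_le_of_finrank_eq hle (by rw [S.rank₁, hm2])
    exact hm₂ (by rw [← this, S.disj])
  have hne₂ : ¬ ℓ₂ ≤ m := by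
    intro hle
    have := Submodule.eq_of_le_of_finrank_eq hle (by rw [S.rank₂, hm2])
    exact hm₁ (by rw [← this, inf_comm, S.disj])
  refine ⟨m, LinearMap.range E, E, ⟨hm, hm₁, hm₂, ?_, ?_, hnle ℓ₁ hne₁ he₁, hnle ℓ₂ hne₂ he₂⟩,
    hmR, ?_, hinj, rfl, hReal⟩
  · rw [LinearMap.finrank_range_of_inj hinj]; simp
  · intro x hx
    rw [hmspan] at hx
    obtain ⟨s, t, rfl⟩ := Submodule.mem_span_pair.1 hx
    exact ⟨![s, t, 0], by rw [hE]; simp⟩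
  · rintro _ ⟨y, rfl⟩
    exact ⟨star y, hReal y⟩

end RealSkewLines

/-! ### The main theorem. -/

theorem theorem3p1 (F : MvPolynomial (Fin 4) ℂ) (hF : IsSmoothCubic F)
    (ℓ₁ ℓ₂ : Submodule ℂ (Fin 4 → ℂ)) (h₁ : IsLineOn F ℓ₁) (h₂ : IsLineOn F ℓ₂)
    (hskew : ℓ₁ ⊓ ℓ₂ = ⊥) :
    -- the construction, for every admissible line `m` and plane `H`
    (∀ m H : Submodule ℂ (Fin 4 → ℂ), IsAdmissible F ℓ₁ ℓ₂ m H →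
      -- existence and uniqueness of the line through `x` that meets `ℓ₁` and `ℓ₂`
      (∀ x : PSpace 4, x.submodule ≤ H → ¬ x.submodule ≤ ℓ₁ → ¬ x.submodule ≤ ℓ₂ →
        ∃! L, IsTransversal ℓ₁ ℓ₂ x L) ∧
      -- the map is defined at `x` when this line does not lie on the surface
      (∀ x : PSpace 4, x.submodule ≤ H → ¬ x.submodule ≤ ℓ₁ → ¬ x.submodule ≤ ℓ₂ →
        ∀ L, IsTransversal ℓ₁ ℓ₂ x L → ¬ LiesOn F L → (thirdPointMap F ℓ₁ ℓ₂ x).Dom) ∧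
      -- in any linear coordinates on `H`, it is birational and given by cubic forms
      (∀ (E : (Fin 3 → ℂ) →ₗ[ℂ] (Fin 4 → ℂ)) (hE : Function.Injective E),
        LinearMap.range E = H →
          IsBirationalOver ℂ Set.univ (surface F) (planeMap F ℓ₁ ℓ₂ E hE) ∧
          IsGivenByFormsOver ℂ 3 (planeMap F ℓ₁ ℓ₂ E hE))) ∧
    -- the real case
    ((∃ F₀ : MvPolynomial (Fin 4) ℝ, F = MvPolynomial.map (algebraMap ℝ ℂ) F₀) →
      ((IsRealSubspace ℓ₁ ∧ IsRealSubspace ℓ₂) ∨ AreConjugate ℓ₁ ℓ₂) →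
      -- there are a real line `m`, a real plane `H` and real coordinates on `H`
      (∃ (m H : Submodule ℂ (Fin 4 → ℂ)) (E : (Fin 3 → ℂ) →ₗ[ℂ] (Fin 4 → ℂ)),
        IsAdmissible F ℓ₁ ℓ₂ m H ∧ IsRealSubspace m ∧ IsRealSubspace H ∧
        Function.Injective E ∧ LinearMap.range E = H ∧ IsRealMap E) ∧
      -- for all such choices the map is birational over `ℝ`, given by real cubic forms
      (∀ (m H : Submodule ℂ (Fin 4 → ℂ)) (E : (Fin 3 → ℂ) →ₗ[ℂ] (Fin 4 → ℂ))
        (hE : Function.Injective E),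
        IsAdmissible F ℓ₁ ℓ₂ m H → IsRealSubspace m → IsRealSubspace H →
        LinearMap.range E = H → IsRealMap E →
          IsBirationalOver ℝ Set.univ (surface F) (planeMap F ℓ₁ ℓ₂ E hE) ∧
          IsGivenByFormsOver ℝ 3 (planeMap F ℓ₁ ℓ₂ E hE))) := by
  obtain ⟨T, hs₁, hs₂, hT, hsm⟩ := hF.exists_polarization
  obtain ⟨P, Q, hP, hQ, hPQ⟩ := exists_projections h₁.1 h₂.1 hskew
  have S : SkewLines T ℓ₁ ℓ₂ P Q :=
    { swap₁ := hs₁, swap₂ := hs₂, smooth := hsm, rank₁ := h₁.1, rank₂ := h₂.1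
      zero₁ := fun v hv => by rw [← hT, h₁.2 v hv]
      zero₂ := fun v hv => by rw [← hT, h₂.2 v hv]
      disj := hskew, mem₁ := hP, mem₂ := hQ, add := hPQ }
  refine ⟨fun m H hadm => ⟨fun x _ hx₁ hx₂ => S.existsUnique_isTransversal x hx₁ hx₂,
    fun x _ hx₁ hx₂ L hL hLF => S.thirdPointMap_dom hT x hx₁ hx₂ L hL hLF,
    fun E hE hEH => ?_⟩, ?_⟩
  · obtain ⟨G, h, p₁, a₁, p₂, a₂, u, v, w, K⟩ := S.exists_planeFrame hT hadm hE hEH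
    exact K.exists_forms hT hE
  · rintro ⟨F₀, hF₀⟩ hreal
    have R : RealSkewLines T ℓ₁ ℓ₂ P Q :=
      { S with
        conj := fun v => by rw [← hT, ← hT, hF₀, MvPolynomial.eval_star_map]
        real := hreal }
    refine ⟨R.exists_real_plane hT, fun m H E hE hadm _ _ hEH hER => ?_⟩
    obtain ⟨G, h, p₁, a₁, p₂, a₂, u, v, w, K⟩ := S.exists_planeFrame hT hadm hE hEH
    exact K.exists_real_forms R hER hT hE
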